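/- Let $\overline M$ be a compact oriented 3-manifold whose boundary is a union of tori $T_1,\dots,T_c$ (the cusps), decomposed into finitely many truncated tetrahedra glued in pairs along all their hexagonal faces by orientation-reversing maps (an ideal triangulation $\tau$ of $M=\overline M\smallsetminus\partial\overline M$); the truncation triangles triangulate $\partial\overline M$. *Angle structures.* A generalized angle structure on $\tau$ assigns a real number $\theta_j$ to every pair of opposite edges of every tetrahedron, so that the three numbers of each tetrahedron have sum $\pi$ and the angles around each interior edge have sum $2\pi$. It is nonnegative if all $\theta_j\ge 0$, and taut if all $\theta_j\in\{0,\pi\}$. A taut angle structure is veering if at each vertex $v$ of $\partial\overline M$ either every boundary triangle with angle $0$ at $v$ has its $\pi$-angle at the corner immediately before $v$ in counterclockwise order ($v$ is left-veering), or every such triangle has its $\pi$-angle at the corner immediately after $v$ ($v$ is right-veering). *Ladders.* Given a veering structure, the edges of $\partial\overline M$ that join two vertices veering in the same direction form disjoint essential closed curves, which cut each $T_i$ into an even number $2k_i$ of parallel annuli, the ladders; their core curves define the slope of the ladders in $H_1(T_i,\mathbb Z)\simeq\mathbb Z^2$, up to sign. *Holonomy.* For an oriented embedded closed curve $\gamma\subset\partial\overline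 M$ that is normal (transverse to the edges, entering and leaving each triangle through different edges), each arc of $\gamma$ in a triangle cuts off one corner; the turning angle of $\gamma$ is the sum of the angles of these corners lying to the left of $\gamma$ minus the sum of those lying to its right. If $[\gamma]\neq 0$ in $H_1(\partial\overline M,\mathbb Z)$ and $n\in\mathbb Z$, the angular holonomy $h_\theta(n[\gamma])$ is $n$ times the turning angle of $\gamma$; it depends only on the class $n[\gamma]$. **Proposition.** Suppose that $\tau$ carries a veering structure, and let $2k_i$ be the number of ladders in $T_i$. For each $i$, let $\delta_i\in H_1(T_i,\mathbb Z)\subset H_1(\partial\overline M,\mathbb Z)$ be a class that spans a complement of the subgroup spanned by the slope of the ladders of $T_i$, i.e. $H_1(T_i,\mathbb Z)$ is the direct sum of these two cyclic subgroups. Then, for all signs $\varepsilon_1,\dots,\varepsilon_c\in\{-1,1\}$, there is a nonnegative angle structure $\theta$ on $\tau$ such that $$h_\theta(\delta_i)=\frac{\varepsilon_i k_i\pi}{2}\qquad\text{for all } i\in\{1,\dots,c\}.$$ More generally, for all real numbers $x_1,\dots,x_c$ with $|x_i|\le k_i\pi/2$ for every $i$, there is a nonnegative angle structure $\theta$ on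 $\tau$ such that $h_\theta(\delta_i)=x_i$ for all $i$. -/

import Mathlib

noncomputable section

/-- An oriented ideal triangulation, as a gluing of the oriented tetrahedra `t : ι`, each with
vertices `0, 1, 2, 3` (listed in a positive order).  The face of `t` opposite to the vertex `f` is
glued to a face of `nbr t f` by the bijection of vertices `perm t f`, which sends the three vertices
of the face to those of the face it is glued to, and `f` to the vertex opposite to that face.
Faces are glued in pairs (`nbr_nbr`, `perm_perm`, `no_fixed_face`), by orientation-reversing maps
(`perm_odd`), so that the truncated tetrahedra form a compact oriented 3-manifold with boundary. -/
structure IdealTriangulation (ι : Type*) where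
  nbr : ι → Fin 4 → ι
  perm : ι → Fin 4 → Equiv.Perm (Fin 4)
  perm_odd : ∀ t f, Equiv.Perm.sign (perm t f) = -1
  nbr_nbr : ∀ t f, nbr (nbr t f) (perm t f f) = t
  perm_perm : ∀ t f, perm (nbr t f) (perm t f f) = (perm t f)⁻¹
  no_fixed_face : ∀ t f, ¬ (nbr t f = t ∧ perm t f f = f)

namespace IdealTriangulation

variable {ι : Type*}

/-! ### The triangulated boundary surface -/

/-- A corner of a boundary triangle.  The flag `(t, g)`, with `g` an even permutation, stands for
the tetrahedron `t` with its vertices positively ordered as `(g 0, g 1, g 2, g 3)`.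
Truncating `t` at `g 0` yields a boundary triangle whose corners, in counterclockwise order, lie on
the edges of `t` from `g 0` to `g 1`, to `g 2` and to `g 3`; the flag is the first of these corners.
A flag also stands for the side of its triangle that is opposite to its corner; that side lies in
the face of `t` opposite to `g 1`, and runs counterclockwise from the corner of `g 2` to the one of
`g 3`. -/
abbrev Corner (_K : IdealTriangulation ι) : Type _ := ι × alternatingGroup (Fin 4)

/-- The cyclic permutation `1 ↦ 2 ↦ 3 ↦ 1`. -/
def cyc : alternatingGroup (Fin 4) :=
  ⟨Equiv.swap 1 2 * Equiv.swap 2 3, Equiv.Perm.mem_alternatingGroup.2 (by decide)⟩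

/-- The next corner, in counterclockwise order, of the same boundary triangle: it replaces
`(g 0, g 1, g 2, g 3)` by `(g 0, g 2, g 3, g 1)`. -/
def ccw (K : IdealTriangulation ι) : Equiv.Perm K.Corner where
  toFun c := (c.1, c.2 * cyc)
  invFun c := (c.1, c.2 * cyc⁻¹)
  left_inv c := by simp
  right_inv c := by simp

/-- The flag across the side opposite to `c`: with `σ` the gluing of the face opposite to `g 1`, it
lists the vertices of the adjacent tetrahedron as `(σ (g 0), σ (g 1), σ (g 3), σ (g 2))`. -/
def crossFun (K : IdealTriangulation ι) (c : K.Corner) : K.Corner :=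
  (K.nbr c.1 (c.2.1 1), ⟨K.perm c.1 (c.2.1 1) * c.2.1 * Equiv.swap 2 3, by
    have h : Equiv.Perm.sign c.2.1 = 1 := Equiv.Perm.mem_alternatingGroup.1 c.2.2
    rw [Equiv.Perm.mem_alternatingGroup, map_mul, map_mul, K.perm_odd, h,
      Equiv.Perm.sign_swap (by decide)]
    rfl⟩)

theorem crossFun_crossFun (K : IdealTriangulation ι) (c : K.Corner) :
    K.crossFun (K.crossFun c) = c := by
  obtain ⟨t, g, hg⟩ := c
  have h1 : (K.perm t (g 1) * g * Equiv.swap 2 3 : Equiv.Perm (Fin 4)) 1 =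
      K.perm t (g 1) (g 1) := by
    simp only [Equiv.Perm.mul_apply]
    rw [Equiv.swap_apply_of_ne_of_ne (by decide) (by decide)]
  refine Prod.ext ?_ (Subtype.ext ?_)
  · simp only [crossFun, h1, K.nbr_nbr]
  · simp only [crossFun, h1, K.perm_perm]
    simp [mul_assoc]

/-- The gluing of the sides of the boundary triangles: the sides `c` and `cross c` are glued, with
opposite directions, to one edge of the boundary surface. -/
def cross (K : IdealTriangulation ι) : Equiv.Perm K.Corner where
  toFun := K.crossFun
  invFun := K.crossFun
  left_inv := K.crossFun_crossFun
  right_inv := K.crossFun_crossFun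

/-- The next corner, in counterclockwise order, around the same vertex of the boundary surface.
The cycles of `rot` are the vertices of the boundary surface, that is, the ends of the interior
edges of the manifold. -/
def rot (K : IdealTriangulation ι) : Equiv.Perm K.Corner := K.ccw * K.cross * K.ccw

/-- The cusps: connected components of the boundary surface. -/
def Cusp (K : IdealTriangulation ι) : Type _ :=
  Quot fun c d : K.Corner => d = K.ccw c ∨ d = K.cross c

/-- The cusp that contains a corner. -/
def cuspOf (K : IdealTriangulation ι) (c : K.Corner) : K.Cusp := Quot.mk _ c

/-! ### Angle structures -/

/-- The index of the pair of opposite edges of a tetrahedron containing the edge `vw`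
(the value for `v = w` is irrelevant). -/
def edgePair (v w : Fin 4) : Fin 3 :=
  (![![0, 0, 1, 2], ![0, 0, 2, 1], ![1, 2, 0, 0], ![2, 1, 0, 0]] : Fin 4 → Fin 4 → Fin 3) v w

/-- The angle at a corner, for an assignment of a real number to each pair of opposite edges of each
tetrahedron. -/
def angle (K : IdealTriangulation ι) (θ : ι → Fin 3 → ℝ) (c : K.Corner) : ℝ :=
  θ c.1 (edgePair (c.2.1 0) (c.2.1 1))

open Classical in
/-- Generalized angle structures.  The corners around a vertex of the boundary surface correspond to
the dihedral angles around the interior edge that ends at this vertex. -/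
def IsGeneralizedAngleStructure [Fintype ι] (K : IdealTriangulation ι) (θ : ι → Fin 3 → ℝ) : Prop :=
  (∀ t, ∑ j, θ t j = Real.pi) ∧
  ∀ c : K.Corner, ∑ c' with K.rot.SameCycle c c', K.angle θ c' = 2 * Real.pi

def IsNonnegAngleStructure [Fintype ι] (K : IdealTriangulation ι) (θ : ι → Fin 3 → ℝ) : Prop :=
  K.IsGeneralizedAngleStructure θ ∧ ∀ t j, 0 ≤ θ t j

def IsTautAngleStructure [Fintype ι] (K : IdealTriangulation ι) (θ : ι → Fin 3 → ℝ) : Prop :=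
  K.IsGeneralizedAngleStructure θ ∧ ∀ t j, θ t j = 0 ∨ θ t j = Real.pi

/-! ### Veering structures and ladders -/

/-- The vertex of the corner `c` is left-veering: every triangle with a thin angle at this vertex
has its wide angle just before it in the counterclockwise order. -/
def LeftVeering (K : IdealTriangulation ι) (α : ι → Fin 3 → ℝ) (c : K.Corner) : Prop :=
  ∀ c', K.rot.SameCycle c c' → K.angle α c' = 0 → K.angle α (K.ccw.symm c') = Real.pi

/-- The vertex of the corner `c` is right-veering: every triangle with a thin angle at this vertex
has its wide angle just after it in the counterclockwise order. -/
def RightVeering (K : IdealTriangulation ι) (α : ι → Fin 3 → ℝ) (c : K.Corner) : Prop :=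
  ∀ c', K.rot.SameCycle c c' → K.angle α c' = 0 → K.angle α (K.ccw c') = Real.pi

def IsVeering [Fintype ι] (K : IdealTriangulation ι) (α : ι → Fin 3 → ℝ) : Prop :=
  K.IsTautAngleStructure α ∧ ∀ c, K.LeftVeering α c ∨ K.RightVeering α c

/-- The side opposite to `c` is a rung: its two ends veer in different directions.  The other
edges of the boundary surface are the ladderpole segments. -/
def IsRung (K : IdealTriangulation ι) (α : ι → Fin 3 → ℝ) (c : K.Corner) : Prop :=
  (K.LeftVeering α (K.ccw c) ∧ K.RightVeering α (K.ccw.symm c)) ∨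
  (K.RightVeering α (K.ccw c) ∧ K.LeftVeering α (K.ccw.symm c))

/-- The ladders: the components of the boundary surface cut along all ladderpole segments, that is,
the classes of boundary triangles under adjacency across rungs. -/
def Ladder (K : IdealTriangulation ι) (α : ι → Fin 3 → ℝ) : Type _ :=
  Quot fun c d : K.Corner => d = K.ccw c ∨ (K.IsRung α c ∧ d = K.cross c)

/-- The ladder that contains a corner. -/
def ladderOf (K : IdealTriangulation ι) (α : ι → Fin 3 → ℝ) (c : K.Corner) : K.Ladder α :=
  Quot.mk _ c

/-- The number of ladders in a cusp. -/
def ladderCount (K : IdealTriangulation ι) (α : ι → Fin 3 → ℝ) (T : K.Cusp) : ℕ :=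
  {L : K.Ladder α | ∃ c, K.cuspOf c = T ∧ K.ladderOf α c = L}.ncard

/-! ### First homology of the boundary surface

This is the cellular homology of the cell structure dual to the triangulation, whose 0-, 1- and
2-cells are dual to the triangles, edges and vertices. -/

/-- Dual 1-cycles.  The integer `z d` is the number of times that `z` leaves the triangle of `d`
through the side `d`, counted with signs. -/
def cycles (K : IdealTriangulation ι) : AddSubgroup (K.Corner → ℤ) where
  carrier := {z | (∀ d, z (K.cross d) = - z d) ∧
    ∀ d, z d + z (K.ccw d) + z (K.ccw (K.ccw d)) = 0}
  zero_mem' := by simp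
  add_mem' := by
    rintro a b ⟨ha, ha'⟩ ⟨hb, hb'⟩
    refine ⟨fun d => ?_, fun d => ?_⟩
    · simp only [Pi.add_apply, ha, hb]; ring
    · have h1 := ha' d
      have h2 := hb' d
      simp only [Pi.add_apply]; linarith
  neg_mem' := by
    rintro a ⟨ha, ha'⟩
    refine ⟨fun d => ?_, fun d => ?_⟩
    · simp only [Pi.neg_apply, ha]
    · have h1 := ha' d
      simp only [Pi.neg_apply]; linarith

/-- Dual 1-boundaries: the boundaries of the dual 2-chains, which are the integer functions `f` of
the vertices of the boundary surface.  The boundary of a dual 2-cell is the counterclockwise loop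
around the vertex. -/
def boundaries (K : IdealTriangulation ι) : AddSubgroup (K.Corner → ℤ) where
  carrier := {z | ∃ f : K.Corner → ℤ, (∀ c, f (K.rot c) = f c) ∧
    ∀ d, z d = f (K.ccw.symm d) - f (K.ccw d)}
  zero_mem' := ⟨0, by simp, by simp⟩
  add_mem' := by
    rintro a b ⟨f, hf, ha⟩ ⟨g, hg, hb⟩
    refine ⟨f + g, fun c => by simp [hf, hg], fun d => ?_⟩
    simp only [Pi.add_apply, ha, hb]; ring
  neg_mem' := by
    rintro a ⟨f, hf, ha⟩
    refine ⟨-f, fun c => by simp [hf], fun d => ?_⟩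
    simp only [Pi.neg_apply, ha]; ring

/-- The first homology group of the boundary surface, with integer coefficients. -/
abbrev H1 (K : IdealTriangulation ι) : Type _ :=
  K.cycles ⧸ K.boundaries.addSubgroupOf K.cycles

/-- The first homology group of a cusp, as a direct summand of that of the boundary surface: the
classes of the cycles that are supported in this cusp. -/
def cuspH1 (K : IdealTriangulation ι) (T : K.Cusp) : AddSubgroup K.H1 :=
  AddSubgroup.map (QuotientAddGroup.mk' _)
    { carrier := {z : K.cycles | ∀ d, K.cuspOf d ≠ T → z.1 d = 0}
      zero_mem' := by simp
      add_mem' := by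
        intro a b ha hb d hd
        simp [ha d hd, hb d hd]
      neg_mem' := by
        intro a ha d hd
        simp [ha d hd] }

/-! ### Normal curves and holonomy -/

/-- Used in the next definition, whose conventions it follows: the coordinate of the endpoint of the
`i`-th arc that lies on the side running counterclockwise out of the corner cut off by this arc,
increasing away from this corner. -/
def outDist {n : ℕ} (left : ZMod n → Bool) (pos : ZMod n → ℝ) (i : ZMod n) : ℝ :=
  if left i then pos i else - pos (i + 1)

/-- Used in the next definition, whose conventions it follows: the coordinate of the endpoint of the
`i`-th arc that lies on the side running counterclockwise into the corner cut off by this arc,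
reversed so as to increase away from this corner. -/
def inDist {n : ℕ} (left : ZMod n → Bool) (pos : ZMod n → ℝ) (i : ZMod n) : ℝ :=
  if left i then pos (i + 1) else - pos i

/-- An oriented, embedded, normal closed curve in the boundary surface.  It consists of arcs indexed
cyclically by `ZMod len`.  The `i`-th arc cuts off the corner `corner i` of its triangle, which lies
to its left if `left i` holds, and to its right otherwise.

Every edge of the surface is identified with `ℝ`, once from each side, so that the coordinate
increases in the counterclockwise direction of the triangle on this side; the coordinates from the
two sides are opposite numbers.  Then `pos i` is the coordinate of the starting point of the `i`-th
arc, seen from the triangle of this arc. -/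
structure NormalCurve (K : IdealTriangulation ι) where
  len : ℕ
  len_ne_zero : NeZero len
  corner : ZMod len → K.Corner
  left : ZMod len → Bool
  pos : ZMod len → ℝ
  /-- The side through which the `i`-th arc leaves is glued to the side through which the next arc
  enters. -/
  glued : ∀ i, K.cross (if left i then K.ccw (corner i) else K.ccw.symm (corner i)) =
    if left (i + 1) then K.ccw.symm (corner (i + 1)) else K.ccw (corner (i + 1))
  /-- Two arcs that cut off the same corner are disjoint: one of them is closer to the corner on
  both sides. -/
  nested : ∀ i j, i ≠ j → corner i = corner j →
    (outDist left pos i < outDist left pos j ∧ inDist left pos i < inDist left pos j) ∨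
    (outDist left pos j < outDist left pos i ∧ inDist left pos j < inDist left pos i)
  /-- Two arcs that cut off different corners of a triangle are disjoint: on the side that joins the
  two corners, each is closer to its own corner. -/
  separated : ∀ i j, corner j = K.ccw (corner i) → outDist left pos i < - inDist left pos j

namespace NormalCurve

variable {K : IdealTriangulation ι}

attribute [instance] NormalCurve.len_ne_zero

/-- The side through which the `i`-th arc enters its triangle. -/
def entry (γ : K.NormalCurve) (i : ZMod γ.len) : K.Corner :=
  if γ.left i then K.ccw.symm (γ.corner i) else K.ccw (γ.corner i)

/-- The side through which the `i`-th arc leaves its triangle. -/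
def exit (γ : K.NormalCurve) (i : ZMod γ.len) : K.Corner :=
  if γ.left i then K.ccw (γ.corner i) else K.ccw.symm (γ.corner i)

open Classical in
/-- The 1-cycle of a normal curve. -/
def chain (γ : K.NormalCurve) (d : K.Corner) : ℤ :=
  ∑ i, ((if γ.exit i = d then 1 else 0) - (if γ.entry i = d then 1 else 0))

theorem ccw_ccw_ccw (K : IdealTriangulation ι) (c : K.Corner) :
    K.ccw (K.ccw (K.ccw c)) = c := by
  have h : cyc * cyc * cyc = 1 := by
    refine Subtype.ext ?_
    change (Equiv.swap 1 2 * Equiv.swap 2 3 : Equiv.Perm (Fin 4)) *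
      (Equiv.swap 1 2 * Equiv.swap 2 3) * (Equiv.swap 1 2 * Equiv.swap 2 3) = 1
    decide
  refine Prod.ext rfl ?_
  change c.2 * cyc * cyc * cyc = c.2
  rw [mul_assoc, mul_assoc, ← mul_assoc cyc, h, mul_one]

theorem cross_exit (γ : K.NormalCurve) (i : ZMod γ.len) :
    K.cross (γ.exit i) = γ.entry (i + 1) := γ.glued i

theorem cross_cross (K : IdealTriangulation ι) (c : K.Corner) : K.cross (K.cross c) = c :=
  K.crossFun_crossFun c

theorem chain_mem (γ : K.NormalCurve) : γ.chain ∈ K.cycles := by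
  classical
  have hs : ∀ c : K.Corner, K.ccw.symm c = K.ccw (K.ccw c) := fun c => by
    rw [Equiv.symm_apply_eq, ccw_ccw_ccw]
  refine ⟨fun d => ?_, fun d => ?_⟩
  · simp only [chain, Finset.sum_sub_distrib, neg_sub]
    have h1 : ∀ i, (γ.exit i = K.cross d) ↔ (γ.entry (i + 1) = d) := fun i => by
      rw [← γ.cross_exit]
      exact ⟨fun h => by rw [h, cross_cross], fun h => by rw [← h, cross_cross]⟩
    have h2 : ∀ i, (γ.entry (i + 1) = K.cross d) ↔ (γ.exit i = d) := fun i => by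
      rw [← γ.cross_exit, EmbeddingLike.apply_eq_iff_eq]
    congr 1
    · simp only [h1]
      exact Equiv.sum_comp (Equiv.addRight (1 : ZMod γ.len))
        fun i => if γ.entry i = d then (1 : ℤ) else 0
    · rw [← Equiv.sum_comp (Equiv.addRight (1 : ZMod γ.len))]
      simp only [Equiv.coe_addRight, h2]
  · simp only [chain, ← Finset.sum_add_distrib]
    refine Finset.sum_eq_zero fun i _ => ?_
    have key : ∀ c : K.Corner, ((if c = d then (1 : ℤ) else 0) + (if c = K.ccw d then 1 else 0) +
        (if c = K.ccw (K.ccw d) then 1 else 0)) = (if K.ccw c = d then (1 : ℤ) else 0) +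
        (if K.ccw c = K.ccw d then 1 else 0) + (if K.ccw c = K.ccw (K.ccw d) then 1 else 0) := by
      intro c
      have e1 : (K.ccw c = d) ↔ c = K.ccw (K.ccw d) := by
        rw [← hs, Equiv.eq_symm_apply]
      simp only [e1, EmbeddingLike.apply_eq_iff_eq]
      ring
    have k1 := key (K.ccw (γ.corner i))
    rw [← hs (γ.corner i)] at k1
    cases hl : γ.left i
    · simp only [exit, entry, hl, Bool.false_eq_true, if_false]
      linarith
    · simp only [exit, entry, hl, if_true]
      linarith

/-- The homology class of a normal curve. -/
def homologyClass (γ : K.NormalCurve) : K.H1 := QuotientAddGroup.mk ⟨γ.chain, γ.chain_mem⟩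

/-- The turning angle: the sum of the angles to the left of the curve, minus the sum of the angles
to its right. -/
def turningAngle (γ : K.NormalCurve) (θ : ι → Fin 3 → ℝ) : ℝ :=
  ∑ i, if γ.left i then K.angle θ (γ.corner i) else - K.angle θ (γ.corner i)

end NormalCurve

/-- The angular holonomy of the class `δ` is defined and equal to `x`: the class `δ` is a multiple
`n • [γ]` of the class of a homologically nontrivial normal curve, and `n` times the turning angle
of `γ` equals `x`, for every such `γ` and `n`. -/
def HasHolonomy (K : IdealTriangulation ι) (θ : ι → Fin 3 → ℝ) (δ : K.H1) (x : ℝ) : Prop :=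
  (∃ (γ : K.NormalCurve) (n : ℤ), γ.homologyClass ≠ 0 ∧ n • γ.homologyClass = δ) ∧
  ∀ (γ : K.NormalCurve) (n : ℤ), γ.homologyClass ≠ 0 → n • γ.homologyClass = δ →
    n * γ.turningAngle θ = x

/-- A curve in the cusp `T` that runs along a ladder: it crosses no ladderpole segment. -/
def IsLadderCurve (K : IdealTriangulation ι) (α : ι → Fin 3 → ℝ) (T : K.Cusp)
    (γ : K.NormalCurve) : Prop :=
  ∀ i, K.cuspOf (γ.corner i) = T ∧ K.IsRung α (γ.entry i)

/-- The class `δ` belongs to the first homology `≃ ℤ²` of the cusp `T`, and spans there a complement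
of the subgroup spanned by the slope of the ladders. -/
def IsLadderComplement (K : IdealTriangulation ι) (α : ι → Fin 3 → ℝ) (T : K.Cusp)
    (δ : K.H1) : Prop :=
  ∃ γ : K.NormalCurve, K.IsLadderCurve α T γ ∧
    AddSubgroup.zmultiples γ.homologyClass ⊓ AddSubgroup.zmultiples δ = ⊥ ∧
    AddSubgroup.zmultiples γ.homologyClass ⊔ AddSubgroup.zmultiples δ = K.cuspH1 T

end IdealTriangulation

end

set_option linter.unusedSectionVars false

noncomputable section
namespace IdealTriangulation
variable {ι : Type*}

/-! ### Corners and their angles -/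

/-! The angle structure is found among the deformations `α + tetDeform (ladderCycle σ)` of the
veering structure `α`, where `σ` puts a weight on the core curve of every ladder.

A real cycle `w` on the boundary surface gives a deformation `tetDeform w` that preserves the angle
sums of the tetrahedra and around the edges (`IsRealCycle.sum_tetDeform`,
`IsRealCycle.sum_angle_sameCycle`). Its holonomy along a cycle `z` is the intersection pairing of
`w` and `z` (`IsRealCycle.pairing_angle`). For ladder cycles this is `-2 * ∑ A, σ A * crossing A z`
(`IsVeering.pairing_ladderCycle_eq`). A ladder cycle with nonnegative weights takes negative values
only at wide corners, and four corners contribute to each angle. So `0 ≤ σ A ≤ π / 4` keeps all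
angles nonnegative (`IsVeering.isNonnegAngleStructure`).

The structure `α` itself turns by zero along every normal curve that has nonzero translation in the
flat structure below. Indeed `α` differs from `roughAngle`, in which rungs are horizontal and
ladderpoles vertical, by a multiple of the ladder cycle of constant weight. That cycle pairs to zero
with everything, because adjacent ladders are crossed in opposite directions. The turning with
respect to `roughAngle` is computed in a flat structure with vertical ladderpoles and ladders of
width one. The curve develops to a periodic embedded polygonal line in the plane, and Hopf's
Umlaufsatz for such lines (`sum_arg_eq_zero_of_embedded`) says that its total turning vanishes.
Embeddedness of the developed line needs that developed triangles overlap only along common sides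
(`FlatStructure.Inside.adjacent`) and that the translation is nonzero. The horizontal part of the
translation counts crossings with the ladders (`FlatStructure.re_period`), so it does not vanish for
a curve with a multiple in the class `δ T`.

The ladders can be coloured with two colours, adjacent ones differently
(`IsVeering.exists_coloring`). A complement of the ladder slope crosses every ladder of its cusp
once, left to right for one colour and right to left for the other. Giving the `k` ladders of one
colour the weight `|x| / (2 * k)`, and the others weight zero, produces holonomy `|x|` or `-|x|`.
The bound `σ ≤ π / 4` is exactly `|x| ≤ k * π / 2`.

The holonomy is defined by normal curves, so a curve representing `δ T` up to sign must also be
exhibited. `LadderWalk.curve` crosses the ladders one after the other, spiralling upwards in each,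
and the number of turns adjusts its class by any multiple of the core class
(`LadderWalk.exists_curve_add_smul`). -/

theorem ccw_ccw (K : IdealTriangulation ι) (c : K.Corner) : K.ccw (K.ccw c) = K.ccw.symm c := by
  rw [Equiv.eq_symm_apply, NormalCurve.ccw_ccw_ccw]

theorem ccw_symm_symm (K : IdealTriangulation ι) (c : K.Corner) :
    K.ccw.symm (K.ccw.symm c) = K.ccw c := by
  rw [Equiv.symm_apply_eq, ccw_ccw]

theorem cyc_ne_one : cyc ≠ 1 := by
  intro h
  have := congrArg (fun g : alternatingGroup (Fin 4) => g.1 1) h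
  revert this
  decide

theorem ccw_ne (K : IdealTriangulation ι) (c : K.Corner) : K.ccw c ≠ c := by
  intro h
  have h2 : c.2 * cyc = c.2 := congrArg Prod.snd h
  exact cyc_ne_one (by simpa using h2)

theorem ccw_symm_ne (K : IdealTriangulation ι) (c : K.Corner) : K.ccw.symm c ≠ c := by
  intro h
  rw [Equiv.symm_apply_eq] at h
  exact K.ccw_ne c h.symm

theorem ccw_symm_ne_ccw (K : IdealTriangulation ι) (c : K.Corner) : K.ccw.symm c ≠ K.ccw c := by
  intro h
  rw [← ccw_ccw] at h
  exact K.ccw_ne _ h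

theorem cross_cross (K : IdealTriangulation ι) (c : K.Corner) : K.cross (K.cross c) = c :=
  K.crossFun_crossFun c

/-- A fixed flag would give a face glued to itself, against `no_fixed_face`. This is what makes
`flip` fixed-point free, on which the two-colouring of the ladders rests. -/
theorem cross_ne (K : IdealTriangulation ι) (c : K.Corner) : K.cross c ≠ c := by
  obtain ⟨t, g, hg⟩ := c
  intro h
  have h1 : K.nbr t (g 1) = t := congrArg Prod.fst h
  have h2 : K.perm t (g 1) * g * Equiv.swap 2 3 = g :=
    congrArg (fun c : K.Corner => c.2.1) h
  refine K.no_fixed_face t (g 1) ⟨h1, ?_⟩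
  conv_rhs => rw [← h2]
  simp only [Equiv.Perm.mul_apply]
  rw [Equiv.swap_apply_of_ne_of_ne (by decide) (by decide)]

theorem rot_apply (K : IdealTriangulation ι) (c : K.Corner) :
    K.rot c = K.ccw (K.cross (K.ccw c)) := rfl

theorem rot_symm_apply (K : IdealTriangulation ι) (c : K.Corner) :
    K.rot.symm c = K.ccw.symm (K.cross (K.ccw.symm c)) := rfl

theorem rot_ccw_symm (K : IdealTriangulation ι) (d : K.Corner) :
    K.rot (K.ccw.symm d) = K.ccw (K.cross d) := by
  simp [rot_apply]

/-- The three edges at one vertex of a tetrahedron represent the three pairs of opposite edges, once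
each. -/
theorem edgePair_sum (f : Fin 3 → ℝ) (g : Equiv.Perm (Fin 4)) :
    f (edgePair (g 0) (g 1)) + f (edgePair (g 0) (g 2)) + f (edgePair (g 0) (g 3)) =
      ∑ j, f j := by
  have h : ∀ g : Equiv.Perm (Fin 4), ∃ e : Equiv.Perm (Fin 3),
      edgePair (g 0) (g 1) = e 0 ∧ edgePair (g 0) (g 2) = e 1 ∧ edgePair (g 0) (g 3) = e 2 := by
    decide
  obtain ⟨e, h0, h1, h2⟩ := h g
  rw [h0, h1, h2, ← Equiv.sum_comp e f, Fin.sum_univ_three]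

theorem cyc_apply_zero : cyc.1 0 = 0 := by decide
theorem cyc_apply_one : cyc.1 1 = 2 := by decide
theorem cyc_apply_two : cyc.1 2 = 3 := by decide

theorem angle_ccw_sum (K : IdealTriangulation ι) {θ : ι → Fin 3 → ℝ} (c : K.Corner) :
    K.angle θ c + K.angle θ (K.ccw c) + K.angle θ (K.ccw.symm c) = ∑ j, θ c.1 j := by
  rw [← ccw_ccw]
  obtain ⟨t, g⟩ := c
  simp only [angle, ccw, Equiv.coe_fn_mk, Subgroup.coe_mul, Equiv.Perm.mul_apply, cyc_apply_zero,
    cyc_apply_one, cyc_apply_two]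
  exact edgePair_sum (θ t) g.1

/-! ### Veering structures -/

/-- The corners with angle `π`.  Each boundary triangle has exactly one. -/
def IsWide (K : IdealTriangulation ι) (α : ι → Fin 3 → ℝ) (c : K.Corner) : Prop :=
  K.angle α c = Real.pi

section

variable [Fintype ι] {K : IdealTriangulation ι} {α : ι → Fin 3 → ℝ}

theorem IsVeering.angle_eq (hα : K.IsVeering α) (c : K.Corner) :
    K.angle α c = 0 ∨ K.IsWide α c := hα.1.2 _ _

theorem IsVeering.angle_sum (hα : K.IsVeering α) (c : K.Corner) :
    K.angle α c + K.angle α (K.ccw c) + K.angle α (K.ccw.symm c) = Real.pi := by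
  rw [angle_ccw_sum]
  exact hα.1.1.1 _

theorem IsVeering.exists_wide (hα : K.IsVeering α) (c : K.Corner) :
    K.IsWide α c ∨ K.IsWide α (K.ccw c) ∨ K.IsWide α (K.ccw.symm c) := by
  by_contra! h
  have h0 := (hα.angle_eq c).resolve_right h.1
  have h1 := (hα.angle_eq _).resolve_right h.2.1
  have h2 := (hα.angle_eq _).resolve_right h.2.2
  have := hα.angle_sum c
  rw [h0, h1, h2] at this
  linarith [Real.pi_pos]

theorem IsVeering.angle_nonneg (hα : K.IsVeering α) (c : K.Corner) : 0 ≤ K.angle α c := by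
  rcases hα.angle_eq c with h | h
  · exact h.ge
  · exact Real.pi_pos.le.trans_eq (Eq.symm h)

theorem IsVeering.angle_ccw (hα : K.IsVeering α) {c : K.Corner} (h : K.IsWide α c) :
    K.angle α (K.ccw c) = 0 := by
  have h0 : K.angle α c = Real.pi := h
  linarith [hα.angle_sum c, hα.angle_nonneg (K.ccw c), hα.angle_nonneg (K.ccw.symm c)]

theorem IsVeering.angle_ccw_symm (hα : K.IsVeering α) {c : K.Corner} (h : K.IsWide α c) :
    K.angle α (K.ccw.symm c) = 0 := by
  have h0 : K.angle α c = Real.pi := h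
  linarith [hα.angle_sum c, hα.angle_nonneg (K.ccw c), hα.angle_nonneg (K.ccw.symm c)]

theorem not_isWide_of_angle {c : K.Corner} (h : K.angle α c = 0) : ¬ K.IsWide α c := by
  intro h'
  have h0 : K.angle α c = Real.pi := h'
  linarith [Real.pi_pos]

theorem IsVeering.not_wide_ccw (hα : K.IsVeering α) {c : K.Corner} (h : K.IsWide α c) :
    ¬ K.IsWide α (K.ccw c) := not_isWide_of_angle (hα.angle_ccw h)

theorem IsVeering.not_wide_ccw_symm (hα : K.IsVeering α) {c : K.Corner} (h : K.IsWide α c) :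
    ¬ K.IsWide α (K.ccw.symm c) := not_isWide_of_angle (hα.angle_ccw_symm h)

theorem leftVeering_congr {c d : K.Corner} (h : K.rot.SameCycle c d) :
    K.LeftVeering α c ↔ K.LeftVeering α d :=
  ⟨fun H e he => H e (h.trans he), fun H e he => H e (h.symm.trans he)⟩

theorem sameCycle_rot (c : K.Corner) : K.rot.SameCycle c (K.rot c) := ⟨1, by simp⟩

theorem sameCycle_ccw_cross (d : K.Corner) :
    K.rot.SameCycle (K.ccw.symm d) (K.ccw (K.cross d)) := by
  rw [← rot_ccw_symm]; exact sameCycle_rot _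

theorem sameCycle_ccw_symm_cross (d : K.Corner) :
    K.rot.SameCycle (K.ccw.symm (K.cross d)) (K.ccw d) := by
  have := sameCycle_ccw_cross (K := K) (K.cross d)
  rwa [cross_cross] at this

theorem leftVeering_ccw_cross (d : K.Corner) :
    K.LeftVeering α (K.ccw (K.cross d)) ↔ K.LeftVeering α (K.ccw.symm d) :=
  (leftVeering_congr (sameCycle_ccw_cross d)).symm

theorem leftVeering_ccw_symm_cross (d : K.Corner) :
    K.LeftVeering α (K.ccw.symm (K.cross d)) ↔ K.LeftVeering α (K.ccw d) :=
  leftVeering_congr (sameCycle_ccw_symm_cross d)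

/-- The two thin corners of a triangle see its wide corner on different sides. Hence, with
`left_ccw` below, the side opposite to a wide corner always joins a left-veering vertex to a
right-veering one. -/
theorem IsVeering.not_left_ccw_symm (hα : K.IsVeering α) {c : K.Corner} (h : K.IsWide α c) :
    ¬ K.LeftVeering α (K.ccw.symm c) := by
  intro H
  have := H _ (Equiv.Perm.SameCycle.refl _ _) (hα.angle_ccw_symm h)
  rw [ccw_symm_symm] at this
  exact hα.not_wide_ccw h this

theorem IsVeering.not_right_ccw (hα : K.IsVeering α) {c : K.Corner} (h : K.IsWide α c) :
    ¬ K.RightVeering α (K.ccw c) := by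
  intro H
  have := H _ (Equiv.Perm.SameCycle.refl _ _) (hα.angle_ccw h)
  rw [ccw_ccw] at this
  exact hα.not_wide_ccw_symm h this

theorem IsVeering.left_ccw (hα : K.IsVeering α) {c : K.Corner} (h : K.IsWide α c) :
    K.LeftVeering α (K.ccw c) := (hα.2 _).resolve_right (hα.not_right_ccw h)

/-- No vertex of the boundary surface veers in both directions. -/
theorem IsVeering.right_iff (hα : K.IsVeering α) (c : K.Corner) :
    K.RightVeering α c ↔ ¬ K.LeftVeering α c := by
  refine ⟨fun hR hL => ?_, fun h => (hα.2 c).resolve_left h⟩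
  -- A vertex veering both ways has no thin corner. Two consecutive wide corners then give
  -- contradictory veering directions to the far end of the edge between them.
  have hw : ∀ d, K.rot.SameCycle c d → K.IsWide α d := by
    intro d hd
    rcases hα.angle_eq d with h | h
    · exact absurd (hL d hd h) fun h1 => by
        have h2 := hα.not_wide_ccw h1
        rw [Equiv.apply_symm_apply] at h2
        have h3 := hα.not_wide_ccw_symm h1
        rw [ccw_symm_symm] at h3
        exact h3 (hR d hd h)
    · exact h
  have h1 := hw c (Equiv.Perm.SameCycle.refl _ _)
  have h2 := hw (K.rot c) (sameCycle_rot c)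
  have h3 := hα.not_left_ccw_symm h1
  have h4 := hα.left_ccw h2
  rw [rot_apply, ccw_ccw, leftVeering_ccw_symm_cross, ccw_ccw] at h4
  exact h3 h4

theorem IsVeering.isRung_iff (hα : K.IsVeering α) (d : K.Corner) :
    K.IsRung α d ↔ ¬ (K.LeftVeering α (K.ccw d) ↔ K.LeftVeering α (K.ccw.symm d)) := by
  unfold IsRung
  rw [hα.right_iff, hα.right_iff]
  tauto

/-- The veering directions at the ends of a side locate the wide corner of the triangle across: two
of the three positions would force a wrong direction at an end. The next two lemmas treat ladderpole
segments in the same way. -/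
theorem IsVeering.wide_cross (hα : K.IsVeering α) {d : K.Corner}
    (h1 : ¬ K.LeftVeering α (K.ccw d)) (h2 : K.LeftVeering α (K.ccw.symm d)) :
    K.IsWide α (K.cross d) := by
  rw [← leftVeering_ccw_cross] at h2
  rw [← leftVeering_ccw_symm_cross] at h1
  rcases hα.exists_wide (K.cross d) with h | h | h
  · exact h
  · have := hα.left_ccw h
    rw [ccw_ccw] at this
    exact absurd this h1
  · have := hα.not_left_ccw_symm h
    rw [ccw_symm_symm] at this
    exact absurd h2 this

theorem IsVeering.wide_ccw_cross (hα : K.IsVeering α) {d : K.Corner}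
    (h1 : K.LeftVeering α (K.ccw d)) (h2 : K.LeftVeering α (K.ccw.symm d)) :
    K.IsWide α (K.ccw (K.cross d)) := by
  rw [← leftVeering_ccw_cross] at h2
  rw [← leftVeering_ccw_symm_cross] at h1
  rcases hα.exists_wide (K.cross d) with h | h | h
  · exact absurd h1 (hα.not_left_ccw_symm h)
  · exact h
  · have := hα.not_left_ccw_symm h
    rw [ccw_symm_symm] at this
    exact absurd h2 this

theorem IsVeering.wide_ccw_symm_cross (hα : K.IsVeering α) {d : K.Corner}
    (h1 : ¬ K.LeftVeering α (K.ccw d)) (h2 : ¬ K.LeftVeering α (K.ccw.symm d)) :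
    K.IsWide α (K.ccw.symm (K.cross d)) := by
  rw [← leftVeering_ccw_cross] at h2
  rw [← leftVeering_ccw_symm_cross] at h1
  rcases hα.exists_wide (K.cross d) with h | h | h
  · exact absurd (hα.left_ccw h) h2
  · have := hα.left_ccw h
    rw [ccw_ccw] at this
    exact absurd this h1
  · exact h

/-! ### The triangles of the ladders

A boundary triangle is represented by its wide corner `p`.  The side opposite to `p` is its lower
rung; the side `upper p` is its upper rung, and `pole p` its ladderpole segment. -/

variable (K α) in
/-- The type of boundary triangles, represented by their wide corners. -/
abbrev Wide : Type _ := {c : K.Corner // K.IsWide α c}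

variable (K α) in
open Classical in
/-- The upper rung of the triangle with wide corner `p`. -/
def upper (p : K.Corner) : K.Corner :=
  if K.LeftVeering α p then K.ccw p else K.ccw.symm p

variable (K α) in
open Classical in
/-- The ladderpole segment of the triangle with wide corner `p`. -/
def pole (p : K.Corner) : K.Corner :=
  if K.LeftVeering α p then K.ccw.symm p else K.ccw p

variable (K α) in
open Classical in
/-- The wide corner of the triangle across the ladderpole segment of the triangle of `p`. -/
def acrossPole (p : K.Corner) : K.Corner :=
  if K.LeftVeering α p then K.ccw (K.cross (K.ccw.symm p)) else K.ccw.symm (K.cross (K.ccw p))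

theorem upper_of_left {p : K.Corner} (h : K.LeftVeering α p) : K.upper α p = K.ccw p := if_pos h
theorem upper_of_not_left {p : K.Corner} (h : ¬ K.LeftVeering α p) :
    K.upper α p = K.ccw.symm p := if_neg h
theorem pole_of_left {p : K.Corner} (h : K.LeftVeering α p) : K.pole α p = K.ccw.symm p := if_pos h
theorem pole_of_not_left {p : K.Corner} (h : ¬ K.LeftVeering α p) :
    K.pole α p = K.ccw p := if_neg h
theorem acrossPole_of_left {p : K.Corner} (h : K.LeftVeering α p) :
    K.acrossPole α p = K.ccw (K.cross (K.ccw.symm p)) := if_pos h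
theorem acrossPole_of_not_left {p : K.Corner} (h : ¬ K.LeftVeering α p) :
    K.acrossPole α p = K.ccw.symm (K.cross (K.ccw p)) := if_neg h

theorem IsVeering.wide_cross_upper (hα : K.IsVeering α) {p : K.Corner} (hp : K.IsWide α p) :
    K.IsWide α (K.cross (K.upper α p)) := by
  by_cases h : K.LeftVeering α p
  · rw [upper_of_left h]
    refine hα.wide_cross ?_ ?_
    · rw [ccw_ccw]; exact hα.not_left_ccw_symm hp
    · rwa [Equiv.symm_apply_apply]
  · rw [upper_of_not_left h]
    refine hα.wide_cross ?_ ?_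
    · rwa [Equiv.apply_symm_apply]
    · rw [ccw_symm_symm]; exact hα.left_ccw hp

theorem IsVeering.wide_acrossPole (hα : K.IsVeering α) {p : K.Corner} (hp : K.IsWide α p) :
    K.IsWide α (K.acrossPole α p) := by
  by_cases h : K.LeftVeering α p
  · rw [acrossPole_of_left h]
    refine hα.wide_ccw_cross ?_ ?_
    · rwa [Equiv.apply_symm_apply]
    · rw [ccw_symm_symm]; exact hα.left_ccw hp
  · rw [acrossPole_of_not_left h]
    refine hα.wide_ccw_symm_cross ?_ ?_
    · rw [ccw_ccw]; exact hα.not_left_ccw_symm hp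
    · rwa [Equiv.symm_apply_apply]

theorem IsVeering.left_acrossPole (hα : K.IsVeering α) {p : K.Corner} (hp : K.IsWide α p) :
    K.LeftVeering α (K.acrossPole α p) ↔ K.LeftVeering α p := by
  by_cases h : K.LeftVeering α p
  · rw [acrossPole_of_left h, leftVeering_ccw_cross, ccw_symm_symm]
    exact iff_of_true (hα.left_ccw hp) h
  · rw [acrossPole_of_not_left h, leftVeering_ccw_symm_cross, ccw_ccw]
    exact iff_of_false (hα.not_left_ccw_symm hp) h

theorem IsVeering.acrossPole_acrossPole (hα : K.IsVeering α) {p : K.Corner} (hp : K.IsWide α p) :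
    K.acrossPole α (K.acrossPole α p) = p := by
  have h' := hα.left_acrossPole hp
  by_cases h : K.LeftVeering α p
  · rw [acrossPole_of_left (h'.2 h), acrossPole_of_left h]
    simp [cross_cross]
  · rw [acrossPole_of_not_left (mt h'.1 h), acrossPole_of_not_left h]
    simp [cross_cross]

theorem acrossPole_ne (p : K.Corner) : K.acrossPole α p ≠ p := by
  by_cases h : K.LeftVeering α p
  · rw [acrossPole_of_left h]
    intro h'
    rw [← Equiv.eq_symm_apply] at h'
    exact K.cross_ne _ h'
  · rw [acrossPole_of_not_left h]
    intro h'
    rw [Equiv.symm_apply_eq] at h'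
    exact K.cross_ne _ h'

theorem IsVeering.cross_pole (hα : K.IsVeering α) {p : K.Corner} (hp : K.IsWide α p) :
    K.cross (K.pole α p) = K.pole α (K.acrossPole α p) := by
  have h' := hα.left_acrossPole hp
  by_cases h : K.LeftVeering α p
  · rw [pole_of_left (h'.2 h), acrossPole_of_left h, pole_of_left h]
    simp
  · rw [pole_of_not_left (mt h'.1 h), acrossPole_of_not_left h, pole_of_not_left h]
    simp

/-- Two wide corners with the same upper rung lie in one triangle, which has a single wide corner.
By finiteness this makes `up` a permutation. -/
theorem upper_injOn {p q : K.Corner} (hp : K.IsWide α p) (hq : K.IsWide α q)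
    (hα : K.IsVeering α) (h : K.upper α p = K.upper α q) : p = q := by
  by_cases h1 : K.LeftVeering α p <;> by_cases h2 : K.LeftVeering α q
  · rw [upper_of_left h1, upper_of_left h2] at h; exact K.ccw.injective h
  · rw [upper_of_left h1, upper_of_not_left h2] at h
    have : q = K.ccw.symm p := by rw [← ccw_ccw, h, Equiv.apply_symm_apply]
    exact absurd (this ▸ hq) (hα.not_wide_ccw_symm hp)
  · rw [upper_of_not_left h1, upper_of_left h2] at h
    have : p = K.ccw.symm q := by rw [← ccw_ccw, ← h, Equiv.apply_symm_apply]
    exact absurd (this ▸ hp) (hα.not_wide_ccw_symm hq)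
  · rw [upper_of_not_left h1, upper_of_not_left h2] at h; exact K.ccw.symm.injective h

/-- The triangle above a triangle in its ladder. -/
def IsVeering.up (hα : K.IsVeering α) : Equiv.Perm (K.Wide α) :=
  Equiv.ofBijective (fun p => ⟨K.cross (K.upper α p), hα.wide_cross_upper p.2⟩)
    (Finite.injective_iff_bijective.1 fun p q h =>
      Subtype.ext (upper_injOn p.2 q.2 hα (K.cross.injective (congrArg Subtype.val h))))

/-- The triangle across the ladderpole segment of a triangle. -/
def IsVeering.flip (hα : K.IsVeering α) (p : K.Wide α) : K.Wide α :=
  ⟨K.acrossPole α p, hα.wide_acrossPole p.2⟩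

theorem IsVeering.coe_up (hα : K.IsVeering α) (p : K.Wide α) :
    (hα.up p : K.Corner) = K.cross (K.upper α p) := rfl

theorem IsVeering.coe_flip (hα : K.IsVeering α) (p : K.Wide α) :
    (hα.flip p : K.Corner) = K.acrossPole α p := rfl

theorem IsVeering.flip_flip (hα : K.IsVeering α) (p : K.Wide α) : hα.flip (hα.flip p) = p :=
  Subtype.ext (hα.acrossPole_acrossPole p.2)

theorem IsVeering.flip_ne (hα : K.IsVeering α) (p : K.Wide α) : hα.flip p ≠ p :=
  fun h => acrossPole_ne (α := α) p.1 (congrArg Subtype.val h)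

theorem IsVeering.left_flip (hα : K.IsVeering α) (p : K.Wide α) :
    K.LeftVeering α (hα.flip p) ↔ K.LeftVeering α p := hα.left_acrossPole p.2

end
end IdealTriangulation
end

noncomputable section

/-! ### Ladder systems -/

/-- The adjacency structure of triangulated strips, the ladders, that are glued along their two
sides.  A triangle `s` is based on the left side of its strip if `left s` holds, and on the right
side otherwise.  The next triangle of the strip is `up s`, and `flip s` is the triangle glued to
`s` along its base. -/
structure LadderSystem (S : Type*) where
  up : Equiv.Perm S
  flip : S → S
  left : S → Prop
  flip_flip : ∀ s, flip (flip s) = s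
  left_flip : ∀ s, left (flip s) ↔ left s
  exists_same : ∀ s, ∃ m : ℕ, 1 ≤ m ∧ (left ((up ^ m) s) ↔ left s)
  exists_other : ∀ s, ∃ m : ℕ, ¬ (left ((up ^ m) s) ↔ left s)
  return_flip : ∀ (s : S) (m : ℕ), 1 ≤ m → (left ((up ^ m) s) ↔ left s) →
    (∀ r, 1 ≤ r → r < m → ¬ (left ((up ^ r) s) ↔ left s)) →
    up.SameCycle (flip ((up ^ m) s)) (flip s)

namespace LadderSystem

variable {S : Type*} (Λ : LadderSystem S)

theorem sameCycle_up_pow (s : S) (m : ℕ) : Λ.up.SameCycle s ((Λ.up ^ m) s) := ⟨m, by simp⟩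

/-- The way up is cut at the first return to the same side of the strip, where `return_flip`
applies; the rest is shorter. -/
theorem sameCycle_flip_pow (m : ℕ) : ∀ s, (Λ.left ((Λ.up ^ m) s) ↔ Λ.left s) →
    Λ.up.SameCycle (Λ.flip s) (Λ.flip ((Λ.up ^ m) s)) := by
  classical
  induction m using Nat.strong_induction_on with
  | _ m ih =>
    intro s hs
    rcases Nat.eq_zero_or_pos m with rfl | hm
    · simpa using Equiv.Perm.SameCycle.refl _ _
    have hex : ∃ r, 1 ≤ r ∧ (Λ.left ((Λ.up ^ r) s) ↔ Λ.left s) := ⟨m, hm, hs⟩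
    have h1 := (Nat.find_spec hex).1
    have h2 := (Nat.find_spec hex).2
    have h3 : Nat.find hex ≤ m := Nat.find_min' hex ⟨hm, hs⟩
    have h4 := Λ.return_flip s _ h1 h2 fun r hr1 hr2 h => Nat.find_min hex hr2 ⟨hr1, h⟩
    set r := Nat.find hex
    have h5 : (Λ.up ^ (m - r)) ((Λ.up ^ r) s) = (Λ.up ^ m) s := by
      rw [← Equiv.Perm.mul_apply, ← pow_add, Nat.sub_add_cancel h3]
    have h6 := ih (m - r) (by omega) ((Λ.up ^ r) s) (by rw [h5]; exact hs.trans h2.symm)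
    rw [h5] at h6
    exact h4.symm.trans h6

/-- This makes the strip across a given side of a strip well defined. -/
theorem sameCycle_flip {s t : S} (h : Λ.up.SameCycle s t) (hst : Λ.left s ↔ Λ.left t) :
    Λ.up.SameCycle (Λ.flip s) (Λ.flip t) := by
  obtain ⟨n, rfl⟩ := h
  obtain ⟨m, rfl | rfl⟩ := n.eq_nat_or_neg
  · rw [zpow_natCast] at *
    exact Λ.sameCycle_flip_pow m s hst.symm
  · set t := (Λ.up ^ (-(m : ℤ))) s with ht
    have hs : s = (Λ.up ^ m) t := by
      rw [ht, ← zpow_natCast, ← Equiv.Perm.mul_apply, ← zpow_add]; simp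
    rw [hs] at hst
    have := Λ.sameCycle_flip_pow m t hst
    rw [← hs] at this
    exact this.symm

/-- The strips of a ladder system. -/
def Line : Type _ := Quotient (Equiv.Perm.SameCycle.setoid Λ.up)

/-- The strip of a triangle. -/
def line (s : S) : Λ.Line := Quotient.mk _ s

theorem line_eq_iff {s t : S} : Λ.line s = Λ.line t ↔ Λ.up.SameCycle s t := Quotient.eq

theorem exists_line (A : Λ.Line) : ∃ s, Λ.line s = A := Quotient.exists_rep A

@[simp] theorem line_up (s : S) : Λ.line (Λ.up s) = Λ.line s :=
  Λ.line_eq_iff.2 ((Equiv.Perm.SameCycle.refl _ _).apply_left)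

@[simp] theorem line_up_symm (s : S) : Λ.line (Λ.up.symm s) = Λ.line s := by
  rw [← Λ.line_up, Equiv.apply_symm_apply]

@[simp] theorem line_up_pow (m : ℕ) (s : S) : Λ.line ((Λ.up ^ m) s) = Λ.line s :=
  Λ.line_eq_iff.2 (Λ.sameCycle_up_pow s m).symm

theorem exists_line_left (A : Λ.Line) (b : Bool) :
    ∃ s, Λ.line s = A ∧ (Λ.left s ↔ b = true) := by
  obtain ⟨s, rfl⟩ := Λ.exists_line A
  by_cases h : Λ.left s ↔ b = true
  · exact ⟨s, rfl, h⟩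
  · obtain ⟨m, hm⟩ := Λ.exists_other s
    exact ⟨_, Λ.line_up_pow m s, by tauto⟩

/-- The strip glued to the left side (if `b` is true) or to the right side of a strip. -/
def flipLine (b : Bool) (A : Λ.Line) : Λ.Line :=
  Λ.line (Λ.flip (Λ.exists_line_left A b).choose)

theorem flipLine_line {b : Bool} {s : S} (h : Λ.left s ↔ b = true) :
    Λ.flipLine b (Λ.line s) = Λ.line (Λ.flip s) := by
  have h1 := (Λ.exists_line_left (Λ.line s) b).choose_spec
  exact Λ.line_eq_iff.2 (Λ.sameCycle_flip (Λ.line_eq_iff.1 h1.1) (h1.2.trans h.symm))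

theorem flipLine_flipLine (b : Bool) (A : Λ.Line) : Λ.flipLine b (Λ.flipLine b A) = A := by
  obtain ⟨s, rfl, hs⟩ := Λ.exists_line_left A b
  rw [Λ.flipLine_line hs, Λ.flipLine_line ((Λ.left_flip s).trans hs), Λ.flip_flip]

end LadderSystem

namespace IdealTriangulation
variable {ι : Type*}
variable [Fintype ι] {K : IdealTriangulation ι} {α : ι → Fin 3 → ℝ}

/-! ### Walking around a vertex -/

-- The angles around a vertex are `0` or `π` and have sum `2π`.
open Classical in
theorem IsVeering.card_wide (hα : K.IsVeering α) (c : K.Corner) :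
    (Finset.univ.filter fun d => K.rot.SameCycle c d ∧ K.IsWide α d).card = 2 := by
  have h := hα.1.1.2 c
  have h1 : ∀ d, K.angle α d = if K.IsWide α d then Real.pi else 0 := by
    intro d
    split_ifs with hd
    · exact hd
    · exact (hα.angle_eq d).resolve_right hd
  simp only [h1] at h
  rw [← Finset.sum_filter, Finset.filter_filter, Finset.sum_const, nsmul_eq_mul] at h
  have h2 := mul_right_cancel₀ Real.pi_ne_zero h
  convert (by exact_mod_cast h2 : (Finset.univ.filter fun d =>
    K.rot.SameCycle c d ∧ K.IsWide α d).card = 2)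

theorem IsVeering.exists_other_wide (hα : K.IsVeering α) (c : K.Corner) :
    ∃ q, q ≠ c ∧ K.rot.SameCycle c q ∧ K.IsWide α q := by
  classical
  have h := hα.card_wide c
  obtain ⟨q, hq, hne⟩ := Finset.exists_mem_ne (by rw [h]; norm_num) c
  rw [Finset.mem_filter] at hq
  exact ⟨q, hne, hq.2⟩

theorem IsVeering.other_wide_unique (hα : K.IsVeering α) {c q q' : K.Corner} (hc : K.IsWide α c)
    (hq : K.IsWide α q) (hcq : K.rot.SameCycle c q) (hne : q ≠ c)
    (hq' : K.IsWide α q') (hcq' : K.rot.SameCycle c q') (hne' : q' ≠ c) : q = q' := by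
  classical
  by_contra hqq
  have h := hα.card_wide c
  have : ({c, q, q'} : Finset K.Corner).card ≤ 2 := by
    rw [← h]
    apply Finset.card_le_card
    intro d hd
    simp only [Finset.mem_insert, Finset.mem_singleton] at hd
    rw [Finset.mem_filter]
    refine ⟨Finset.mem_univ _, ?_⟩
    rcases hd with rfl | rfl | rfl
    · exact ⟨Equiv.Perm.SameCycle.refl _ _, hc⟩
    · exact ⟨hcq, hq⟩
    · exact ⟨hcq', hq'⟩
  rw [Finset.card_insert_of_notMem (by simp [hne.symm, hne'.symm]), Finset.card_pair hqq] at this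
  omega

/-- Turning counterclockwise around the vertex of the wide corner of a left-based triangle means
climbing its ladder. Until the next left-based triangle, every triangle met touches the left
ladderpole only at this vertex, with a thin corner. On the right side one turns clockwise instead.
-/
theorem IsVeering.rot_pow_left (hα : K.IsVeering α) {p : K.Wide α} (hp : K.LeftVeering α p) (n : ℕ)
    (h : ∀ r, 1 ≤ r → r < n + 1 → ¬ K.LeftVeering α ((hα.up ^ r) p)) :
    (K.rot ^ (n + 1)) p = K.ccw ((hα.up ^ (n + 1)) p) := by
  induction n with
  | zero => rw [zero_add, pow_one, pow_one, rot_apply, hα.coe_up, upper_of_left hp]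
  | succ n ih =>
    rw [pow_succ', Equiv.Perm.mul_apply, ih fun r h1 h2 => h r h1 (by omega), rot_apply, ccw_ccw,
      pow_succ' _ (n + 1), Equiv.Perm.mul_apply, hα.coe_up,
      upper_of_not_left (h (n + 1) (by omega) (by omega))]

theorem IsVeering.rot_pow_right (hα : K.IsVeering α) {p : K.Wide α} (hp : ¬ K.LeftVeering α p)
    (n : ℕ) (h : ∀ r, 1 ≤ r → r < n + 1 → K.LeftVeering α ((hα.up ^ r) p)) :
    (K.rot⁻¹ ^ (n + 1)) p = K.ccw.symm ((hα.up ^ (n + 1)) p) := by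
  induction n with
  | zero =>
    rw [zero_add, pow_one, pow_one, Equiv.Perm.inv_def, rot_symm_apply, hα.coe_up,
      upper_of_not_left hp]
  | succ n ih =>
    rw [pow_succ', Equiv.Perm.mul_apply, ih fun r h1 h2 => h r h1 (by omega), Equiv.Perm.inv_def,
      rot_symm_apply, ccw_symm_symm,
      pow_succ' _ (n + 1), Equiv.Perm.mul_apply, hα.coe_up,
      upper_of_left (h (n + 1) (by omega) (by omega))]

/-- The next triangle of a ladder with the same type as a given one is adjacent, across its
ladderpole segment, to the other triangle with its wide corner at the same vertex. -/
theorem IsVeering.flip_return (hα : K.IsVeering α) (p : K.Wide α) (m : ℕ) (hm : 1 ≤ m)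
    (hs : K.LeftVeering α ((hα.up ^ m) p) ↔ K.LeftVeering α p)
    (h : ∀ r, 1 ≤ r → r < m → ¬ (K.LeftVeering α ((hα.up ^ r) p) ↔ K.LeftVeering α p)) :
    K.rot.SameCycle p (hα.flip ((hα.up ^ m) p)) ∧ hα.flip ((hα.up ^ m) p) ≠ p := by
  -- `ρ` turns around the vertex in the sense that climbs the ladder: `rot` on the left side, its
  -- inverse on the right side. The last of the `m + 1` steps crosses the ladderpole segment of the
  -- triangle reached.
  have key : ∃ ρ : Equiv.Perm K.Corner, (∀ c d, ρ.SameCycle c d ↔ K.rot.SameCycle c d) ∧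
      (ρ ^ (m + 1)) p = hα.flip ((hα.up ^ m) p) ∧
      ∀ r, 1 ≤ r → r < m + 1 → ¬ K.IsWide α ((ρ ^ r) p) := by
    by_cases hp : K.LeftVeering α p
    · have h' : ∀ r, 1 ≤ r → r < m → ¬ K.LeftVeering α ((hα.up ^ r) p) := fun r h1 h2 => by
        have := h r h1 h2; tauto
      refine ⟨K.rot, fun _ _ => Iff.rfl, ?_, ?_⟩
      · obtain ⟨n, rfl⟩ : ∃ n, m = n + 1 := ⟨m - 1, by omega⟩
        rw [pow_succ', Equiv.Perm.mul_apply, hα.rot_pow_left hp n h', rot_apply, ccw_ccw,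
          hα.coe_flip, acrossPole_of_left (hs.2 hp)]
      · intro r h1 h2
        obtain ⟨n, rfl⟩ : ∃ n, r = n + 1 := ⟨r - 1, by omega⟩
        rw [hα.rot_pow_left hp n fun r h3 h4 => h' r h3 (by omega)]
        exact hα.not_wide_ccw ((hα.up ^ (n + 1)) p).2
    · have h' : ∀ r, 1 ≤ r → r < m → K.LeftVeering α ((hα.up ^ r) p) := fun r h1 h2 => by
        have := h r h1 h2; tauto
      refine ⟨K.rot⁻¹, fun _ _ => Equiv.Perm.sameCycle_inv, ?_, ?_⟩
      · obtain ⟨n, rfl⟩ : ∃ n, m = n + 1 := ⟨m - 1, by omega⟩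
        rw [pow_succ', Equiv.Perm.mul_apply, hα.rot_pow_right hp n h', Equiv.Perm.inv_def,
          rot_symm_apply, ccw_symm_symm, hα.coe_flip, acrossPole_of_not_left (mt hs.1 hp)]
      · intro r h1 h2
        obtain ⟨n, rfl⟩ : ∃ n, r = n + 1 := ⟨r - 1, by omega⟩
        rw [hα.rot_pow_right hp n fun r h3 h4 => h' r h3 (by omega)]
        exact hα.not_wide_ccw_symm ((hα.up ^ (n + 1)) p).2
  obtain ⟨ρ, hρ, h1, h2⟩ := key
  refine ⟨?_, fun heq => ?_⟩
  · rw [← hρ, ← h1]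
    exact ⟨(m + 1 : ℕ), by rw [zpow_natCast]⟩
  -- If the rotation led back to `p`, these `m + 1` corners would be all the corners at the vertex,
  -- and `p` the only wide one, whereas there are two.
  · rw [heq] at h1
    obtain ⟨q, hne, hq, hw⟩ := hα.exists_other_wide p.1
    rw [← hρ] at hq
    obtain ⟨i, hi⟩ := hq.exists_pow_eq'
    have h3 : (ρ ^ (i % (m + 1))) p = q := by
      rw [← hi.2]
      conv_rhs => rw [← Nat.mod_add_div i (m + 1), pow_add, Equiv.Perm.mul_apply, pow_mul]
      congr 1
      exact (Function.IsFixedPt.perm_pow h1 (i / (m + 1))).symm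
    rcases Nat.eq_zero_or_pos (i % (m + 1)) with h0 | h0
    · rw [h0] at h3
      exact hne h3.symm
    · exact h2 _ h0 (Nat.mod_lt _ (by omega)) (h3 ▸ hw)

theorem IsVeering.exists_up_pow_eq (hα : K.IsVeering α) (p : K.Wide α) :
    ∃ m : ℕ, 1 ≤ m ∧ (hα.up ^ m) p = p :=
  ⟨orderOf hα.up, orderOf_pos _, by rw [pow_orderOf_eq_one]; rfl⟩

/-- Along a ladderpole, the triangles on one side come in the reverse order of those on the other
side. -/
theorem IsVeering.return_flip (hα : K.IsVeering α) (p : K.Wide α) (m : ℕ) (hm : 1 ≤ m)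
    (hs : K.LeftVeering α ((hα.up ^ m) p) ↔ K.LeftVeering α p)
    (h : ∀ r, 1 ≤ r → r < m → ¬ (K.LeftVeering α ((hα.up ^ r) p) ↔ K.LeftVeering α p)) :
    ∃ n, 1 ≤ n ∧ (hα.up ^ n) (hα.flip ((hα.up ^ m) p)) = hα.flip p ∧
      ∀ r, 1 ≤ r → r < n → ¬ (K.LeftVeering α ((hα.up ^ r) (hα.flip ((hα.up ^ m) p))) ↔
        K.LeftVeering α p) := by
  classical
  set q := hα.flip ((hα.up ^ m) p) with hq
  have h1 := hα.flip_return p m hm hs h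
  have hqp : K.LeftVeering α q ↔ K.LeftVeering α p := (leftVeering_congr h1.1).symm
  have hex : ∃ n, 1 ≤ n ∧ (K.LeftVeering α ((hα.up ^ n) q) ↔ K.LeftVeering α q) := by
    obtain ⟨n, hn, hn'⟩ := hα.exists_up_pow_eq q
    exact ⟨n, hn, by rw [hn']⟩
  have h2 := Nat.find_spec hex
  have h3 : ∀ r, 1 ≤ r → r < Nat.find hex →
    ¬ (K.LeftVeering α ((hα.up ^ r) q) ↔ K.LeftVeering α q) :=
    fun r hr1 hr2 H => Nat.find_min hex hr2 ⟨hr1, H⟩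
  set n := Nat.find hex
  have h4 := hα.flip_return q n h2.1 h2.2 h3
  refine ⟨n, h2.1, ?_, fun r hr1 hr2 => by rw [← hqp]; exact h3 r hr1 hr2⟩
  -- A vertex has exactly two wide corners, and each application of `flip_return` passes to the
  -- other one; two applications lead back to `p`.
  have h5 : (hα.flip ((hα.up ^ n) q) : K.Corner) = p :=
    hα.other_wide_unique q.2 (hα.flip _).2 h4.1 (fun h' => h4.2 (Subtype.ext h')) p.2 h1.1.symm
      (fun h' => h1.2 (Subtype.ext h'.symm))
  rw [← hα.flip_flip ((hα.up ^ n) q), Subtype.ext h5]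

/-- If all triangles of a ladder were based on one side, its other side would be reduced to a vertex
with only thin corners, against `card_wide`. -/
theorem IsVeering.exists_up_pow_not (hα : K.IsVeering α) (p : K.Wide α) :
    ∃ m : ℕ, ¬ (K.LeftVeering α ((hα.up ^ m) p) ↔ K.LeftVeering α p) := by
  classical
  by_contra! h
  by_cases hp : K.LeftVeering α p
  · -- the lone corners of these triangles are all the corners around one vertex
    have h2 : ∀ n, (K.rot⁻¹ ^ n) (K.ccw.symm p) = K.ccw.symm ((hα.up ^ n) p) := by
      intro n
      induction n with
      | zero => rfl
      | succ n ih =>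
        rw [pow_succ', Equiv.Perm.mul_apply, ih, Equiv.Perm.inv_def, rot_symm_apply, ccw_symm_symm,
          pow_succ' _ n, Equiv.Perm.mul_apply, hα.coe_up, upper_of_left ((h n).2 hp)]
    obtain ⟨q, hq⟩ := Finset.card_pos.1 (by rw [hα.card_wide (K.ccw.symm p)]; norm_num)
    rw [Finset.mem_filter, ← Equiv.Perm.sameCycle_inv] at hq
    obtain ⟨i, hi⟩ := hq.2.1.exists_pow_eq'
    have := hi.2
    rw [h2] at this
    exact hα.not_wide_ccw_symm ((hα.up ^ i) p).2 (this ▸ hq.2.2)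
  · have h2 : ∀ n, (K.rot ^ n) (K.ccw p) = K.ccw ((hα.up ^ n) p) := by
      intro n
      induction n with
      | zero => rfl
      | succ n ih =>
        rw [pow_succ', Equiv.Perm.mul_apply, ih, rot_apply, ccw_ccw,
          pow_succ' _ n, Equiv.Perm.mul_apply, hα.coe_up, upper_of_not_left (mt (h n).1 hp)]
    obtain ⟨q, hq⟩ := Finset.card_pos.1 (by rw [hα.card_wide (K.ccw p)]; norm_num)
    rw [Finset.mem_filter] at hq
    obtain ⟨i, hi⟩ := hq.2.1.exists_pow_eq'
    have := hi.2
    rw [h2] at this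
    exact hα.not_wide_ccw ((hα.up ^ i) p).2 (this ▸ hq.2.2)

/-- The ladder system of a veering structure. -/
def IsVeering.ladders (hα : K.IsVeering α) : LadderSystem (K.Wide α) where
  up := hα.up
  flip := hα.flip
  left p := K.LeftVeering α p
  flip_flip := hα.flip_flip
  left_flip := hα.left_flip
  exists_same p := by
    obtain ⟨m, hm, h⟩ := hα.exists_up_pow_eq p
    exact ⟨m, hm, by rw [h]⟩
  exists_other := hα.exists_up_pow_not
  return_flip p m hm hs h := by
    obtain ⟨n, -, hn, -⟩ := hα.return_flip p m hm hs h
    exact ⟨n, by rw [zpow_natCast, hn]⟩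

end IdealTriangulation
end

/-! ### Two-colouring of the ladders. -/

noncomputable section

/-- The graph that is the union of two perfect matchings is bipartite, provided no alternating
cycle is odd, which is automatic. -/
theorem exists_coloring_of_involutions {X : Type*} (a b : X → X) (ha : ∀ x, a (a x) = x)
    (hb : ∀ x, b (b x) = x) (ha' : ∀ x, a x ≠ x) (hb' : ∀ x, b x ≠ x) :
    ∃ col : X → ℤ, (∀ x, col x = 1 ∨ col x = -1) ∧ (∀ x, col (a x) = - col x) ∧
      ∀ x, col (b x) = - col x := by
  classical
  let A : Equiv.Perm X := ⟨a, a, ha, ha⟩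
  let B : Equiv.Perm X := ⟨b, b, hb, hb⟩
  have hAA : A * A = 1 := Equiv.ext ha
  have hBB : B * B = 1 := Equiv.ext hb
  have hAi : A⁻¹ = A := inv_eq_of_mul_eq_one_left hAA
  have hBi : B⁻¹ = B := inv_eq_of_mul_eq_one_left hBB
  set σ := A * B with hσ
  have hAσ : A * σ * A⁻¹ = σ⁻¹ := by
    rw [hσ, mul_inv_rev, hAi, hBi, ← mul_assoc, hAA, one_mul]
  have hAσn : ∀ n : ℤ, A * σ ^ n = σ ^ (-n) * A := by
    intro n
    have : A * σ ^ n * A⁻¹ = σ ^ (-n) := by rw [← conj_zpow, hAσ, inv_zpow, zpow_neg]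
    rw [← this]; group
  have hsame : ∀ x y, σ.SameCycle x y → σ.SameCycle (a x) (a y) := by
    rintro x _ ⟨n, rfl⟩
    refine ⟨-n, ?_⟩
    have := congrArg (fun e : Equiv.Perm X => e x) (hAσn n)
    exact this.symm
  -- In the dihedral group generated by the two involutions, `a x = σ ^ n x` makes the point halfway
  -- between `x` and `a x` a fixed point of `a` if `n` is even, of `b` if `n` is odd.
  have hfree : ∀ x, ¬ σ.SameCycle x (a x) := by
    rintro x ⟨n, hn⟩
    have hx : ∀ m : ℤ, A ((σ ^ m) x) = (σ ^ (n - m)) x := by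
      intro m
      have := congrArg (fun e : Equiv.Perm X => e x) (hAσn m)
      simp only [Equiv.Perm.mul_apply] at this
      rw [this]
      change (σ ^ (-m)) (a x) = _
      rw [← hn, ← Equiv.Perm.mul_apply, ← zpow_add]
      congr 2; ring
    rcases Int.even_or_odd' n with ⟨m, h | h⟩
    · refine ha' ((σ ^ m) x) ((hx m).trans ?_)
      rw [h]; congr 2; ring
    · refine hb' ((σ ^ m) x) ?_
      have h1 : B = A * σ := by rw [hσ, ← mul_assoc, hAA, one_mul]
      have h2 : b ((σ ^ m) x) = (A * σ) ((σ ^ m) x) := by rw [← h1]; rfl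
      rw [h2, Equiv.Perm.mul_apply, ← Equiv.Perm.mul_apply σ, ← zpow_one_add, hx, h]
      congr 2; ring
  -- The classes are the orbits under both involutions. By `hfree` each is the union of two distinct
  -- cycles of `σ`, which receive the two colours; the chosen representative decides which cycle
  -- gets `1`.
  let s : Setoid X :=
    { r := fun x y => σ.SameCycle x y ∨ σ.SameCycle (a x) y
      iseqv :=
        { refl := fun x => Or.inl (Equiv.Perm.SameCycle.refl _ _)
          symm := by
            rintro x y (h | h)
            · exact Or.inl h.symm
            · right
              have := hsame _ _ h
              rw [ha] at this
              exact this.symm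
          trans := by
            rintro x y z (h | h) (h' | h')
            · exact Or.inl (h.trans h')
            · exact Or.inr ((hsame _ _ h).trans h')
            · exact Or.inr (h.trans h')
            · left
              have := hsame _ _ h
              rw [ha] at this
              exact this.trans h' } }
  let r : X → X := fun x => (Quotient.mk s x).out
  have hr : ∀ x, σ.SameCycle (r x) x ∨ σ.SameCycle (a (r x)) x := fun x => Quotient.mk_out (s := s) x
  have hr' : ∀ x y, s.r x y → r x = r y := fun x y h => by
    change (Quotient.mk s x).out = (Quotient.mk s y).out
    rw [Quotient.sound h]
  let col : X → ℤ := fun x => if σ.SameCycle (r x) x then 1 else -1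
  have hcol : ∀ x y, σ.SameCycle x y → col x = col y := by
    intro x y h
    have h1 := hr' x y (Or.inl h)
    have : σ.SameCycle (r x) x ↔ σ.SameCycle (r y) y := by
      rw [h1]; exact ⟨fun H => H.trans h, fun H => H.trans h.symm⟩
    simp only [col, this]
  have hcola : ∀ x, col (a x) = - col x := by
    intro x
    have h1 : r x = r (a x) := hr' x (a x) (Or.inr (Equiv.Perm.SameCycle.refl _ _))
    by_cases h : σ.SameCycle (r x) x
    · have h2 : ¬ σ.SameCycle (r (a x)) (a x) := by
        rw [← h1]; exact fun H => hfree x (h.symm.trans H)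
      simp only [col, if_pos h, if_neg h2]
    · have h2 : σ.SameCycle (r (a x)) (a x) := by
        have := hsame _ _ ((hr x).resolve_left h)
        rwa [ha, h1] at this
      simp only [col, if_neg h, if_pos h2]; norm_num
  refine ⟨col, fun x => ?_, hcola, fun x => ?_⟩
  · simp only [col]; split_ifs <;> simp
  · have h1 : B = A * σ := by rw [hσ, ← mul_assoc, hAA, one_mul]
    have h2 : b x = a (σ x) := congrArg (fun e : Equiv.Perm X => e x) h1
    rw [h2, hcola, hcol x (σ x) ⟨1, by simp⟩]

namespace IdealTriangulation
variable {ι : Type*}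
variable [Fintype ι] {K : IdealTriangulation ι} {α : ι → Fin 3 → ℝ}

open Classical in
/-- The number of steps to the next triangle of a ladder with its base on the same side. -/
def IsVeering.nextStep (hα : K.IsVeering α) (p : K.Wide α) : ℕ :=
  Nat.find (hα.ladders.exists_same p)

/-- The next triangle of a ladder with its base on the same side. -/
def IsVeering.next (hα : K.IsVeering α) (p : K.Wide α) : K.Wide α := (hα.up ^ hα.nextStep p) p

theorem IsVeering.nextStep_pos (hα : K.IsVeering α) (p : K.Wide α) : 1 ≤ hα.nextStep p := by
  classical
  exact (Nat.find_spec (hα.ladders.exists_same p)).1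

theorem IsVeering.left_next (hα : K.IsVeering α) (p : K.Wide α) :
    K.LeftVeering α (hα.next p) ↔ K.LeftVeering α p := by
  classical
  exact (Nat.find_spec (hα.ladders.exists_same p)).2

theorem IsVeering.not_left_of_lt_nextStep (hα : K.IsVeering α) (p : K.Wide α) (r : ℕ) (h1 : 1 ≤ r)
    (h2 : r < hα.nextStep p) : ¬ (K.LeftVeering α ((hα.up ^ r) p) ↔ K.LeftVeering α p) := by
  classical
  exact fun h => Nat.find_min (hα.ladders.exists_same p) h2 ⟨h1, h⟩

theorem IsVeering.next_eq (hα : K.IsVeering α) (p : K.Wide α) (n : ℕ) (h1 : 1 ≤ n)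
    (h2 : K.LeftVeering α ((hα.up ^ n) p) ↔ K.LeftVeering α p)
    (h3 : ∀ r, 1 ≤ r → r < n → ¬ (K.LeftVeering α ((hα.up ^ r) p) ↔ K.LeftVeering α p)) :
    hα.next p = (hα.up ^ n) p := by
  classical
  have : hα.nextStep p = n :=
    (Nat.find_eq_iff (hα.ladders.exists_same p)).2 ⟨⟨h1, h2⟩, fun r hr ⟨h4, h5⟩ => h3 r h4 hr h5⟩
  rw [next, this]

/-- The triangles on the two sides of a ladderpole come in opposite orders, so `flip` conjugates
`next` to its inverse. -/
theorem IsVeering.next_flip_next (hα : K.IsVeering α) (p : K.Wide α) :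
    hα.next (hα.flip (hα.next p)) = hα.flip p := by
  have hp := hα.left_next p
  obtain ⟨n, h1, h2, h3⟩ := hα.return_flip p _ (hα.nextStep_pos p) hp
    (hα.not_left_of_lt_nextStep p)
  change (hα.up ^ n) (hα.flip (hα.next p)) = _ at h2
  have hq : K.LeftVeering α (hα.flip (hα.next p)) ↔ K.LeftVeering α p :=
    (hα.left_flip _).trans hp
  rw [← h2]
  refine hα.next_eq _ n h1 ?_ fun r hr1 hr2 => ?_
  · rw [h2, hα.left_flip, hq]
  · rw [hq]; exact h3 r hr1 hr2

theorem IsVeering.flip_next_ne (hα : K.IsVeering α) (p : K.Wide α) : hα.flip (hα.next p) ≠ p :=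
  (hα.flip_return p _ (hα.nextStep_pos p) (hα.left_next p) (hα.not_left_of_lt_nextStep p)).2

theorem IsVeering.flip_injective (hα : K.IsVeering α) : Function.Injective hα.flip :=
  Function.LeftInverse.injective hα.flip_flip

theorem IsVeering.next_injective (hα : K.IsVeering α) : Function.Injective hα.next := by
  intro p q h
  apply hα.flip_injective
  rw [← hα.next_flip_next p, ← hα.next_flip_next q, h]

theorem IsVeering.exists_next_iterate (hα : K.IsVeering α) (m : ℕ) : ∀ p : K.Wide α,
    (K.LeftVeering α ((hα.up ^ m) p) ↔ K.LeftVeering α p) →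
    ∃ n, hα.next^[n] p = (hα.up ^ m) p := by
  induction m using Nat.strong_induction_on with
  | _ m ih =>
    intro p hs
    rcases Nat.eq_zero_or_pos m with rfl | hm
    · exact ⟨0, rfl⟩
    have h3 : hα.nextStep p ≤ m := by
      by_contra! h
      exact hα.not_left_of_lt_nextStep p m hm h hs
    have h5 : (hα.up ^ (m - hα.nextStep p)) (hα.next p) = (hα.up ^ m) p := by
      rw [next, ← Equiv.Perm.mul_apply, ← pow_add, Nat.sub_add_cancel h3]
    have h1 := hα.nextStep_pos p
    obtain ⟨n, hn⟩ := ih (m - hα.nextStep p) (by omega) (hα.next p)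
      (by rw [h5]; exact hs.trans (hα.left_next p).symm)
    exact ⟨n + 1, by rw [Function.iterate_succ_apply, hn, h5]⟩

/-- A ladder is not adjacent to itself. -/
theorem IsVeering.not_sameCycle_flip (hα : K.IsVeering α) (p : K.Wide α) :
    ¬ hα.up.SameCycle p (hα.flip p) := by
  intro h
  obtain ⟨m, hm⟩ := h.exists_nat_pow_eq
  obtain ⟨n, hn⟩ := hα.exists_next_iterate m p (by rw [hm, hα.left_flip])
  rw [hm] at hn
  have key : ∀ j, hα.next^[j] (hα.flip (hα.next^[j] p)) = hα.flip p := by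
    intro j
    induction j with
    | zero => rfl
    | succ j ih =>
      rw [Function.iterate_succ_apply, Function.iterate_succ_apply' _ j p, hα.next_flip_next, ih]
  -- If `flip p` is the `n`-th iterate of `next` at `p`, the reversal of order gives, halfway
  -- between them, a fixed point of `flip` for even `n` and of `flip ∘ next` for odd `n`.
  rcases Nat.even_or_odd' n with ⟨j, rfl | rfl⟩
  · have h1 := key j
    rw [← hn, two_mul, Function.iterate_add_apply] at h1
    exact hα.flip_ne _ ((hα.next_injective.iterate j) h1)
  · have h1 := key j
    rw [← hn, show 2 * j + 1 = j + (j + 1) by ring, Function.iterate_add_apply,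
      Function.iterate_succ_apply' _ j p] at h1
    have h2 := (hα.next_injective.iterate j) h1
    apply hα.flip_next_ne (hα.next^[j] p)
    rw [← h2, hα.flip_flip]

theorem IsVeering.flipLine_ne (hα : K.IsVeering α) (b : Bool) (A : hα.ladders.Line) :
    hα.ladders.flipLine b A ≠ A := by
  obtain ⟨s, rfl, hs⟩ := hα.ladders.exists_line_left A b
  rw [LadderSystem.flipLine_line _ hs]
  exact fun h => hα.not_sameCycle_flip s ((LadderSystem.line_eq_iff _).1 h.symm)

/-- The ladders can be coloured with two colours, so that adjacent ladders have different
colours. -/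
structure IsLadderColoring (hα : K.IsVeering α) (ε : hα.ladders.Line → ℤ) : Prop where
  eq_or : ∀ A, ε A = 1 ∨ ε A = -1
  flipLine : ∀ b A, ε (hα.ladders.flipLine b A) = - ε A

theorem IsVeering.exists_coloring (hα : K.IsVeering α) : ∃ ε, IsLadderColoring hα ε := by
  obtain ⟨ε, h1, h2, h3⟩ := exists_coloring_of_involutions (hα.ladders.flipLine true)
    (hα.ladders.flipLine false) (hα.ladders.flipLine_flipLine _) (hα.ladders.flipLine_flipLine _)
    (hα.flipLine_ne _) (hα.flipLine_ne _)
  exact ⟨ε, h1, fun b A => by cases b; exacts [h3 A, h2 A]⟩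

theorem line_flip_eq (hα : K.IsVeering α) (p : K.Wide α) :
    ∃ b, hα.ladders.line (hα.flip p) = hα.ladders.flipLine b (hα.ladders.line p) := by
  by_cases h : K.LeftVeering α p
  · exact ⟨true, (LadderSystem.flipLine_line _ (iff_of_true h rfl)).symm⟩
  · exact ⟨false, (LadderSystem.flipLine_line _ (iff_of_false h Bool.false_ne_true)).symm⟩

theorem IsLadderColoring.flip {hα : K.IsVeering α} {ε} (hε : IsLadderColoring hα ε)
    (p : K.Wide α) :
    ε (hα.ladders.line (hα.flip p)) = - ε (hα.ladders.line p) := by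
  obtain ⟨b, hb⟩ := line_flip_eq hα p
  rw [hb, hε.flipLine]

/-! ### The triangle of a corner -/

variable (K α) in
open Classical in
/-- The wide corner of the triangle of a corner. -/
def topCorner (c : K.Corner) : K.Corner :=
  if K.IsWide α c then c else if K.IsWide α (K.ccw c) then K.ccw c else K.ccw.symm c

theorem IsVeering.isWide_topCorner (hα : K.IsVeering α) (c : K.Corner) :
    K.IsWide α (K.topCorner α c) := by
  unfold topCorner
  split_ifs with h1 h2
  · exact h1
  · exact h2
  · exact ((hα.exists_wide c).resolve_left h1).resolve_left h2

/-- The triangle of a corner. -/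
def IsVeering.top (hα : K.IsVeering α) (c : K.Corner) : K.Wide α :=
  ⟨K.topCorner α c, hα.isWide_topCorner c⟩

theorem IsVeering.top_of_wide (hα : K.IsVeering α) (p : K.Wide α) : hα.top p = p :=
  Subtype.ext (if_pos p.2)

theorem IsVeering.top_ccw_wide (hα : K.IsVeering α) (p : K.Wide α) :
    hα.top (K.ccw p) = p := by
  refine Subtype.ext ?_
  change K.topCorner α _ = _
  rw [topCorner, if_neg (hα.not_wide_ccw p.2), ccw_ccw, if_neg (hα.not_wide_ccw_symm p.2),
    Equiv.symm_apply_apply]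

theorem IsVeering.top_ccw_symm_wide (hα : K.IsVeering α) (p : K.Wide α) :
    hα.top (K.ccw.symm p) = p := by
  refine Subtype.ext ?_
  change K.topCorner α _ = _
  rw [topCorner, if_neg (hα.not_wide_ccw_symm p.2), Equiv.apply_symm_apply, if_pos p.2]

theorem IsVeering.corner_cases (hα : K.IsVeering α) (c : K.Corner) :
    c = hα.top c ∨ c = K.ccw (hα.top c) ∨ c = K.ccw.symm (hα.top c) := by
  rcases hα.exists_wide c with h | h | h
  · left; exact (congrArg Subtype.val (hα.top_of_wide ⟨c, h⟩)).symm
  · right; right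
    have := hα.top_ccw_symm_wide ⟨_, h⟩
    simp only [Equiv.symm_apply_apply] at this
    rw [this]; simp
  · right; left
    have := hα.top_ccw_wide ⟨_, h⟩
    simp only [Equiv.apply_symm_apply] at this
    rw [this]; simp

theorem IsVeering.top_ccw (hα : K.IsVeering α) (c : K.Corner) : hα.top (K.ccw c) = hα.top c := by
  rcases hα.corner_cases c with h | h | h
  · rw [h, hα.top_ccw_wide, hα.top_of_wide]
  · rw [h, ccw_ccw, hα.top_ccw_symm_wide, hα.top_ccw_wide]
  · rw [h, Equiv.apply_symm_apply, hα.top_ccw_symm_wide, hα.top_of_wide]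

theorem IsVeering.top_ccw_symm (hα : K.IsVeering α) (c : K.Corner) :
    hα.top (K.ccw.symm c) = hα.top c := by
  rw [← ccw_ccw, hα.top_ccw, hα.top_ccw]

theorem IsVeering.top_upper (hα : K.IsVeering α) (p : K.Wide α) : hα.top (K.upper α p) = p := by
  by_cases h : K.LeftVeering α p
  · rw [upper_of_left h, hα.top_ccw_wide]
  · rw [upper_of_not_left h, hα.top_ccw_symm_wide]

theorem IsVeering.top_pole (hα : K.IsVeering α) (p : K.Wide α) : hα.top (K.pole α p) = p := by
  by_cases h : K.LeftVeering α p
  · rw [pole_of_left h, hα.top_ccw_symm_wide]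
  · rw [pole_of_not_left h, hα.top_ccw_wide]

/-- The three sides of a triangle. -/
theorem IsVeering.side_cases (hα : K.IsVeering α) (c : K.Corner) :
    c = hα.top c ∨ c = K.upper α (hα.top c) ∨ c = K.pole α (hα.top c) := by
  have h1 := hα.corner_cases c
  by_cases h : K.LeftVeering α (hα.top c)
  · rw [upper_of_left h, pole_of_left h]; exact h1
  · rw [upper_of_not_left h, pole_of_not_left h]; tauto

theorem IsVeering.cross_upper (hα : K.IsVeering α) (p : K.Wide α) :
    K.cross (K.upper α p) = hα.up p := rfl

theorem IsVeering.cross_wide (hα : K.IsVeering α) (p : K.Wide α) :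
    K.cross p = K.upper α (hα.up.symm p) := by
  rw [← cross_cross K (K.upper α _), hα.cross_upper, Equiv.apply_symm_apply]

theorem IsVeering.cross_pole_flip (hα : K.IsVeering α) (p : K.Wide α) :
    K.cross (K.pole α p) = K.pole α (hα.flip p) := hα.cross_pole p.2

/-- A function on triangles that is invariant under adjacency is constant on cusps. -/
theorem IsVeering.eq_of_cuspOf_eq (hα : K.IsVeering α) {X : Type*} (f : K.Wide α → X)
    (h1 : ∀ p, f (hα.up p) = f p) (h2 : ∀ p, f (hα.flip p) = f p) {c d : K.Corner}
    (h : K.cuspOf c = K.cuspOf d) : f (hα.top c) = f (hα.top d) := by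
  let g : K.Cusp → X := Quot.lift (fun c => f (hα.top c)) (by
    rintro a b (rfl | rfl)
    · rw [hα.top_ccw]
    · rcases hα.side_cases a with h | h | h
      · rw [h, hα.cross_wide, hα.top_upper, hα.top_of_wide, ← h1 (hα.up.symm _),
          Equiv.apply_symm_apply]
      · rw [h, hα.cross_upper, hα.top_upper, hα.top_of_wide, h1]
      · rw [h, hα.cross_pole_flip, hα.top_pole, hα.top_pole, h2])
  exact congrArg g h

theorem cuspOf_ccw (c : K.Corner) : K.cuspOf (K.ccw c) = K.cuspOf c := by
  symm; exact Quot.sound (Or.inl rfl)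

theorem cuspOf_ccw_symm (c : K.Corner) : K.cuspOf (K.ccw.symm c) = K.cuspOf c := by
  rw [← ccw_ccw, cuspOf_ccw, cuspOf_ccw]

theorem cuspOf_cross (c : K.Corner) : K.cuspOf (K.cross c) = K.cuspOf c := by
  symm; exact Quot.sound (Or.inr rfl)

theorem cuspOf_upper (c : K.Corner) : K.cuspOf (K.upper α c) = K.cuspOf c := by
  unfold upper; split_ifs
  exacts [cuspOf_ccw c, cuspOf_ccw_symm c]

theorem cuspOf_pole (c : K.Corner) : K.cuspOf (K.pole α c) = K.cuspOf c := by
  unfold pole; split_ifs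
  exacts [cuspOf_ccw_symm c, cuspOf_ccw c]

theorem IsVeering.cuspOf_up (hα : K.IsVeering α) (p : K.Wide α) :
    K.cuspOf (hα.up p) = K.cuspOf p := by
  rw [hα.coe_up, cuspOf_cross, cuspOf_upper]

theorem IsVeering.cuspOf_top (hα : K.IsVeering α) (c : K.Corner) :
    K.cuspOf (hα.top c) = K.cuspOf c := by
  rcases hα.corner_cases c with h | h | h
  · rw [← h]
  · conv_rhs => rw [h, cuspOf_ccw]
  · conv_rhs => rw [h, cuspOf_ccw_symm]

theorem IsVeering.cuspOf_eq_of_sameCycle (hα : K.IsVeering α) {p q : K.Wide α}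
    (h : hα.up.SameCycle p q) : K.cuspOf p = K.cuspOf q := by
  obtain ⟨m, rfl⟩ := h.exists_nat_pow_eq
  clear h
  induction m with
  | zero => rfl
  | succ m ih => rw [pow_succ', Equiv.Perm.mul_apply, hα.cuspOf_up, ← ih]

/-- The cusp of a ladder. -/
def IsVeering.cuspOfLine (hα : K.IsVeering α) : hα.ladders.Line → K.Cusp :=
  Quotient.lift (fun p : K.Wide α => K.cuspOf p.1) fun _ _ h => hα.cuspOf_eq_of_sameCycle h

theorem IsVeering.cuspOfLine_line (hα : K.IsVeering α) (p : K.Wide α) :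
    hα.cuspOfLine (hα.ladders.line p) = K.cuspOf p := rfl

/-- A function on ladders that is invariant under adjacency is constant on cusps. -/
theorem IsVeering.line_eq_of_cuspOfLine_eq (hα : K.IsVeering α) {X : Type*}
    (f : hα.ladders.Line → X) (h1 : ∀ b A, f (hα.ladders.flipLine b A) = f A)
    {A B : hα.ladders.Line} (h : hα.cuspOfLine A = hα.cuspOfLine B) : f A = f B := by
  obtain ⟨p, rfl⟩ := hα.ladders.exists_line A
  obtain ⟨q, rfl⟩ := hα.ladders.exists_line B
  have := hα.eq_of_cuspOf_eq (fun p => f (hα.ladders.line p))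
    (fun p => by rw [show hα.up = hα.ladders.up from rfl, LadderSystem.line_up])
    (fun p => by obtain ⟨b, hb⟩ := line_flip_eq hα p; rw [hb, h1]) h
  rwa [hα.top_of_wide, hα.top_of_wide] at this

instance (hα : K.IsVeering α) : Finite hα.ladders.Line :=
  inferInstanceAs (Finite (Quotient _))

theorem IsVeering.isRung_upper (hα : K.IsVeering α) (p : K.Wide α) :
    K.IsRung α (K.upper α p) := by
  have h1 := hα.left_ccw p.2
  have h2 := hα.not_left_ccw_symm p.2
  rw [hα.isRung_iff]
  by_cases h : K.LeftVeering α p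
  · rw [upper_of_left h, ccw_ccw, Equiv.symm_apply_apply]; tauto
  · rw [upper_of_not_left h, ccw_symm_symm, Equiv.apply_symm_apply]; tauto

theorem IsVeering.not_isRung_pole (hα : K.IsVeering α) (p : K.Wide α) :
    ¬ K.IsRung α (K.pole α p) := by
  have h1 := hα.left_ccw p.2
  have h2 := hα.not_left_ccw_symm p.2
  rw [hα.isRung_iff]
  by_cases h : K.LeftVeering α p
  · rw [pole_of_left h, ccw_symm_symm, Equiv.apply_symm_apply]; tauto
  · rw [pole_of_not_left h, ccw_ccw, Equiv.symm_apply_apply]; tauto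

/-- The number of ladders of a cusp. -/
theorem IsVeering.ladderCount_eq (hα : K.IsVeering α) (T : K.Cusp) :
    K.ladderCount α T = {A : hα.ladders.Line | hα.cuspOfLine A = T}.ncard := by
  let F : K.Ladder α → hα.ladders.Line := Quot.lift (fun c => hα.ladders.line (hα.top c)) (by
    rintro a b (rfl | ⟨hr, rfl⟩)
    · rw [hα.top_ccw]
    · rcases hα.side_cases a with h | h | h
      · rw [h, hα.cross_wide, hα.top_upper, hα.top_of_wide]
        exact (hα.ladders.line_up_symm _).symm
      · rw [h, hα.cross_upper, hα.top_upper, hα.top_of_wide]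
        exact (hα.ladders.line_up _).symm
      · exact absurd hr (h ▸ hα.not_isRung_pole _))
  have hlad : ∀ c, K.ladderOf α (hα.top c : K.Corner) = K.ladderOf α c := by
    have h1 : ∀ c, K.ladderOf α (K.ccw c) = K.ladderOf α c :=
      fun c => by symm; exact Quot.sound (Or.inl rfl)
    intro c
    rcases hα.corner_cases c with h | h | h
    · rw [← h]
    · conv_rhs => rw [h, h1]
    · conv_rhs => rw [h, ← ccw_ccw, h1, h1]
  have hup : ∀ p : K.Wide α, K.ladderOf α (hα.up p : K.Corner) = K.ladderOf α p := by
    intro p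
    rw [hα.coe_up]
    have h2 : K.ladderOf α (K.cross (K.upper α p)) = K.ladderOf α (K.upper α p) := by
      symm; exact Quot.sound (Or.inr ⟨hα.isRung_upper p, rfl⟩)
    rw [h2, ← hlad, hα.top_upper]
  have hF : Function.Injective F := by
    intro A B
    induction A using Quot.ind with | _ a =>
    induction B using Quot.ind with | _ b =>
    intro h
    have h : hα.up.SameCycle (hα.top a) (hα.top b) := (LadderSystem.line_eq_iff _).1 h
    change K.ladderOf α a = K.ladderOf α b
    rw [← hlad a, ← hlad b]
    obtain ⟨m, hm⟩ := h.exists_nat_pow_eq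
    rw [← hm]
    generalize hα.top a = p
    clear h hm
    induction m with
    | zero => rfl
    | succ m ih => rw [pow_succ', Equiv.Perm.mul_apply, hup, ← ih]
  unfold ladderCount
  rw [← Set.ncard_image_of_injective _ hF]
  congr 1
  ext A
  constructor
  · rintro ⟨_, ⟨c, hc, rfl⟩, rfl⟩
    exact (hα.cuspOf_top c).trans hc
  · intro h
    obtain ⟨p, rfl⟩ := hα.ladders.exists_line A
    refine ⟨K.ladderOf α p, ⟨p, h, rfl⟩, ?_⟩
    change hα.ladders.line (hα.top p) = _
    rw [hα.top_of_wide]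

end IdealTriangulation
end

noncomputable section
namespace IdealTriangulation
variable {ι : Type*} [Fintype ι] {K : IdealTriangulation ι}

/-! ### Real cycles and their intersection pairing -/

/-- A real dual 1-cycle of the boundary surface. -/
structure IsRealCycle (K : IdealTriangulation ι) (w : K.Corner → ℝ) : Prop where
  cross : ∀ d, w (K.cross d) = - w d
  sum : ∀ d, w d + w (K.ccw d) + w (K.ccw.symm d) = 0

/-- The intersection pairing of dual 1-cycles, up to normalization. -/
def pairing (K : IdealTriangulation ι) (w z : K.Corner → ℝ) : ℝ :=
  (∑ d, z d * (w (K.ccw.symm d) - w (K.ccw d))) / 3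

theorem sum_ccw (f : K.Corner → ℝ) : ∑ d, f (K.ccw d) = ∑ d, f d := Equiv.sum_comp K.ccw f

theorem sum_ccw_symm (f : K.Corner → ℝ) : ∑ d, f (K.ccw.symm d) = ∑ d, f d :=
  Equiv.sum_comp K.ccw.symm f

/-- The value of `w` at a corner is minus the sum of its values on the two sides that issue from its
vertex. Around the vertex these sides are glued in pairs, `ccw c` to `ccw.symm (rot c)`, so the
values cancel. -/
theorem IsRealCycle.sum_mul_eq_zero {w : K.Corner → ℝ} (hw : K.IsRealCycle w) {f : K.Corner → ℝ}
    (hf : ∀ c, f (K.rot c) = f c) : ∑ c, f c * w c = 0 := by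
  have h1 : ∑ c, f c * w (K.ccw c) = - ∑ c, f c * w (K.ccw.symm c) := by
    rw [← Equiv.sum_comp K.rot fun c => f c * w (K.ccw.symm c), ← Finset.sum_neg_distrib]
    refine Finset.sum_congr rfl fun c _ => ?_
    rw [hf, rot_apply, Equiv.symm_apply_apply, hw.cross]
    ring
  have h2 : ∑ c, f c * w c = ∑ c, -(f c * w (K.ccw c) + f c * w (K.ccw.symm c)) :=
    Finset.sum_congr rfl fun c _ => by
      have := hw.sum c
      rw [show w c = -(w (K.ccw c) + w (K.ccw.symm c)) by linarith]; ring
  rw [h2, Finset.sum_neg_distrib, Finset.sum_add_distrib, h1]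
  ring

/-- The pairing descends to homology in its second argument, which will make crossing numbers with
ladders homological. -/
theorem IsRealCycle.pairing_boundary {w : K.Corner → ℝ} (hw : K.IsRealCycle w)
    {f : K.Corner → ℝ} (hf : ∀ c, f (K.rot c) = f c) :
    K.pairing w (fun d => f (K.ccw.symm d) - f (K.ccw d)) = 0 := by
  have h0 := hw.sum_mul_eq_zero hf
  have h1 := sum_ccw fun d => f d * w d
  have h2 := sum_ccw_symm fun d => f d * w d
  have h3 := sum_ccw fun d => f (K.ccw d) * w d
  have h4 := sum_ccw_symm fun d => f (K.ccw.symm d) * w d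
  simp only [ccw_ccw, ccw_symm_symm] at h3 h4
  have h5 : ∑ d, (f d * w d + f (K.ccw d) * w d + f (K.ccw.symm d) * w d) = 0 := by
    have h6 := sum_ccw fun d => f d * w (K.ccw.symm d)
    have h7 := sum_ccw_symm fun d => f d * w (K.ccw d)
    simp only [Equiv.symm_apply_apply, Equiv.apply_symm_apply] at h6 h7
    rw [Finset.sum_add_distrib, Finset.sum_add_distrib, h6, h7, ← Finset.sum_add_distrib,
      ← Finset.sum_add_distrib]
    refine Finset.sum_eq_zero fun d _ => ?_
    rw [← mul_add, ← mul_add, add_right_comm, hw.sum, mul_zero]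
  simp only [Finset.sum_add_distrib] at h5
  have h8 : ∀ d, (f (K.ccw.symm d) - f (K.ccw d)) * (w (K.ccw.symm d) - w (K.ccw d)) =
      f (K.ccw.symm d) * w (K.ccw.symm d) + f (K.ccw d) * w (K.ccw d) -
      f (K.ccw.symm d) * w (K.ccw d) - f (K.ccw d) * w (K.ccw.symm d) := fun d => by ring
  rw [pairing]
  simp only [h8, Finset.sum_sub_distrib, Finset.sum_add_distrib]
  linarith

theorem pairing_add_left (w w' z : K.Corner → ℝ) :
    K.pairing (w + w') z = K.pairing w z + K.pairing w' z := by
  simp only [pairing, ← add_div, ← Finset.sum_add_distrib, Pi.add_apply]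
  congr 1
  exact Finset.sum_congr rfl fun d _ => by ring

theorem pairing_smul_left (a : ℝ) (w z : K.Corner → ℝ) :
    K.pairing (a • w) z = a * K.pairing w z := by
  simp only [pairing, mul_div_assoc', Finset.mul_sum, Pi.smul_apply, smul_eq_mul]
  congr 1
  exact Finset.sum_congr rfl fun d _ => by ring

theorem NormalCurve.sum_chain_mul (γ : K.NormalCurve) (u : K.Corner → ℝ) :
    ∑ d, (γ.chain d : ℝ) * u d = ∑ i, (u (γ.exit i) - u (γ.entry i)) := by
  classical
  simp only [NormalCurve.chain, Int.cast_sum, Int.cast_sub, Int.cast_ite, Int.cast_one,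
    Int.cast_zero, Finset.sum_mul]
  rw [Finset.sum_comm]
  refine Finset.sum_congr rfl fun i _ => ?_
  simp [sub_mul]

/-- The turning of a normal curve with respect to corner weights of sum zero in each triangle. -/
theorem NormalCurve.turning_eq_pairing (γ : K.NormalCurve) {A : K.Corner → ℝ}
    (hA : ∀ d, A d + A (K.ccw d) + A (K.ccw.symm d) = 0) :
    (∑ i, if γ.left i then A (γ.corner i) else - A (γ.corner i)) =
      K.pairing A fun d => (γ.chain d : ℝ) := by
  -- For weights of sum zero in each triangle, the difference of this function between exit and
  -- entry of an arc is the signed weight of the corner cut off. This is the reason for the factor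
  -- `3`.
  have h := γ.sum_chain_mul fun d => (A (K.ccw.symm d) - A (K.ccw d)) / 3
  rw [pairing, Finset.sum_div]
  simp only [mul_div_assoc] at h ⊢
  rw [h]
  refine Finset.sum_congr rfl fun i _ => ?_
  have := hA (γ.corner i)
  cases hl : γ.left i
  · simp only [NormalCurve.exit, NormalCurve.entry, hl, Bool.false_eq_true, if_false, ccw_symm_symm,
      Equiv.apply_symm_apply, Equiv.symm_apply_apply, ccw_ccw]
    linarith
  · simp only [NormalCurve.exit, NormalCurve.entry, hl, if_true, ccw_symm_symm,
      Equiv.apply_symm_apply, Equiv.symm_apply_apply, ccw_ccw]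
    linarith

/-! ### Leading-trailing deformations -/

/-- The double transposition exchanging `0` and `1`. -/
def klein₁ : alternatingGroup (Fin 4) :=
  ⟨Equiv.swap 0 1 * Equiv.swap 2 3, Equiv.Perm.mem_alternatingGroup.2 (by decide)⟩

/-- The double transposition exchanging `0` and `2`. -/
def klein₂ : alternatingGroup (Fin 4) :=
  ⟨Equiv.swap 0 2 * Equiv.swap 1 3, Equiv.Perm.mem_alternatingGroup.2 (by decide)⟩

/-- The double transposition exchanging `0` and `3`. -/
def klein₃ : alternatingGroup (Fin 4) :=
  ⟨Equiv.swap 0 3 * Equiv.swap 1 2, Equiv.Perm.mem_alternatingGroup.2 (by decide)⟩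

/-- Relabelling of flags. -/
def relabel (K : IdealTriangulation ι) (h : alternatingGroup (Fin 4)) (c : K.Corner) : K.Corner :=
  (c.1, c.2 * h)

/-- The deformation of the angles of the tetrahedra defined by weights of the corners: the pair `j`
of opposite edges of a tetrahedron gets the sum of the weights of the four corners on it. -/
def tetDeform (K : IdealTriangulation ι) (w : K.Corner → ℝ) (t : ι) (j : Fin 3) : ℝ :=
  ∑ g : alternatingGroup (Fin 4), if edgePair (g.1 0) (g.1 1) = j then w (t, g) else 0

/-- The flags over one pair of opposite edges form a coset of the Klein four-group. They are four
corners, one in each boundary triangle of the tetrahedron. -/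
theorem edgePair_klein (g h : alternatingGroup (Fin 4)) :
    edgePair ((g * h).1 0) ((g * h).1 1) = edgePair (g.1 0) (g.1 1) ↔
      h = 1 ∨ h = klein₁ ∨ h = klein₂ ∨ h = klein₃ := by
  revert g h
  decide +kernel

theorem angle_tetDeform (w : K.Corner → ℝ) (c : K.Corner) :
    K.angle (K.tetDeform w) c = w c + w (K.relabel klein₁ c) + w (K.relabel klein₂ c) +
      w (K.relabel klein₃ c) := by
  classical
  obtain ⟨t, g⟩ := c
  simp only [angle, tetDeform]
  rw [← Equiv.sum_comp (Equiv.mulLeft g)]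
  simp only [Equiv.coe_mulLeft, edgePair_klein]
  rw [← Finset.sum_filter]
  have : (Finset.univ.filter fun h : alternatingGroup (Fin 4) =>
      h = 1 ∨ h = klein₁ ∨ h = klein₂ ∨ h = klein₃) = {1, klein₁, klein₂, klein₃} := by
    ext; simp
  rw [this, Finset.sum_insert (by decide), Finset.sum_insert (by decide),
    Finset.sum_pair (by decide), mul_one]
  simp only [relabel]
  ring
end IdealTriangulation
end

/-! ### Angle sums and holonomy of a deformation. -/

noncomputable section
namespace IdealTriangulation
variable {ι : Type*} [Fintype ι] {K : IdealTriangulation ι}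

theorem relabel_relabel (g h : alternatingGroup (Fin 4)) (c : K.Corner) :
    K.relabel h (K.relabel g c) = K.relabel (g * h) c := Prod.ext rfl (mul_assoc _ _ _)

theorem ccw_eq_relabel (c : K.Corner) : K.ccw c = K.relabel cyc c := rfl

theorem ccw_symm_eq_relabel (c : K.Corner) : K.ccw.symm c = K.relabel cyc⁻¹ c := rfl

theorem relabel_klein₃_ccw (c : K.Corner) :
    K.relabel klein₃ (K.ccw c) = K.ccw (K.relabel klein₁ c) := by
  simp only [ccw_eq_relabel, relabel_relabel]
  congr 1
  decide +kernel

theorem relabel_klein₂_ccw_symm (c : K.Corner) :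
    K.relabel klein₂ (K.ccw.symm c) = K.ccw.symm (K.relabel klein₁ c) := by
  simp only [ccw_symm_eq_relabel, relabel_relabel]
  congr 1
  decide +kernel

theorem relabel_klein₁_klein₁ (c : K.Corner) : K.relabel klein₁ (K.relabel klein₁ c) = c := by
  rw [relabel_relabel, show klein₁ * klein₁ = 1 by decide +kernel]
  exact Prod.ext rfl (mul_one _)

/-- The labels `klein₂` and `klein₃` give the corners at the two ends of the opposite edge. The face
crossed by `rot` contains one of these ends on either side, and the corresponding sides are glued.
-/
theorem cross_relabel_klein₃ (c : K.Corner) :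
    K.cross (K.relabel klein₃ c) = K.relabel klein₂ (K.rot c) := by
  obtain ⟨t, g⟩ := c
  have h1 : (g * klein₃).1 1 = (g * cyc).1 1 :=
    congrArg g.1 (show klein₃.1 1 = cyc.1 1 by decide)
  refine Prod.ext ?_ (Subtype.ext ?_)
  · change K.nbr t ((g * klein₃).1 1) = K.nbr t ((g * cyc).1 1)
    rw [h1]
  · change K.perm t ((g * klein₃).1 1) * (g.1 * klein₃.1) * Equiv.swap 2 3 =
      K.perm t ((g * cyc).1 1) * (g.1 * cyc.1) * Equiv.swap 2 3 * cyc.1 * klein₂.1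
    rw [h1]
    simp only [mul_assoc]
    congr 2
    decide +kernel

/-- `klein₁` passes to the other end of the same edge, from where the tetrahedra around the edge are
seen in the opposite order. -/
theorem relabel_klein₁_rot_symm (c : K.Corner) :
    K.relabel klein₁ (K.rot.symm c) = K.rot (K.relabel klein₁ c) := by
  obtain ⟨t, g⟩ := c
  have h1 : (g * cyc⁻¹).1 1 = (g * klein₁ * cyc).1 1 :=
    congrArg g.1 (show (cyc⁻¹).1 1 = (klein₁ * cyc).1 1 by decide)
  refine Prod.ext ?_ (Subtype.ext ?_)
  · change K.nbr t ((g * cyc⁻¹).1 1) = K.nbr t ((g * klein₁ * cyc).1 1)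
    rw [h1]
  · change K.perm t ((g * cyc⁻¹).1 1) * (g.1 * (cyc⁻¹).1) * Equiv.swap 2 3 * (cyc⁻¹).1 * klein₁.1 =
      K.perm t ((g * klein₁ * cyc).1 1) * (g.1 * klein₁.1 * cyc.1) * Equiv.swap 2 3 * cyc.1
    rw [h1]
    simp only [mul_assoc]
    congr 2
    decide +kernel

theorem relabel_klein₁_rot (c : K.Corner) :
    K.relabel klein₁ (K.rot c) = K.rot.symm (K.relabel klein₁ c) := by
  have := relabel_klein₁_rot_symm (K := K) (K.relabel klein₁ c)
  rw [relabel_klein₁_klein₁] at this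
  rw [← this, relabel_klein₁_klein₁]

theorem relabel_bijective (K : IdealTriangulation ι) (h : alternatingGroup (Fin 4)) :
    Function.Bijective (K.relabel h) := by
  refine Function.bijective_iff_has_inverse.2 ⟨K.relabel h⁻¹, fun c => ?_, fun c => ?_⟩ <;>
  · rw [relabel_relabel]
    exact Prod.ext rfl (by simp [relabel])

theorem sum_relabel (h : alternatingGroup (Fin 4)) (f : K.Corner → ℝ) :
    ∑ c, f (K.relabel h c) = ∑ c, f c := (K.relabel_bijective h).sum_comp f

/-- This is the edge equation for deformations. The weights at each end of the edge have sum zero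
around it, by `sum_mul_eq_zero`. Those at the ends of the opposite edges cancel across the faces
that contain the edge. -/
theorem IsRealCycle.sum_angle_mul_eq_zero {w : K.Corner → ℝ} (hw : K.IsRealCycle w)
    {f : K.Corner → ℝ} (hf : ∀ c, f (K.rot c) = f c) :
    ∑ c, f c * K.angle (K.tetDeform w) c = 0 := by
  simp only [angle_tetDeform, mul_add, Finset.sum_add_distrib]
  have h1 : ∑ c, f c * w (K.relabel klein₁ c) = 0 := by
    rw [← sum_relabel klein₁]
    simp only [relabel_klein₁_klein₁]
    refine hw.sum_mul_eq_zero (f := fun c => f (K.relabel klein₁ c)) fun c => ?_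
    rw [relabel_klein₁_rot, ← hf, Equiv.apply_symm_apply]
  have h2 : ∑ c, f c * w (K.relabel klein₂ c) = - ∑ c, f c * w (K.relabel klein₃ c) := by
    rw [← Equiv.sum_comp K.rot, ← Finset.sum_neg_distrib]
    refine Finset.sum_congr rfl fun c _ => ?_
    rw [hf, ← cross_relabel_klein₃, hw.cross]; ring
  rw [hw.sum_mul_eq_zero hf, h1, h2]
  ring

open Classical in
theorem IsRealCycle.sum_angle_sameCycle {w : K.Corner → ℝ} (hw : K.IsRealCycle w) (c : K.Corner) :
    ∑ c' with K.rot.SameCycle c c', K.angle (K.tetDeform w) c' = 0 := by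
  rw [Finset.sum_filter]
  have := hw.sum_angle_mul_eq_zero (f := fun c' => if K.rot.SameCycle c c' then 1 else 0)
    fun c' => by simp only [Equiv.Perm.sameCycle_apply_right]
  simpa using this

/-- The sum of the deformed angles of a tetrahedron does not change. -/
theorem IsRealCycle.sum_tetDeform {w : K.Corner → ℝ} (hw : K.IsRealCycle w) (t : ι) :
    ∑ j, K.tetDeform w t j = 0 := by
  simp only [tetDeform]
  rw [Finset.sum_comm]
  simp only [Finset.sum_ite_eq, Finset.mem_univ, if_true]
  have h1 : ∑ g : alternatingGroup (Fin 4), w (t, g * cyc) = ∑ g, w (t, g) :=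
    Equiv.sum_comp (Equiv.mulRight cyc) fun g => w (t, g)
  have h2 : ∑ g : alternatingGroup (Fin 4), w (t, g * cyc⁻¹) = ∑ g, w (t, g) :=
    Equiv.sum_comp (Equiv.mulRight cyc⁻¹) fun g => w (t, g)
  have h3 : ∑ g : alternatingGroup (Fin 4), (w (t, g) + w (t, g * cyc) + w (t, g * cyc⁻¹)) = 0 :=
    Finset.sum_eq_zero fun g _ => hw.sum (t, g)
  simp only [Finset.sum_add_distrib] at h3
  linarith

theorem IsRealCycle.angle_sum {w : K.Corner → ℝ} (hw : K.IsRealCycle w) (c : K.Corner) :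
    K.angle (K.tetDeform w) c + K.angle (K.tetDeform w) (K.ccw c) +
      K.angle (K.tetDeform w) (K.ccw.symm c) = 0 := by
  rw [angle_ccw_sum, hw.sum_tetDeform]

/-- The angular holonomy of a leading-trailing deformation is the intersection pairing: the
contributions of the different boundary triangles of a tetrahedron to each other cancel. -/
theorem IsRealCycle.pairing_angle {w z : K.Corner → ℝ} (hw : K.IsRealCycle w)
    (hz : K.IsRealCycle z) : K.pairing (K.angle (K.tetDeform w)) z = K.pairing w z := by
  have key : ∑ d, (z d * (w (K.relabel klein₂ (K.ccw.symm d)) - w (K.relabel klein₃ (K.ccw d))) +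
      z (K.ccw d) * (w (K.relabel klein₁ d) - w (K.relabel klein₂ (K.ccw.symm d))) +
      z (K.ccw.symm d) * (w (K.relabel klein₃ (K.ccw d)) - w (K.relabel klein₁ d))) = 0 := by
    -- Reindexing by `rot` replaces both sides by the sides glued to them, because the rotation is
    -- reversed at the other end of the edge. The two signs cancel.
    have h1 : ∑ d, z (K.ccw.symm d) * w (K.ccw (K.relabel klein₁ d)) =
        ∑ d, z (K.ccw d) * w (K.ccw.symm (K.relabel klein₁ d)) := by
      rw [← Equiv.sum_comp K.rot]
      refine Finset.sum_congr rfl fun d _ => ?_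
      rw [relabel_klein₁_rot, rot_apply, rot_symm_apply, Equiv.symm_apply_apply,
        Equiv.apply_symm_apply, hz.cross, hw.cross]
      ring
    have h2 : ∀ d,
        (z d * (w (K.relabel klein₂ (K.ccw.symm d)) - w (K.relabel klein₃ (K.ccw d))) +
        z (K.ccw d) * (w (K.relabel klein₁ d) - w (K.relabel klein₂ (K.ccw.symm d))) +
        z (K.ccw.symm d) * (w (K.relabel klein₃ (K.ccw d)) - w (K.relabel klein₁ d))) =
        3 * (z (K.ccw.symm d) * w (K.ccw (K.relabel klein₁ d)) -
          z (K.ccw d) * w (K.ccw.symm (K.relabel klein₁ d))) := fun d => by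
      rw [relabel_klein₂_ccw_symm, relabel_klein₃_ccw]
      have e1 := hz.sum d
      have e2 := hw.sum (K.relabel klein₁ d)
      rw [show z d = -(z (K.ccw d) + z (K.ccw.symm d)) by linarith,
        show w (K.relabel klein₁ d) = -(w (K.ccw (K.relabel klein₁ d)) +
          w (K.ccw.symm (K.relabel klein₁ d))) by linarith]
      ring
    simp only [h2]
    rw [← Finset.mul_sum, Finset.sum_sub_distrib, h1]
    ring
  simp only [Finset.sum_add_distrib] at key
  rw [← sum_ccw_symm fun d => z (K.ccw d) *
      (w (K.relabel klein₁ d) - w (K.relabel klein₂ (K.ccw.symm d))),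
    ← sum_ccw fun d => z (K.ccw.symm d) *
      (w (K.relabel klein₃ (K.ccw d)) - w (K.relabel klein₁ d))] at key
  simp only [Equiv.apply_symm_apply, Equiv.symm_apply_apply, ccw_ccw, ccw_symm_symm] at key
  rw [pairing, pairing]
  congr 1
  rw [← sub_eq_zero, ← Finset.sum_sub_distrib, ← key, ← Finset.sum_add_distrib,
    ← Finset.sum_add_distrib]
  refine Finset.sum_congr rfl fun d _ => ?_
  rw [angle_tetDeform, angle_tetDeform]
  ring

end IdealTriangulation
end

noncomputable section
namespace IdealTriangulation
variable {ι : Type*} [Fintype ι] {K : IdealTriangulation ι} {α : ι → Fin 3 → ℝ}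

/-! ### Cycles running along the ladders -/

theorem upper_ne (p : K.Wide α) :
    K.upper α p ≠ p ∧ K.pole α p ≠ p ∧ K.pole α p ≠ K.upper α p := by
  have h1 := K.ccw_ne p
  have h2 := K.ccw_symm_ne p
  have h3 := K.ccw_symm_ne_ccw p
  by_cases h : K.LeftVeering α p
  · rw [upper_of_left h, pole_of_left h]; exact ⟨h1, h2, h3⟩
  · rw [upper_of_not_left h, pole_of_not_left h]; exact ⟨h2, h1, h3.symm⟩

open Classical in
/-- The function on sides with given values on lower rungs, upper rungs and ladderpole segments. -/
def IsVeering.ofSides (hα : K.IsVeering α) {X : Type*} (a b c : K.Wide α → X) (d : K.Corner) : X :=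
  if d = hα.top d then a (hα.top d) else if d = K.upper α (hα.top d) then b (hα.top d)
  else c (hα.top d)

theorem IsVeering.ofSides_wide (hα : K.IsVeering α) {X : Type*} (a b c : K.Wide α → X)
    (p : K.Wide α) : hα.ofSides a b c p = a p := by
  rw [ofSides, hα.top_of_wide, if_pos rfl]

theorem IsVeering.ofSides_upper (hα : K.IsVeering α) {X : Type*} (a b c : K.Wide α → X)
    (p : K.Wide α) : hα.ofSides a b c (K.upper α p) = b p := by
  rw [ofSides, hα.top_upper, if_neg (upper_ne p).1, if_pos rfl]

theorem IsVeering.ofSides_pole (hα : K.IsVeering α) {X : Type*} (a b c : K.Wide α → X)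
    (p : K.Wide α) : hα.ofSides a b c (K.pole α p) = c p := by
  rw [ofSides, hα.top_pole, if_neg (upper_ne p).2.1, if_neg (upper_ne p).2.2]

theorem IsVeering.sum_triangle (hα : K.IsVeering α) {R : Type*} [AddCommGroup R]
    (f : K.Corner → R) (d : K.Corner) :
    f d + f (K.ccw d) + f (K.ccw.symm d) =
      f (hα.top d) + f (K.upper α (hα.top d)) + f (K.pole α (hα.top d)) := by
  have h2 : f (hα.top d) + f (K.upper α (hα.top d)) + f (K.pole α (hα.top d)) =
      f (hα.top d) + f (K.ccw (hα.top d)) + f (K.ccw.symm (hα.top d)) := by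
    by_cases h : K.LeftVeering α (hα.top d)
    · rw [upper_of_left h, pole_of_left h]
    · rw [upper_of_not_left h, pole_of_not_left h, add_right_comm]
  rw [h2]
  rcases hα.corner_cases d with h | h | h
  · rw [← h]
  · generalize (hα.top d : K.Corner) = p at h
    subst h
    rw [ccw_ccw, Equiv.symm_apply_apply]; abel
  · generalize (hα.top d : K.Corner) = p at h
    subst h
    rw [ccw_symm_symm, Equiv.apply_symm_apply]; abel

theorem IsVeering.cross_of_sides (hα : K.IsVeering α) {R : Type*} [AddCommGroup R]
    {w : K.Corner → R} (h1 : ∀ p : K.Wide α, w (K.upper α p) = - w (hα.up p))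
    (h2 : ∀ p : K.Wide α, w (K.pole α (hα.flip p)) = - w (K.pole α p)) (d : K.Corner) :
    w (K.cross d) = - w d := by
  rcases hα.side_cases d with h | h | h
  · rw [h, hα.cross_wide, h1, Equiv.apply_symm_apply]
  · rw [h, hα.cross_upper, h1, neg_neg]
  · rw [h, hα.cross_pole_flip, h2]

theorem IsVeering.sum_corner (hα : K.IsVeering α) {R : Type*} [AddCommMonoid R]
    [Fintype (K.Wide α)] (f : K.Corner → R) :
    ∑ d, f d = ∑ p : K.Wide α, (f p + f (K.upper α p) + f (K.pole α p)) := by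
  classical
  rw [← Finset.sum_fiberwise Finset.univ hα.top f]
  refine Finset.sum_congr rfl fun p _ => ?_
  have h := upper_ne p
  have : (Finset.univ.filter fun d => hα.top d = p) =
      {(p : K.Corner), K.upper α p, K.pole α p} := by
    ext d
    simp only [Finset.mem_filter, Finset.mem_univ, true_and, Finset.mem_insert,
      Finset.mem_singleton]
    constructor
    · rintro rfl; exact hα.side_cases d
    · rintro (rfl | rfl | rfl)
      exacts [hα.top_of_wide p, hα.top_upper p, hα.top_pole p]
  rw [this, Finset.sum_insert (by simp [h.1.symm, h.2.1.symm]), Finset.sum_pair h.2.2.symm,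
    add_assoc]

/-- The real cycle running up along every ladder `A` with multiplicity `σ A`. -/
def IsVeering.ladderCycle (hα : K.IsVeering α) (σ : hα.ladders.Line → ℝ) : K.Corner → ℝ :=
  hα.ofSides (fun p => - σ (hα.ladders.line p)) (fun p => σ (hα.ladders.line p)) 0

theorem IsVeering.ladderCycle_wide (hα : K.IsVeering α) (σ : hα.ladders.Line → ℝ)
    (p : K.Wide α) : hα.ladderCycle σ p = - σ (hα.ladders.line p) := hα.ofSides_wide _ _ _ p

theorem IsVeering.ladderCycle_upper (hα : K.IsVeering α) (σ : hα.ladders.Line → ℝ)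
    (p : K.Wide α) : hα.ladderCycle σ (K.upper α p) = σ (hα.ladders.line p) :=
  hα.ofSides_upper _ _ _ p

theorem IsVeering.ladderCycle_pole (hα : K.IsVeering α) (σ : hα.ladders.Line → ℝ)
    (p : K.Wide α) : hα.ladderCycle σ (K.pole α p) = 0 := hα.ofSides_pole _ _ _ p

theorem IsVeering.line_up (hα : K.IsVeering α) (p : K.Wide α) :
    hα.ladders.line (hα.up p) = hα.ladders.line p := hα.ladders.line_up p

theorem IsVeering.isRealCycle_ladderCycle (hα : K.IsVeering α) (σ : hα.ladders.Line → ℝ) :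
    K.IsRealCycle (hα.ladderCycle σ) where
  cross := hα.cross_of_sides
    (fun p => by rw [hα.ladderCycle_upper, hα.ladderCycle_wide, hα.line_up, neg_neg])
    (fun p => by rw [hα.ladderCycle_pole, hα.ladderCycle_pole, neg_zero])
  sum d := by
    rw [hα.sum_triangle, hα.ladderCycle_wide, hα.ladderCycle_upper, hα.ladderCycle_pole]
    ring

theorem IsVeering.add_upper_add_pole (hα : K.IsVeering α) {z : K.Corner → ℝ}
    (hz : ∀ d, z d + z (K.ccw d) + z (K.ccw.symm d) = 0) (p : K.Wide α) :
    z p + z (K.upper α p) + z (K.pole α p) = 0 := by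
  have := hα.sum_triangle z p
  rw [hz, hα.top_of_wide] at this
  exact this.symm

-- A ladder cycle goes from the lower to the upper rung in each triangle, so only the flow of `z`
-- through the ladderpole segment matters. The sign tells on which side of the ladder this segment
-- lies.
open Classical in
theorem IsVeering.pairing_ladderCycle (hα : K.IsVeering α) (σ : hα.ladders.Line → ℝ)
    {z : K.Corner → ℝ} (hz : ∀ d, z d + z (K.ccw d) + z (K.ccw.symm d) = 0) :
    K.pairing (hα.ladderCycle σ) z =
      ∑ p : K.Wide α, σ (hα.ladders.line p) *
        (if K.LeftVeering α p then z (K.pole α p) else - z (K.pole α p)) := by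
  rw [pairing, hα.sum_corner, Finset.sum_div]
  refine Finset.sum_congr rfl fun p _ => ?_
  have h1 := hα.ladderCycle_wide σ p
  have h2 := hα.ladderCycle_upper σ p
  have h3 := hα.ladderCycle_pole σ p
  have h4 := hα.add_upper_add_pole hz p
  by_cases h : K.LeftVeering α p
  · rw [upper_of_left h] at h2 h4 ⊢
    rw [pole_of_left h] at h3 h4 ⊢
    rw [if_pos h, Equiv.symm_apply_apply, Equiv.apply_symm_apply, ccw_ccw, ccw_symm_symm, h1, h2,
      h3]
    rw [show z p = -(z (K.ccw p) + z (K.ccw.symm p)) by linarith]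
    ring
  · rw [upper_of_not_left h] at h2 h4 ⊢
    rw [pole_of_not_left h] at h3 h4 ⊢
    rw [if_neg h, Equiv.symm_apply_apply, Equiv.apply_symm_apply, ccw_ccw, ccw_symm_symm, h1, h2,
      h3]
    rw [show z p = -(z (K.ccw p) + z (K.ccw.symm p)) by linarith]
    ring

/-! ### Crossing numbers with ladders -/

open Classical in
/-- The number of times that a cycle crosses a ladder from its left side to its right side. -/
def IsVeering.crossing (hα : K.IsVeering α) (A : hα.ladders.Line) {R : Type*} [AddCommGroup R]
    (z : K.Corner → R) : R :=
  - ∑ p : K.Wide α with hα.ladders.line p = A ∧ K.LeftVeering α p, z (K.pole α p)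

-- Conservation of the flow in a ladder: `z (pole p) = z (up p) - z p`, which sums to zero over one
-- lap.
open Classical in
theorem IsVeering.crossing_eq_right (hα : K.IsVeering α) (A : hα.ladders.Line) {z : K.Corner → ℝ}
    (hz : K.IsRealCycle z) : hα.crossing A z =
      ∑ p : K.Wide α with hα.ladders.line p = A ∧ ¬ K.LeftVeering α p, z (K.pole α p) := by
  rw [crossing, neg_eq_iff_add_eq_zero, ← Finset.filter_filter, ← Finset.filter_filter,
    Finset.sum_filter_add_sum_filter_not, Finset.sum_filter]
  have h1 : ∀ p : K.Wide α, z (K.pole α p) = z (hα.up p) - z p := fun p => by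
    have h2 := hα.add_upper_add_pole hz.sum p
    have h3 := hz.cross (K.upper α p)
    rw [hα.cross_upper] at h3
    linarith
  have h4 : ∀ p : K.Wide α, (if hα.ladders.line p = A then z (K.pole α p) else 0) =
      (if hα.ladders.line (hα.up p) = A then z (hα.up p) else 0) -
      (if hα.ladders.line p = A then z p else 0) := fun p => by
    rw [hα.line_up, h1]
    split_ifs <;> ring
  simp only [h4, Finset.sum_sub_distrib]
  rw [Equiv.sum_comp hα.up fun p => if hα.ladders.line p = A then z p else 0, sub_self]

/-- Ladders are glued left side to left side and right side to right side. A flow that enters one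
ladder through its left side therefore leaves the adjacent one through its left side. -/
theorem IsVeering.crossing_flipLine (hα : K.IsVeering α) (b : Bool) (A : hα.ladders.Line)
    {z : K.Corner → ℝ} (hz : K.IsRealCycle z) :
    hα.crossing (hα.ladders.flipLine b A) z = - hα.crossing A z := by
  classical
  let F : Equiv.Perm (K.Wide α) := ⟨hα.flip, hα.flip, hα.flip_flip, hα.flip_flip⟩
  have hF : ∀ p, z (K.pole α (hα.flip p)) = - z (K.pole α p) := fun p => by
    rw [← hα.cross_pole_flip, hz.cross]
  have hline : ∀ (b : Bool) (p : K.Wide α), (K.LeftVeering α p ↔ b = true) →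
      (hα.ladders.line (hα.flip p) = hα.ladders.flipLine b A ↔ hα.ladders.line p = A) := by
    intro b p h
    have h1 : hα.ladders.flipLine b (hα.ladders.line p) = hα.ladders.line (hα.flip p) :=
      hα.ladders.flipLine_line h
    rw [← h1]
    exact ⟨fun h2 => by rw [← hα.ladders.flipLine_flipLine b A, ← h2,
      hα.ladders.flipLine_flipLine], fun h2 => by rw [h2]⟩
  cases b
  · rw [hα.crossing_eq_right _ hz, hα.crossing_eq_right _ hz, Finset.sum_filter, Finset.sum_filter,
      ← Equiv.sum_comp F, ← Finset.sum_neg_distrib]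
    refine Finset.sum_congr rfl fun p _ => ?_
    change (if hα.ladders.line (hα.flip p) = _ ∧ ¬ K.LeftVeering α (hα.flip p) then
      z (K.pole α (hα.flip p)) else 0) = _
    by_cases h : K.LeftVeering α p
    · rw [if_neg (by rw [hα.left_flip]; tauto), if_neg (by tauto), neg_zero]
    · simp only [hα.left_flip, hline false p (iff_of_false h Bool.false_ne_true), hF]
      split_ifs <;> simp
  · rw [crossing, crossing, Finset.sum_filter, Finset.sum_filter,
      ← Equiv.sum_comp F]
    congr 1
    rw [← Finset.sum_neg_distrib]
    refine Finset.sum_congr rfl fun p _ => ?_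
    change (if hα.ladders.line (hα.flip p) = _ ∧ K.LeftVeering α (hα.flip p) then
      z (K.pole α (hα.flip p)) else 0) = _
    by_cases h : K.LeftVeering α p
    · simp only [hα.left_flip, hline true p (iff_of_true h rfl), hF]
      split_ifs <;> simp
    · rw [if_neg (by rw [hα.left_flip]; tauto), if_neg (by tauto)]; simp

/-- The factor `2` appears because both sides of each ladder see the whole flow through it. -/
theorem IsVeering.pairing_ladderCycle_eq (hα : K.IsVeering α) [Fintype hα.ladders.Line]
    (σ : hα.ladders.Line → ℝ) {z : K.Corner → ℝ} (hz : K.IsRealCycle z) :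
    K.pairing (hα.ladderCycle σ) z = - 2 * ∑ A, σ A * hα.crossing A z := by
  classical
  rw [hα.pairing_ladderCycle σ hz.sum, ← Finset.sum_fiberwise Finset.univ hα.ladders.line,
    Finset.mul_sum]
  refine Finset.sum_congr rfl fun A _ => ?_
  have h1 : hα.crossing A z + hα.crossing A z = _ :=
    congrArg (hα.crossing A z + ·) (hα.crossing_eq_right A hz)
  have h2 : ∀ p ∈ Finset.univ.filter (fun p => hα.ladders.line p = A),
      σ (hα.ladders.line p) * (if K.LeftVeering α p then z (K.pole α p) else - z (K.pole α p)) =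
      σ A * ((if K.LeftVeering α p then z (K.pole α p) else 0) -
        if ¬ K.LeftVeering α p then z (K.pole α p) else 0) := by
    intro p hp
    rw [(Finset.mem_filter.1 hp).2]
    split_ifs <;> ring
  rw [Finset.sum_congr rfl h2, ← Finset.mul_sum, Finset.sum_sub_distrib, ← Finset.sum_filter,
    ← Finset.sum_filter, Finset.filter_filter, Finset.filter_filter, ← hα.crossing_eq_right A hz,
    show (-2 : ℝ) * (σ A * hα.crossing A z) = σ A * (-hα.crossing A z - hα.crossing A z) by ring]
  congr 2
  rw [crossing, neg_neg]

theorem isRealCycle_of_mem {z : K.Corner → ℤ} (hz : z ∈ K.cycles) :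
    K.IsRealCycle fun d => (z d : ℝ) where
  cross d := by rw [hz.1]; push_cast; ring
  sum d := by
    have := hz.2 d
    rw [ccw_ccw] at this
    exact_mod_cast this

theorem IsVeering.crossing_cast (hα : K.IsVeering α) (A : hα.ladders.Line) (z : K.Corner → ℤ) :
    ((hα.crossing A z : ℤ) : ℝ) = hα.crossing A fun d => (z d : ℝ) := by
  simp [crossing]

/-- The crossing number is, up to the factor `-2`, the pairing with the ladder cycle of the single
ladder `A`, and boundaries pair to zero. -/
theorem IsVeering.crossing_of_mem_boundaries (hα : K.IsVeering α) (A : hα.ladders.Line)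
    {z : K.Corner → ℤ} (hz : z ∈ K.cycles) (hb : z ∈ K.boundaries) : hα.crossing A z = 0 := by
  classical
  have := Fintype.ofFinite hα.ladders.Line
  obtain ⟨f, hf, hz'⟩ := hb
  have h1 := (hα.isRealCycle_ladderCycle (Pi.single A 1)).pairing_boundary
    (f := fun c => (f c : ℝ)) (fun c => by rw [hf])
  have h2 : (fun d => ((f (K.ccw.symm d) : ℝ) - (f (K.ccw d) : ℝ))) = fun d => (z d : ℝ) := by
    ext d; rw [hz']; push_cast; ring
  rw [h2, hα.pairing_ladderCycle_eq _ (isRealCycle_of_mem hz)] at h1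
  simp only [Pi.single_apply, ite_mul, one_mul, zero_mul, Finset.sum_ite_eq', Finset.mem_univ,
    if_true, ← hα.crossing_cast] at h1
  have h3 : ((hα.crossing A z : ℤ) : ℝ) = 0 := by linarith
  exact_mod_cast h3

/-- The crossing number as a homomorphism on cycles. -/
def IsVeering.crossingHom (hα : K.IsVeering α) (A : hα.ladders.Line) : K.H1 →+ ℤ :=
  QuotientAddGroup.lift _
    { toFun := fun z : K.cycles => hα.crossing A z.1
      map_zero' := by simp [crossing]
      map_add' := fun z z' => by
        simp [crossing, Finset.sum_add_distrib]
        ring }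
    fun z hz => hα.crossing_of_mem_boundaries A z.2 hz

theorem IsVeering.crossingHom_mk (hα : K.IsVeering α) (A : hα.ladders.Line) (z : K.cycles) :
    hα.crossingHom A (QuotientAddGroup.mk z) = hα.crossing A z.1 := rfl

theorem IsVeering.crossingHom_curve (hα : K.IsVeering α) (A : hα.ladders.Line)
    (γ : K.NormalCurve) : hα.crossingHom A γ.homologyClass = hα.crossing A γ.chain := rfl

theorem IsVeering.crossingHom_flipLine (hα : K.IsVeering α) (b : Bool) (A : hα.ladders.Line)
    (x : K.H1) : hα.crossingHom (hα.ladders.flipLine b A) x = - hα.crossingHom A x := by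
  induction x using QuotientAddGroup.induction_on with
  | H z =>
    rw [hα.crossingHom_mk, hα.crossingHom_mk]
    have := hα.crossing_flipLine b A (isRealCycle_of_mem z.2)
    rw [← hα.crossing_cast, ← hα.crossing_cast] at this
    exact_mod_cast this

/-- Up to sign, the crossing number is the same for all ladders of a cusp. -/
theorem IsLadderColoring.mul_crossingHom {hα : K.IsVeering α} {ε} (hε : IsLadderColoring hα ε)
    {A B : hα.ladders.Line} (h : hα.cuspOfLine A = hα.cuspOfLine B) (x : K.H1) :
    ε A * hα.crossingHom A x = ε B * hα.crossingHom B x :=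
  hα.line_eq_of_cuspOfLine_eq (fun A => ε A * hα.crossingHom A x)
    (fun b A => by rw [hε.flipLine, hα.crossingHom_flipLine]; ring) h

/-- Classes of other cusps do not cross the ladders of a cusp. -/
theorem IsVeering.crossingHom_of_mem_cuspH1 (hα : K.IsVeering α) {T : K.Cusp} {x : K.H1}
    (hx : x ∈ K.cuspH1 T) {A : hα.ladders.Line} (hA : hα.cuspOfLine A ≠ T) :
    hα.crossingHom A x = 0 := by
  classical
  obtain ⟨z, hz, rfl⟩ := hx
  change hα.crossing A z.1 = 0
  rw [crossing, neg_eq_zero]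
  refine Finset.sum_eq_zero fun p hp => hz _ fun h => hA ?_
  rw [← (Finset.mem_filter.1 hp).2.1, hα.cuspOfLine_line, ← h, cuspOf_pole]

end IdealTriangulation
end

noncomputable section

/-! ### The turning number of a periodic embedded polygonal line -/

/-- Inside an open half-plane, the principal argument of a quotient is a difference of arguments,
without a jump by `2π`. All the additivity of angles below comes from this. -/
theorem arg_div_of_re_pos {u z w : ℂ} (hz : 0 < (u * z).re) (hw : 0 < (u * w).re) :
    (w / z).arg = (u * w).arg - (u * z).arg := by
  have hu : u ≠ 0 := by rintro rfl; simp at hz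
  have hz0 : u * z ≠ 0 := by intro h; rw [h] at hz; simp at hz
  have hw0 : u * w ≠ 0 := by intro h; rw [h] at hw; simp at hw
  have h1 := abs_lt.1 (Complex.abs_arg_lt_pi_div_two_iff.2 (Or.inl hz))
  have h2 := abs_lt.1 (Complex.abs_arg_lt_pi_div_two_iff.2 (Or.inl hw))
  have h3 : w / z = (u * w) * (u * z)⁻¹ := by
    rw [← div_eq_mul_inv, mul_div_mul_left _ _ hu]
  have h4 : ((u * z)⁻¹).arg = -(u * z).arg := by
    rw [Complex.arg_inv, if_neg]
    intro h; linarith [Real.pi_pos, h1.2]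
  rw [h3, (Complex.arg_mul_eq_add_arg_iff hw0 (inv_ne_zero hz0)).2, h4, sub_eq_add_neg]
  rw [h4]
  constructor <;> linarith [h1.1, h1.2, h2.1, h2.2]

theorem arg_div_add_arg_div {u x y z : ℂ} (hx : 0 < (u * x).re) (hy : 0 < (u * y).re)
    (hz : 0 < (u * z).re) : (y / x).arg + (z / y).arg = (z / x).arg := by
  rw [arg_div_of_re_pos hx hy, arg_div_of_re_pos hy hz, arg_div_of_re_pos hx hz]
  ring

/-- The differences of the points of two disjoint segments lie in an open half-plane. -/
theorem exists_re_pos_of_disjoint_segment {a b c d : ℂ}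
    (h : Disjoint (segment ℝ a b) (segment ℝ c d)) :
    ∃ u : ℂ, ∀ p ∈ segment ℝ a b, ∀ q ∈ segment ℝ c d, 0 < (u * (q - p)).re := by
  have hc : ∀ x y : ℂ, IsCompact (segment ℝ x y) := fun x y => by
    rw [segment_eq_image_lineMap]
    exact isCompact_Icc.image (by fun_prop)
  obtain ⟨f, s, t, h1, h2, h3⟩ := geometric_hahn_banach_compact_closed (convex_segment a b)
    (hc a b) (convex_segment c d) (hc c d).isClosed h
  -- This complex number represents the separating functional: the real part of its product with `z`
  -- is `f z`.
  refine ⟨f 1 - Complex.I * f Complex.I, fun p hp q hq => ?_⟩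
  have h4 : ∀ z : ℂ, (((f 1 : ℝ) - Complex.I * (f Complex.I : ℝ) : ℂ) * z).re = f z := by
    intro z
    have h5 : z = z.re • (1 : ℂ) + z.im • Complex.I := by
      simp [Complex.re_add_im]
    conv_rhs => rw [h5]
    rw [map_add, map_smul, map_smul]
    simp
    ring
  rw [h4, map_sub]
  linarith [h1 p hp, h3 q hq]

/-- Hopf's Umlaufsatz for periodic polygonal lines. -/
theorem sum_arg_eq_zero_of_embedded (P : ℕ → ℂ) (n : ℕ) (hn : 1 ≤ n) (V : ℂ)
    (hper : ∀ i, P (i + n) = P i + V)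
    (hseg : ∀ i j, i + 2 ≤ j →
      Disjoint (segment ℝ (P i) (P (i + 1))) (segment ℝ (P j) (P (j + 1))))
    (hturn : ∀ i, ∃ u : ℂ, 0 < (u * (P (i + 1) - P i)).re ∧
      0 < (u * (P (i + 2) - P (i + 1))).re) :
    ∑ i ∈ Finset.range n, ((P (i + 2) - P (i + 1)) / (P (i + 1) - P i)).arg = 0 := by
  -- Hopf's argument follows the secants from `P i` to `P j`. `a` is the rotation of the secant when
  -- its end advances, `b` when its start advances. `S g` is its rotation along one period of a
  -- staircase of index gap `g`.
  set a : ℕ → ℕ → ℝ := fun i j => ((P (j + 1) - P i) / (P j - P i)).arg with ha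
  set b : ℕ → ℕ → ℝ := fun i j => ((P j - P (i + 1)) / (P j - P i)).arg with hb
  set S : ℕ → ℝ := fun g => ∑ i ∈ Finset.range n, (a i (i + g) + b i (i + g + 1)) with hS
  have hV : ∀ i j, P (j + n) - P (i + n) = P j - P i := fun i j => by
    rw [hper, hper]; ring
  -- The four secants between two disjoint segments lie in a half-plane, so both ways around this
  -- square rotate by the same angle. This allows the gap to be increased.
  have hsq : ∀ i j, i + 2 ≤ j → a i j + b i (j + 1) = b i j + a (i + 1) j := by
    intro i j hij
    obtain ⟨u, hu⟩ := exists_re_pos_of_disjoint_segment (hseg i j hij)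
    have h00 := hu _ (left_mem_segment ℝ _ _) _ (left_mem_segment ℝ _ _)
    have h01 := hu _ (left_mem_segment ℝ _ _) _ (right_mem_segment ℝ _ _)
    have h10 := hu _ (right_mem_segment ℝ _ _) _ (left_mem_segment ℝ _ _)
    have h11 := hu _ (right_mem_segment ℝ _ _) _ (right_mem_segment ℝ _ _)
    simp only [ha, hb]
    rw [arg_div_add_arg_div h00 h01 h11, arg_div_add_arg_div h00 h10 h11]
  have hstep : ∀ g, 1 ≤ g → S (g + 1) = S g := by
    intro g hg
    simp only [hS]
    have h1 : ∀ i, a i (i + (g + 1)) + b i (i + (g + 1) + 1) =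
        b i (i + g + 1) + a (i + 1) (i + 1 + g) := fun i => by
      rw [show i + 1 + g = i + g + 1 by ring, ← add_assoc]
      exact hsq i (i + g + 1) (by omega)
    simp only [h1, Finset.sum_add_distrib]
    rw [add_comm]
    congr 1
    have h2 := Finset.sum_range_succ (fun i => a i (i + g)) n
    rw [Finset.sum_range_succ'] at h2
    have h3 : a n (n + g) = a 0 (0 + g) := by
      simp only [ha]
      rw [show n + g + 1 = (0 + g + 1) + n by ring, show n + g = (0 + g) + n by ring]
      conv_lhs => rw [show P n = P (0 + n) by rw [zero_add]]
      rw [hV, hV]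
    rw [h3] at h2
    exact add_right_cancel h2
  have hall : ∀ g, S (g + 1) = S 1 := by
    intro g
    induction g with
    | zero => rfl
    | succ g ih => rw [hstep (g + 1) (by omega), ih]
  have h1 : S 1 = ∑ i ∈ Finset.range n, ((P (i + 2) - P (i + 1)) / (P (i + 1) - P i)).arg := by
    refine Finset.sum_congr rfl fun i _ => ?_
    obtain ⟨u, hu1, hu2⟩ := hturn i
    refine arg_div_add_arg_div hu1 (?_ : 0 < (u * (P (i + 1 + 1) - P i)).re) hu2
    rw [show u * (P (i + 1 + 1) - P i) =
      u * (P (i + 1) - P i) + u * (P (i + 2) - P (i + 1)) by ring, Complex.add_re]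
    exact add_pos hu1 hu2
  -- At a gap of one period the secant is `V` at the beginning of every step of the staircase and
  -- again at its end.
  have hSn : S n = 0 := by
    refine Finset.sum_eq_zero fun i _ => ?_
    have key : ∃ u : ℂ, 0 < (u * (P (i + n) - P i)).re ∧
        0 < (u * (P (i + n + 1) - P i)).re := by
      rcases eq_or_lt_of_le hn with h | h
      · obtain ⟨u, hu1, hu2⟩ := hturn i
        rw [← h]
        refine ⟨u, hu1, ?_⟩
        rw [show u * (P (i + 1 + 1) - P i) =
          u * (P (i + 1) - P i) + u * (P (i + 2) - P (i + 1)) by ring, Complex.add_re]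
        exact add_pos hu1 hu2
      · obtain ⟨u, hu⟩ := exists_re_pos_of_disjoint_segment (hseg i (i + n) (by omega))
        exact ⟨u, hu _ (left_mem_segment ℝ _ _) _ (left_mem_segment ℝ _ _),
          hu _ (left_mem_segment ℝ _ _) _ (right_mem_segment ℝ _ _)⟩
    obtain ⟨u, hu1, hu2⟩ := key
    have e : P (i + n + 1) - P (i + 1) = P (i + n) - P i := by
      rw [show i + n + 1 = (i + 1) + n by ring, hper, hper]; ring
    simp only [ha, hb]
    rw [e, arg_div_add_arg_div hu1 hu2 hu1, div_self, Complex.arg_one]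
    intro h0
    rw [h0] at hu1
    simp at hu1
  obtain ⟨m, rfl⟩ : ∃ m, n = m + 1 := ⟨n - 1, by omega⟩
  rw [← h1, ← hall m, hSn]

end

/-! ### Flat structures on the boundary surface, and the angles between sides. -/

noncomputable section

open Classical in
/-- A function on a finite set is a coboundary for a permutation if its sum over each cycle
vanishes. -/
theorem exists_eq_sub_of_sum_cycle {X : Type*} [Fintype X] (U : Equiv.Perm X) (f : X → ℝ)
    (hf : ∀ x, ∑ y with U.SameCycle x y, f y = 0) : ∃ b : X → ℝ, ∀ x, b (U x) - b x = f x := by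
  set n := orderOf U with hn
  have hn0 : 0 < n := orderOf_pos U
  have hU : ∀ x, (U ^ n) x = x := fun x => by rw [hn, pow_orderOf_eq_one]; rfl
  set g : X → ℝ := fun x => ∑ k ∈ Finset.range n, f ((U ^ k) x) with hg
  have hgU : ∀ x, g (U x) = g x := by
    intro x
    have h := Finset.sum_range_succ (fun k => f ((U ^ k) x)) n
    rw [Finset.sum_range_succ', hU] at h
    simp only [pow_succ, Equiv.Perm.mul_apply, pow_zero, Equiv.Perm.one_apply] at h
    exact add_right_cancel h
  have hgc : ∀ x y, U.SameCycle x y → g y = g x := by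
    intro x y h
    obtain ⟨m, rfl⟩ := h.exists_nat_pow_eq
    clear h
    induction m with
    | zero => rfl
    | succ m ih => rw [pow_succ', Equiv.Perm.mul_apply, hgU, ih]
  -- `g` is constant on each cycle, and its sum over the cycle vanishes since that of `f` does.
  have hg0 : ∀ x, g x = 0 := by
    intro x
    have h1 : ∑ y with U.SameCycle x y, g y = 0 := by
      simp only [hg]
      rw [Finset.sum_comm]
      refine Finset.sum_eq_zero fun k _ => ?_
      rw [← hf x, Finset.sum_filter, Finset.sum_filter,
        ← Equiv.sum_comp (U ^ k) fun y => if U.SameCycle x y then f y else 0]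
      refine Finset.sum_congr rfl fun y _ => ?_
      simp only [Equiv.Perm.sameCycle_pow_right]
    rw [Finset.sum_congr rfl fun y hy => hgc x y (Finset.mem_filter.1 hy).2, Finset.sum_const,
      nsmul_eq_mul] at h1
    refine (mul_eq_zero.1 h1).resolve_left ?_
    have : 0 < (Finset.univ.filter fun y => U.SameCycle x y).card :=
      Finset.card_pos.2 ⟨x, by simp [Equiv.Perm.SameCycle.refl]⟩
    positivity
  -- Applying `U` lowers each coefficient by one, which costs a full sum of `f` and hence nothing,
  -- except that the term `k = n`, where `U ^ n` is the identity, contributes `n * f x`.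
  refine ⟨fun x => (∑ k ∈ Finset.range n, (k : ℝ) * f ((U ^ k) x)) / n, fun x => ?_⟩
  have h2 : ∑ k ∈ Finset.range n, ((k : ℝ) + 1) * f ((U ^ (k + 1)) x) =
      ∑ k ∈ Finset.range n, (k : ℝ) * f ((U ^ k) x) + n * f x := by
    have h := Finset.sum_range_succ (fun k => (k : ℝ) * f ((U ^ k) x)) n
    rw [Finset.sum_range_succ', hU] at h
    simpa using h
  have h3 : ∑ k ∈ Finset.range n, f ((U ^ k) (U x)) = 0 := hg0 (U x)
  simp only [add_mul, one_mul, Finset.sum_add_distrib, pow_succ, Equiv.Perm.mul_apply] at h2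
  rw [h3, add_zero] at h2
  beta_reduce
  rw [h2]
  field_simp
  ring

theorem arg_div_of_polar {a r₁ r₂ θ₁ θ₂ : ℝ} (ha : a ≠ 0) (h₁ : 0 < r₁) (h₂ : 0 < r₂)
    (hθ : θ₂ - θ₁ ∈ Set.Ioc (-Real.pi) Real.pi) {x y : ℂ}
    (hx : x = a * (r₁ * Complex.exp (θ₁ * Complex.I)))
    (hy : y = a * (r₂ * Complex.exp (θ₂ * Complex.I))) : (y / x).arg = θ₂ - θ₁ := by
  have h : y / x = ((r₂ / r₁ : ℝ) : ℂ) * Complex.exp ((θ₂ - θ₁ : ℝ) * Complex.I) := by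
    have ha' : (a : ℂ) ≠ 0 := by exact_mod_cast ha
    have h1' : (r₁ : ℂ) ≠ 0 := by exact_mod_cast h₁.ne'
    have he := Complex.exp_ne_zero (θ₁ * Complex.I)
    rw [hx, hy]
    push_cast
    rw [sub_mul, Complex.exp_sub]
    field_simp
  rw [h, Complex.arg_real_mul _ (div_pos h₂ h₁), Complex.arg_exp_mul_I, toIocMod_eq_self]
  rwa [show -Real.pi + 2 * Real.pi = Real.pi by ring]

theorem exists_polar_one_add (b : ℝ) :
    ∃ r : ℝ, 0 < r ∧ (1 + b * Complex.I : ℂ) = r * Complex.exp (Real.arctan b * Complex.I) := by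
  refine ⟨√(1 + b ^ 2), Real.sqrt_pos.2 (by positivity), ?_⟩
  have h : √(1 + b ^ 2) ≠ 0 := (Real.sqrt_pos.2 (by positivity)).ne'
  rw [Complex.exp_mul_I, ← Complex.ofReal_cos, ← Complex.ofReal_sin, Real.cos_arctan,
    Real.sin_arctan]
  apply Complex.ext <;> simp <;> field_simp

namespace IdealTriangulation
variable {ι : Type*} [Fintype ι] {K : IdealTriangulation ι} {α : ι → Fin 3 → ℝ}

/-! ### A flat structure with vertical ladderpoles -/

/-- A flat structure on the boundary surface in which the ladderpoles are vertical and all the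
ladders have width `1`.  The ladder of `p` points up or down according to the sign `sgn p`, the
ladderpole segment of `p` has length `len p`, and its lower rung has slope `slope p`. -/
structure FlatStructure (hα : K.IsVeering α) where
  sgn : K.Wide α → ℝ
  sgn_eq : ∀ p, sgn p = 1 ∨ sgn p = -1
  sgn_up : ∀ p, sgn (hα.up p) = sgn p
  sgn_flip : ∀ p, sgn (hα.flip p) = - sgn p
  len : K.Wide α → ℝ
  len_pos : ∀ p, 0 < len p
  len_flip : ∀ p, len (hα.flip p) = len p
  slope : K.Wide α → ℝ
  slope_left : ∀ p : K.Wide α, K.LeftVeering α p → slope (hα.up p) = slope p - len p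
  slope_right : ∀ p : K.Wide α, ¬ K.LeftVeering α p → slope (hα.up p) = slope p + len p

/-- Every ladderpole gets total length `1`, equally divided among its segments; the division agrees
from both sides because `flip` matches the triangles. Climbing once around a ladder, the slope of
the rungs loses `1` at the left side and gains `1` at the right side, so slopes exist by
`exists_eq_sub_of_sum_cycle`. -/
theorem IsLadderColoring.exists_flatStructure {hα : K.IsVeering α} {ε}
    (hε : IsLadderColoring hα ε) :
    ∃ Φ : FlatStructure hα, ∀ p, Φ.sgn p = ε (hα.ladders.line p) := by
  classical
  let B : K.Wide α → Finset (K.Wide α) := fun p =>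
    Finset.univ.filter fun q => hα.up.SameCycle p q ∧ (K.LeftVeering α p ↔ K.LeftVeering α q)
  have hBpos : ∀ p, 0 < (B p).card := fun p =>
    Finset.card_pos.2 ⟨p, by simp [B, Equiv.Perm.SameCycle.refl]⟩
  have hBle : ∀ p, (B p).card ≤ (B (hα.flip p)).card := fun p =>
    Finset.card_le_card_of_injOn hα.flip (fun q hq => by
      simp only [B, Finset.coe_filter, Finset.mem_univ, true_and, Set.mem_ofPred_eq] at hq ⊢
      rw [hα.left_flip, hα.left_flip]
      exact ⟨hα.ladders.sameCycle_flip hq.1 hq.2, hq.2⟩) hα.flip_injective.injOn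
  have hBflip : ∀ p, (B (hα.flip p)).card = (B p).card := fun p =>
    le_antisymm ((hBle _).trans_eq (by rw [hα.flip_flip])) (hBle p)
  have hBeq : ∀ p q, hα.up.SameCycle p q → (K.LeftVeering α p ↔ K.LeftVeering α q) →
      B p = B q := by
    intro p q h1 h2
    ext r
    simp only [B, Finset.mem_filter, Finset.mem_univ, true_and, h2]
    exact and_congr_left fun _ => ⟨fun h => h1.symm.trans h, fun h => h1.trans h⟩
  let len : K.Wide α → ℝ := fun p => 1 / (B p).card
  have hsum : ∀ p, ∑ q ∈ B p, len q = 1 := by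
    intro p
    have h1 : ∀ q ∈ B p, len q = 1 / (B p).card := fun q hq => by
      have hq := (Finset.mem_filter.1 hq).2
      simp only [len, hBeq p q hq.1 hq.2]
    have := hBpos p
    rw [Finset.sum_congr rfl h1, Finset.sum_const, nsmul_eq_mul]
    field_simp
  obtain ⟨b, hb⟩ := exists_eq_sub_of_sum_cycle hα.up
    (fun p => if K.LeftVeering α p then - len p else len p) (by
      intro p
      obtain ⟨q, hq1, hq2⟩ := hα.ladders.exists_line_left (hα.ladders.line p) true
      obtain ⟨r, hr1, hr2⟩ := hα.ladders.exists_line_left (hα.ladders.line p) false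
      rw [LadderSystem.line_eq_iff] at hq1 hr1
      change K.LeftVeering α q ↔ _ at hq2
      change K.LeftVeering α r ↔ _ at hr2
      simp only [iff_true] at hq2
      simp only [Bool.false_eq_true, iff_false] at hr2
      rw [Finset.sum_ite, Finset.filter_filter, Finset.filter_filter, Finset.sum_neg_distrib]
      have hadd : ∀ a b : ℝ, a = 1 → b = 1 → -a + b = 0 := fun a b h h' => by rw [h, h']; ring
      apply hadd
      · rw [← hsum q]
        refine Finset.sum_congr ?_ fun _ _ => rfl
        ext x
        simp only [B, Finset.mem_filter, Finset.mem_univ, true_and, hq2, true_iff]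
        exact and_congr_left fun _ => ⟨fun h => hq1.trans h, fun h => hq1.symm.trans h⟩
      · rw [← hsum r]
        refine Finset.sum_congr ?_ fun _ _ => rfl
        ext x
        simp only [B, Finset.mem_filter, Finset.mem_univ, true_and, hr2, false_iff]
        exact and_congr_left fun _ => ⟨fun h => hr1.trans h, fun h => hr1.symm.trans h⟩)
  refine ⟨{ sgn := fun p => ε (hα.ladders.line p)
            sgn_eq := fun p => ?_
            sgn_up := fun p => by rw [hα.line_up]
            sgn_flip := fun p => by rw [hε.flip]; push_cast; rfl
            len := len
            len_pos := fun p => one_div_pos.2 (by exact_mod_cast hBpos p)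
            len_flip := fun p => by simp only [len, hBflip]
            slope := b
            slope_left := fun p h => ?_
            slope_right := fun p h => ?_ }, fun p => rfl⟩
  · rcases hε.eq_or (hα.ladders.line p) with h | h <;> simp [h]
  · have := hb p; rw [if_pos h] at this; linarith
  · have := hb p; rw [if_neg h] at this; linarith

namespace FlatStructure

variable {hα : K.IsVeering α} (Φ : FlatStructure hα)

theorem sgn_ne (p : K.Wide α) : Φ.sgn p ≠ 0 := by
  rcases Φ.sgn_eq p with h | h <;> rw [h] <;> norm_num

theorem sgn_mul_sgn (p : K.Wide α) : Φ.sgn p * Φ.sgn p = 1 := by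
  rcases Φ.sgn_eq p with h | h <;> rw [h] <;> norm_num

/-- The vector of the lower rung of a triangle, from left to right. -/
def rung (p : K.Wide α) : ℂ := Φ.sgn p * (1 + Φ.slope p * Complex.I)

/-- The upward vector of the ladderpole segment of a triangle. -/
def rise (p : K.Wide α) : ℂ := Φ.sgn p * (Φ.len p * Complex.I)

open Classical in
/-- The vector of a side of a boundary triangle, in the counterclockwise direction. -/
def side : K.Corner → ℂ :=
  hα.ofSides Φ.rung (fun p => - Φ.rung (hα.up p))
    (fun p => if K.LeftVeering α p then - Φ.rise p else Φ.rise p)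

theorem side_wide (p : K.Wide α) : Φ.side p = Φ.rung p := hα.ofSides_wide _ _ _ p

theorem side_upper (p : K.Wide α) : Φ.side (K.upper α p) = - Φ.rung (hα.up p) :=
  hα.ofSides_upper _ _ _ p

theorem side_pole_left {p : K.Wide α} (h : K.LeftVeering α p) :
    Φ.side (K.pole α p) = - Φ.rise p := by
  rw [side, hα.ofSides_pole, if_pos h]

theorem side_pole_right {p : K.Wide α} (h : ¬ K.LeftVeering α p) :
    Φ.side (K.pole α p) = Φ.rise p := by
  rw [side, hα.ofSides_pole, if_neg h]

theorem rise_flip (p : K.Wide α) : Φ.rise (hα.flip p) = - Φ.rise p := by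
  rw [rise, rise, Φ.sgn_flip, Φ.len_flip]; push_cast; ring

theorem rung_up_left {p : K.Wide α} (h : K.LeftVeering α p) :
    Φ.rung (hα.up p) = Φ.rung p - Φ.rise p := by
  rw [rung, rung, rise, Φ.sgn_up, Φ.slope_left p h]; push_cast; ring

theorem rung_up_right {p : K.Wide α} (h : ¬ K.LeftVeering α p) :
    Φ.rung (hα.up p) = Φ.rung p + Φ.rise p := by
  rw [rung, rung, rise, Φ.sgn_up, Φ.slope_right p h]; push_cast; ring

theorem side_cross (d : K.Corner) : Φ.side (K.cross d) = - Φ.side d := by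
  refine hα.cross_of_sides (fun p => by rw [side_upper, side_wide]) (fun p => ?_) d
  by_cases h : K.LeftVeering α p
  · rw [side_pole_left _ h, side_pole_left _ ((hα.left_flip p).2 h), rise_flip]
  · rw [side_pole_right _ h, side_pole_right _ (mt (hα.left_flip p).1 h), rise_flip]

theorem side_sum (d : K.Corner) :
    Φ.side d + Φ.side (K.ccw d) + Φ.side (K.ccw.symm d) = 0 := by
  rw [hα.sum_triangle, side_wide, side_upper]
  by_cases h : K.LeftVeering α (hα.top d)
  · rw [side_pole_left _ h, rung_up_left _ h]; ring
  · rw [side_pole_right _ h, rung_up_right _ h]; ring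

/-- The determinant of two vectors of the plane. -/
def _root_.Complex.det₂ (x y : ℂ) : ℝ := x.re * y.im - x.im * y.re

/-- This is twice the area of the triangle, the same for all three corners. It is computed from a
rung of horizontal extent `±1` and the vertical side. -/
theorem det_side_pos (d : K.Corner) : 0 < Complex.det₂ (Φ.side d) (Φ.side (K.ccw d)) := by
  have hrot : ∀ d, Complex.det₂ (Φ.side (K.ccw d)) (Φ.side (K.ccw.symm d)) =
      Complex.det₂ (Φ.side d) (Φ.side (K.ccw d)) := by
    intro d
    have h := Φ.side_sum d
    have h1 : Φ.side (K.ccw.symm d) = -(Φ.side d + Φ.side (K.ccw d)) :=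
      eq_neg_of_add_eq_zero_right h
    rw [h1]
    simp only [Complex.det₂, Complex.neg_re, Complex.neg_im, Complex.add_re, Complex.add_im]
    ring
  have hccw : ∀ d, Complex.det₂ (Φ.side (K.ccw d)) (Φ.side (K.ccw (K.ccw d))) =
      Complex.det₂ (Φ.side d) (Φ.side (K.ccw d)) := fun d => by rw [ccw_ccw, hrot]
  have hp : ∀ p : K.Wide α, 0 < Complex.det₂ (Φ.side p) (Φ.side (K.ccw p)) := by
    intro p
    have h1 := Φ.len_pos p
    have h2 := Φ.sgn_mul_sgn p
    by_cases h : K.LeftVeering α p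
    · have h3 := Φ.side_pole_left h
      rw [pole_of_left h] at h3
      have h4 := hccw (K.ccw p)
      rw [ccw_ccw, Equiv.apply_symm_apply] at h4
      rw [← hrot p, ← h4, h3, side_wide]
      simp only [Complex.det₂, rise, rung]
      simp
      nlinarith
    · have h3 := Φ.side_pole_right h
      rw [pole_of_not_left h] at h3
      rw [h3, side_wide]
      simp only [Complex.det₂, rise, rung]
      simp
      nlinarith
  rcases hα.corner_cases d with h | h | h
  · rw [h]; exact hp _
  · rw [h, hccw]; exact hp _
  · rw [h, ← hccw, Equiv.apply_symm_apply]; exact hp _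

/-- The deviation of a side from the vertical or horizontal direction. -/
def tilt : K.Corner → ℝ :=
  hα.ofSides (fun p => Real.arctan (Φ.slope p)) (fun p => Real.arctan (Φ.slope (hα.up p))) 0

theorem tilt_cross (d : K.Corner) : Φ.tilt (K.cross d) = Φ.tilt d := by
  rcases hα.side_cases d with h | h | h
  · rw [h, hα.cross_wide, tilt, hα.ofSides_upper, hα.ofSides_wide, Equiv.apply_symm_apply]
  · rw [h, hα.cross_upper, tilt, hα.ofSides_upper, hα.ofSides_wide]
  · rw [h, hα.cross_pole_flip, tilt, hα.ofSides_pole, hα.ofSides_pole]; rfl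

/-- The rough angles of the corners: a right angle between a ladderpole segment and a rung, and zero
between two rungs. -/
def _root_.IdealTriangulation.IsVeering.roughAngle (hα : K.IsVeering α) : K.Corner → ℝ :=
  hα.ofSides (fun _ => Real.pi / 2) (fun _ => Real.pi / 2) 0

theorem exists_polar_rung (p : K.Wide α) : ∃ r : ℝ, 0 < r ∧
    Φ.rung p = Φ.sgn p * (r * Complex.exp (Real.arctan (Φ.slope p) * Complex.I)) := by
  obtain ⟨r, hr, h⟩ := exists_polar_one_add (Φ.slope p)
  exact ⟨r, hr, by rw [rung, h]⟩

theorem exp_pi_div_two_add (x : ℝ) : Complex.exp (((Real.pi / 2 + x : ℝ) : ℂ) * Complex.I) =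
    Complex.I * Complex.exp (x * Complex.I) := by
  push_cast
  rw [add_mul, Complex.exp_add, Complex.exp_pi_div_two_mul_I]

theorem exp_pi_add (x : ℝ) : Complex.exp (((Real.pi + x : ℝ) : ℂ) * Complex.I) =
    - Complex.exp (x * Complex.I) := by
  push_cast
  rw [add_mul, Complex.exp_add, Complex.exp_pi_mul_I]
  ring

/-- Up to the common sign `sgn`, rungs have direction `arctan` of their slope and ladderpole
segments have direction `π / 2`, modulo `π`. The multiples of `π` are chosen in each case so that
the difference lies in `(-π, π]`. Since `tilt` agrees on the two sides of an edge, its contribution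
will telescope along a curve and leave only `roughAngle`. -/
theorem arg_side_div (c : K.Corner) :
    (Φ.side (K.ccw c) / (- Φ.side (K.ccw.symm c))).arg =
      hα.roughAngle c + Φ.tilt (K.ccw c) - Φ.tilt (K.ccw.symm c) := by
  set p := hα.top c with hp
  obtain ⟨r, hr, hr'⟩ := Φ.exists_polar_rung p
  obtain ⟨s, hs, hs'⟩ := Φ.exists_polar_rung (hα.up p)
  rw [Φ.sgn_up] at hs'
  have ha := Φ.sgn_ne p
  have hl := Φ.len_pos p
  have a1 := Real.neg_pi_div_two_lt_arctan (Φ.slope p)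
  have a2 := Real.arctan_lt_pi_div_two (Φ.slope p)
  have b1 := Real.neg_pi_div_two_lt_arctan (Φ.slope (hα.up p))
  have b2 := Real.arctan_lt_pi_div_two (Φ.slope (hα.up p))
  have hpi := Real.pi_pos
  have e1 := Φ.side_wide p
  have e2 := Φ.side_upper p
  have t1 : Φ.tilt p = _ := hα.ofSides_wide _ _ _ p
  have t2 : Φ.tilt (K.upper α p) = _ := hα.ofSides_upper _ _ _ p
  have t3 : Φ.tilt (K.pole α p) = _ := hα.ofSides_pole _ _ _ p
  have r1 : hα.roughAngle p = _ := hα.ofSides_wide _ _ _ p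
  have r2 : hα.roughAngle (K.upper α p) = _ := hα.ofSides_upper _ _ _ p
  have r3 : hα.roughAngle (K.pole α p) = _ := hα.ofSides_pole _ _ _ p
  rw [hr'] at e1
  rw [hs'] at e2
  have hrise : ∀ x : ℝ, (Φ.sgn p : ℂ) * (Φ.len p * (Complex.I * Complex.exp ((0 : ℝ) * Complex.I)))
      = Φ.rise p := fun x => by rw [rise]; simp
  by_cases h : K.LeftVeering α p
  · have e3 := Φ.side_pole_left h
    rw [pole_of_left h] at e3 t3 r3
    rw [upper_of_left h] at e2 t2 r2
    rcases hα.corner_cases c with hc | hc | hc <;> rw [← hp] at hc <;> rw [hc]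
    · rw [e2, e3, r1, t2, t3, arg_div_of_polar (θ₁ := Real.pi / 2 + 0)
        (θ₂ := Real.pi + Real.arctan (Φ.slope (hα.up p))) ha hl hs]
      · simp; ring
      · constructor <;> linarith
      · rw [exp_pi_div_two_add, hrise 0, neg_neg]
      · rw [exp_pi_add]; ring
    · rw [ccw_ccw, Equiv.symm_apply_apply, e1, e3, r2, t1, t3,
        arg_div_of_polar (θ₁ := Real.pi + Real.arctan (Φ.slope p))
        (θ₂ := Real.pi + (Real.pi / 2 + 0)) ha hr hl]
      · simp
      · constructor <;> linarith
      · rw [exp_pi_add]; ring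
      · rw [exp_pi_add, exp_pi_div_two_add, ← hrise 0]; ring
    · rw [ccw_symm_symm, Equiv.apply_symm_apply, e1, e2, r3, t1, t2, neg_neg,
        arg_div_of_polar (θ₁ := Real.arctan (Φ.slope (hα.up p)))
        (θ₂ := Real.arctan (Φ.slope p)) ha hs hr]
      · simp
      · constructor <;> linarith
      · rfl
      · rfl
  · have e3 := Φ.side_pole_right h
    rw [pole_of_not_left h] at e3 t3 r3
    rw [upper_of_not_left h] at e2 t2 r2
    rcases hα.corner_cases c with hc | hc | hc <;> rw [← hp] at hc <;> rw [hc]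
    · rw [e2, e3, r1, t2, t3, neg_neg,
        arg_div_of_polar (θ₁ := Real.arctan (Φ.slope (hα.up p)))
        (θ₂ := Real.pi / 2 + 0) ha hs hl]
      · simp
      · constructor <;> linarith
      · rfl
      · rw [exp_pi_div_two_add, hrise 0]
    · rw [ccw_ccw, Equiv.symm_apply_apply, e1, e2, r3, t1, t2,
        arg_div_of_polar (θ₁ := Real.pi + Real.arctan (Φ.slope p))
        (θ₂ := Real.pi + Real.arctan (Φ.slope (hα.up p))) ha hr hs]
      · simp
      · constructor <;> linarith
      · rw [exp_pi_add]; ring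
      · rw [exp_pi_add]; ring
    · rw [ccw_symm_symm, Equiv.apply_symm_apply, e1, e3, r2, t1, t3,
        arg_div_of_polar (θ₁ := Real.pi + (Real.pi / 2 + 0))
        (θ₂ := Real.pi + (Real.pi + Real.arctan (Φ.slope p))) ha hl hr]
      · simp; ring
      · constructor <;> linarith
      · rw [exp_pi_add, exp_pi_div_two_add, ← hrise 0]; ring
      · rw [exp_pi_add, exp_pi_add]; ring

/-- The quotient is inverse to the one of `arg_side_div`. Its argument changes sign because the
positive area excludes the argument `π`. -/
theorem arg_side_div' (c : K.Corner) :
    (Φ.side (K.ccw.symm c) / (- Φ.side (K.ccw c))).arg =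
      - hα.roughAngle c + Φ.tilt (K.ccw.symm c) - Φ.tilt (K.ccw c) := by
  have h1 := Φ.arg_side_div c
  have h2 := Φ.det_side_pos (K.ccw c)
  rw [ccw_ccw] at h2
  have h3 : Φ.side (K.ccw.symm c) / (- Φ.side (K.ccw c)) =
      (Φ.side (K.ccw c) / (- Φ.side (K.ccw.symm c)))⁻¹ := by
    rw [inv_div, div_neg, neg_div]
  rw [h3, Complex.arg_inv, if_neg, h1]
  · ring
  · intro h
    rw [Complex.arg_eq_pi_iff, Complex.div_im] at h
    have h4 : 0 < Complex.normSq (- Φ.side (K.ccw.symm c)) := by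
      rw [Complex.normSq_pos]
      intro h0
      rw [neg_eq_zero] at h0
      rw [h0] at h2
      simp [Complex.det₂] at h2
    have h5 := h.2
    rw [div_sub_div_same, div_eq_zero_iff] at h5
    have h6 := h5.resolve_right h4.ne'
    simp only [Complex.neg_re, Complex.neg_im] at h6
    simp only [Complex.det₂] at h2
    linarith

end FlatStructure
end IdealTriangulation
end

noncomputable section
namespace IdealTriangulation
variable {ι : Type*} [Fintype ι] {K : IdealTriangulation ι} {α : ι → Fin 3 → ℝ}

namespace FlatStructure

variable {hα : K.IsVeering α} (Φ : FlatStructure hα)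

/-! ### Developing the boundary surface -/

/-- The vector from the centroid of a triangle to the midpoint of a side. -/
def toMid (d : K.Corner) : ℂ := (Φ.side (K.ccw.symm d) - Φ.side (K.ccw d)) / 6

/-- The vector from the centroid of a triangle to that of the triangle across a side. -/
def jump (d : K.Corner) : ℂ := Φ.toMid d - Φ.toMid (K.cross d)

theorem jump_cross (d : K.Corner) : Φ.jump (K.cross d) = - Φ.jump d := by
  rw [jump, jump, cross_cross]; ring

/-- The position of a vertex of a developed triangle with centroid `G`. -/
def pos (G : ℂ) (c : K.Corner) : ℂ := G + (Φ.side (K.ccw c) - Φ.side (K.ccw.symm c)) / 3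

theorem side_ccw_symm (d : K.Corner) : Φ.side (K.ccw.symm d) = - Φ.side d - Φ.side (K.ccw d) := by
  have := Φ.side_sum d
  linear_combination this

theorem pos_ccw_symm (G : ℂ) (d : K.Corner) :
    Φ.pos G (K.ccw.symm d) = Φ.pos G (K.ccw d) + Φ.side d := by
  simp only [pos, ccw_ccw, ccw_symm_symm, Equiv.apply_symm_apply, Equiv.symm_apply_apply]
  rw [side_ccw_symm]; ring

theorem pos_self (G : ℂ) (d : K.Corner) :
    Φ.pos G d = Φ.pos G (K.ccw.symm d) + Φ.side (K.ccw d) := by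
  have := Φ.pos_ccw_symm G (K.ccw d)
  rwa [Equiv.symm_apply_apply, ccw_ccw] at this

theorem pos_ccw (G : ℂ) (d : K.Corner) :
    Φ.pos G (K.ccw d) = Φ.pos G d + Φ.side (K.ccw.symm d) := by
  have := Φ.pos_ccw_symm G (K.ccw.symm d)
  rwa [ccw_symm_symm, Equiv.apply_symm_apply] at this

theorem pos_ccw_cross (G : ℂ) (d : K.Corner) :
    Φ.pos (G + Φ.jump d) (K.ccw (K.cross d)) = Φ.pos G (K.ccw.symm d) := by
  have h1 := Φ.side_sum d
  have h2 := Φ.side_sum (K.cross d)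
  rw [Φ.side_cross] at h2
  simp only [pos, jump, toMid, ccw_ccw, ccw_symm_symm, Equiv.apply_symm_apply,
    Equiv.symm_apply_apply, Φ.side_cross]
  linear_combination (1 / 6 : ℂ) * h1 + (1 / 6 : ℂ) * h2

theorem pos_ccw_symm_cross (G : ℂ) (d : K.Corner) :
    Φ.pos (G + Φ.jump d) (K.ccw.symm (K.cross d)) = Φ.pos G (K.ccw d) := by
  rw [pos_ccw_symm, pos_ccw_cross, Φ.side_cross, pos_ccw_symm]; ring

/-- A developed triangle: a triangle together with the position of its centroid. -/
abbrev Tile (_Φ : FlatStructure hα) : Type _ := K.Wide α × ℂ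

/-- The developed triangle across a side. -/
def crossTile (s : Φ.Tile) (d : K.Corner) : Φ.Tile := (hα.top (K.cross d), s.2 + Φ.jump d)

theorem crossTile_cross {s : Φ.Tile} {d : K.Corner} (h : hα.top d = s.1) :
    Φ.crossTile (Φ.crossTile s d) (K.cross d) = s := by
  refine Prod.ext ?_ ?_
  · change hα.top (K.cross (K.cross d)) = _
    rw [cross_cross, h]
  · change s.2 + Φ.jump d + Φ.jump (K.cross d) = s.2
    rw [jump_cross]; ring

/-- The developed triangle above a developed triangle. -/
def tileUp : Equiv.Perm Φ.Tile where
  toFun s := (hα.up s.1, s.2 + Φ.jump (K.upper α s.1))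
  invFun s := (hα.up.symm s.1, s.2 + Φ.jump s.1)
  left_inv s := by
    refine Prod.ext (by simp) ?_
    change s.2 + Φ.jump (K.upper α s.1) + Φ.jump (hα.up s.1) = s.2
    rw [← hα.cross_upper, jump_cross]; ring
  right_inv s := by
    refine Prod.ext (by simp) ?_
    change s.2 + Φ.jump s.1 + Φ.jump (K.upper α (hα.up.symm s.1)) = s.2
    rw [← hα.cross_wide, jump_cross]; ring

/-- The developed triangle across the ladderpole segment of a developed triangle. -/
def tileFlip (s : Φ.Tile) : Φ.Tile := (hα.flip s.1, s.2 + Φ.jump (K.pole α s.1))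

theorem tileUp_eq (s : Φ.Tile) : Φ.tileUp s = Φ.crossTile s (K.upper α s.1) :=
  Prod.ext (by rw [crossTile, hα.cross_upper, hα.top_of_wide]; rfl) rfl

theorem tileUp_symm_eq (s : Φ.Tile) : Φ.tileUp.symm s = Φ.crossTile s s.1 :=
  Prod.ext (by rw [crossTile, hα.cross_wide, hα.top_upper]; rfl) rfl

theorem tileFlip_eq (s : Φ.Tile) : Φ.tileFlip s = Φ.crossTile s (K.pole α s.1) :=
  Prod.ext (by rw [crossTile, hα.cross_pole_flip, hα.top_pole]; rfl) rfl

theorem tileFlip_tileFlip (s : Φ.Tile) : Φ.tileFlip (Φ.tileFlip s) = s := by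
  refine Prod.ext (hα.flip_flip _) ?_
  change s.2 + Φ.jump (K.pole α s.1) + Φ.jump (K.pole α (hα.flip s.1)) = s.2
  rw [← hα.cross_pole_flip, jump_cross]; ring

/-- The left end of the lower rung. -/
def leftEnd (s : Φ.Tile) : ℂ := Φ.pos s.2 (K.ccw s.1)

/-- The right end of the lower rung. -/
def rightEnd (s : Φ.Tile) : ℂ := Φ.pos s.2 (K.ccw.symm s.1)

/-- The vertex with the wide corner. -/
def apex (s : Φ.Tile) : ℂ := Φ.pos s.2 s.1

theorem rightEnd_eq (s : Φ.Tile) : Φ.rightEnd s = Φ.leftEnd s + Φ.rung s.1 := by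
  rw [rightEnd, pos_ccw_symm, side_wide]; rfl

theorem apex_left {s : Φ.Tile} (h : K.LeftVeering α s.1) :
    Φ.apex s = Φ.leftEnd s + Φ.rise s.1 := by
  have := Φ.side_pole_left h
  rw [pole_of_left h] at this
  rw [leftEnd, pos_ccw, this, apex]; ring

theorem apex_right {s : Φ.Tile} (h : ¬ K.LeftVeering α s.1) :
    Φ.apex s = Φ.rightEnd s + Φ.rise s.1 := by
  have := Φ.side_pole_right h
  rw [pole_of_not_left h] at this
  rw [apex, pos_self, this, rightEnd]

theorem leftEnd_up (s : Φ.Tile) :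
    Φ.leftEnd (Φ.tileUp s) = Φ.pos s.2 (K.ccw.symm (K.upper α s.1)) := by
  change Φ.pos (s.2 + Φ.jump (K.upper α s.1)) (K.ccw (hα.up s.1)) = _
  rw [← hα.cross_upper, pos_ccw_cross]

theorem rightEnd_up (s : Φ.Tile) :
    Φ.rightEnd (Φ.tileUp s) = Φ.pos s.2 (K.ccw (K.upper α s.1)) := by
  change Φ.pos (s.2 + Φ.jump (K.upper α s.1)) (K.ccw.symm (hα.up s.1)) = _
  rw [← hα.cross_upper, pos_ccw_symm_cross]

theorem leftEnd_up_left {s : Φ.Tile} (h : K.LeftVeering α s.1) :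
    Φ.leftEnd (Φ.tileUp s) = Φ.apex s := by
  rw [leftEnd_up, upper_of_left h, Equiv.symm_apply_apply]; rfl

theorem leftEnd_up_right {s : Φ.Tile} (h : ¬ K.LeftVeering α s.1) :
    Φ.leftEnd (Φ.tileUp s) = Φ.leftEnd s := by
  rw [leftEnd_up, upper_of_not_left h, ccw_symm_symm]; rfl

theorem rightEnd_up_left {s : Φ.Tile} (h : K.LeftVeering α s.1) :
    Φ.rightEnd (Φ.tileUp s) = Φ.rightEnd s := by
  rw [rightEnd_up, upper_of_left h, ccw_ccw]; rfl

theorem rightEnd_up_right {s : Φ.Tile} (h : ¬ K.LeftVeering α s.1) :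
    Φ.rightEnd (Φ.tileUp s) = Φ.apex s := by
  rw [rightEnd_up, upper_of_not_left h, Equiv.apply_symm_apply]; rfl

theorem coe_flip_of_left {p : K.Wide α} (h : K.LeftVeering α p) :
    (hα.flip p : K.Corner) = K.ccw (K.cross (K.pole α p)) := by
  rw [hα.coe_flip, acrossPole_of_left h, pole_of_left h]

theorem coe_flip_of_not_left {p : K.Wide α} (h : ¬ K.LeftVeering α p) :
    (hα.flip p : K.Corner) = K.ccw.symm (K.cross (K.pole α p)) := by
  rw [hα.coe_flip, acrossPole_of_not_left h, pole_of_not_left h]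

theorem leftEnd_flip {s : Φ.Tile} (h : K.LeftVeering α s.1) :
    Φ.leftEnd (Φ.tileFlip s) = Φ.apex s := by
  change Φ.pos (s.2 + Φ.jump (K.pole α s.1)) (K.ccw (hα.flip s.1)) = _
  rw [coe_flip_of_left h, ccw_ccw, pos_ccw_symm_cross, pole_of_left h, Equiv.apply_symm_apply]
  rfl

theorem apex_flip_left {s : Φ.Tile} (h : K.LeftVeering α s.1) :
    Φ.apex (Φ.tileFlip s) = Φ.leftEnd s := by
  change Φ.pos (s.2 + Φ.jump (K.pole α s.1)) (hα.flip s.1) = _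
  rw [coe_flip_of_left h, pos_ccw_cross, pole_of_left h, ccw_symm_symm]
  rfl

theorem rightEnd_flip {s : Φ.Tile} (h : ¬ K.LeftVeering α s.1) :
    Φ.rightEnd (Φ.tileFlip s) = Φ.apex s := by
  change Φ.pos (s.2 + Φ.jump (K.pole α s.1)) (K.ccw.symm (hα.flip s.1)) = _
  rw [coe_flip_of_not_left h, ccw_symm_symm, pos_ccw_cross, pole_of_not_left h,
    Equiv.symm_apply_apply]
  rfl

theorem apex_flip_right {s : Φ.Tile} (h : ¬ K.LeftVeering α s.1) :
    Φ.apex (Φ.tileFlip s) = Φ.rightEnd s := by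
  change Φ.pos (s.2 + Φ.jump (K.pole α s.1)) (hα.flip s.1) = _
  rw [coe_flip_of_not_left h, pos_ccw_symm_cross, pole_of_not_left h, ccw_ccw]
  rfl

theorem tile_ext_left {s t : Φ.Tile} (h1 : s.1 = t.1) (h2 : Φ.leftEnd s = Φ.leftEnd t) :
    s = t := by
  refine Prod.ext h1 ?_
  rw [leftEnd, leftEnd, h1, pos, pos] at h2
  exact add_right_cancel h2

theorem tile_ext_right {s t : Φ.Tile} (h1 : s.1 = t.1) (h2 : Φ.rightEnd s = Φ.rightEnd t) :
    s = t := by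
  refine Prod.ext h1 ?_
  rw [rightEnd, rightEnd, h1, pos, pos] at h2
  exact add_right_cancel h2

theorem tileUp_pow_fst (m : ℕ) (s : Φ.Tile) : ((Φ.tileUp ^ m) s).1 = (hα.up ^ m) s.1 := by
  induction m with
  | zero => rfl
  | succ m ih => rw [pow_succ', pow_succ', Equiv.Perm.mul_apply, Equiv.Perm.mul_apply, ← ih]; rfl

/-- A left-based triangle moves the left end of the rung to its apex, and the right-based ones above
it leave this end where it is. -/
theorem leftEnd_return {s : Φ.Tile} (hs : K.LeftVeering α s.1) {m : ℕ} (hm : 1 ≤ m)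
    (h : ∀ r, 1 ≤ r → r < m → ¬ K.LeftVeering α ((hα.up ^ r) s.1)) :
    Φ.leftEnd ((Φ.tileUp ^ m) s) = Φ.apex s := by
  induction m, hm using Nat.le_induction with
  | base => rw [pow_one, leftEnd_up_left _ hs]
  | succ m hm ih =>
    rw [pow_succ', Equiv.Perm.mul_apply, leftEnd_up_right, ih fun r h1 h2 => h r h1 (by omega)]
    rw [tileUp_pow_fst]
    exact h m hm (by omega)

theorem rightEnd_return {s : Φ.Tile} (hs : ¬ K.LeftVeering α s.1) {m : ℕ} (hm : 1 ≤ m)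
    (h : ∀ r, 1 ≤ r → r < m → K.LeftVeering α ((hα.up ^ r) s.1)) :
    Φ.rightEnd ((Φ.tileUp ^ m) s) = Φ.apex s := by
  induction m, hm using Nat.le_induction with
  | base => rw [pow_one, rightEnd_up_right _ hs]
  | succ m hm ih =>
    rw [pow_succ', Equiv.Perm.mul_apply, rightEnd_up_left, ih fun r h1 h2 => h r h1 (by omega)]
    rw [tileUp_pow_fst]
    exact h m hm (by omega)

/-- The ladder system formed by the developed triangles. -/
def tiles : LadderSystem Φ.Tile where
  up := Φ.tileUp
  flip := Φ.tileFlip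
  left s := K.LeftVeering α s.1
  flip_flip := Φ.tileFlip_tileFlip
  left_flip s := hα.left_flip s.1
  exists_same s := by
    obtain ⟨m, hm, h⟩ := hα.ladders.exists_same s.1
    exact ⟨m, hm, by rw [tileUp_pow_fst]; exact h⟩
  exists_other s := by
    obtain ⟨m, h⟩ := hα.ladders.exists_other s.1
    exact ⟨m, by rw [tileUp_pow_fst]; exact h⟩
  return_flip s m hm hs h := by
    simp only [tileUp_pow_fst] at hs h
    obtain ⟨n, hn, hn1, hn2⟩ := hα.return_flip s.1 m hm hs h
    refine ⟨n, ?_⟩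
    rw [zpow_natCast]
    set t := (Φ.tileUp ^ m) s with ht
    have ht1 : t.1 = (hα.up ^ m) s.1 := Φ.tileUp_pow_fst m s
    have hft : (Φ.tileFlip t).1 = hα.flip ((hα.up ^ m) s.1) := by rw [← ht1]; rfl
    have hfst : ((Φ.tileUp ^ n) (Φ.tileFlip t)).1 = (Φ.tileFlip s).1 := by
      rw [tileUp_pow_fst, hft, hn1]; rfl
    have hlt : K.LeftVeering α t.1 ↔ K.LeftVeering α s.1 := by rw [ht1]; exact hs
    have hlft : K.LeftVeering α (Φ.tileFlip t).1 ↔ K.LeftVeering α s.1 :=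
      (hα.left_flip t.1).trans hlt
    by_cases hl : K.LeftVeering α s.1
    -- A developed triangle is determined by its triangle and the position of one vertex. Here the
    -- vertices to compare are ends of the two ladderpole segments.
    · refine Φ.tile_ext_left hfst ?_
      rw [leftEnd_return _ (hlft.2 hl) hn, apex_flip_left _ (hlt.2 hl), leftEnd_flip _ hl, ht,
        leftEnd_return _ hl hm]
      · intro r h1 h2; have := h r h1 h2; tauto
      · intro r h1 h2; rw [hft]; have := hn2 r h1 h2; tauto
    · refine Φ.tile_ext_right hfst ?_
      rw [rightEnd_return _ (mt hlft.1 hl) hn, apex_flip_right _ (mt hlt.1 hl), rightEnd_flip _ hl,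
        ht, rightEnd_return _ hl hm]
      · intro r h1 h2; have := h r h1 h2; tauto
      · intro r h1 h2; rw [hft]; have := hn2 r h1 h2; tauto

/-! ### Strips -/

theorem rung_re (p : K.Wide α) : (Φ.rung p).re = Φ.sgn p := by simp [rung]

theorem rise_re (p : K.Wide α) : (Φ.rise p).re = 0 := by simp [rise]

/-- The horizontal coordinate of the strip of a developed triangle. -/
def strip (s : Φ.Tile) : ℝ := (Φ.leftEnd s).re + (Φ.sgn s.1 - 1) / 2

theorem rightEnd_re (s : Φ.Tile) : (Φ.rightEnd s).re = (Φ.leftEnd s).re + Φ.sgn s.1 := by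
  rw [rightEnd_eq, Complex.add_re, rung_re]

theorem leftEnd_up_re (s : Φ.Tile) : (Φ.leftEnd (Φ.tileUp s)).re = (Φ.leftEnd s).re := by
  by_cases h : K.LeftVeering α s.1
  · rw [leftEnd_up_left _ h, apex_left _ h, Complex.add_re, rise_re, add_zero]
  · rw [leftEnd_up_right _ h]

theorem strip_up (s : Φ.Tile) : Φ.strip (Φ.tileUp s) = Φ.strip s := by
  rw [strip, strip, leftEnd_up_re]
  change _ + (Φ.sgn (hα.up s.1) - 1) / 2 = _
  rw [Φ.sgn_up]

theorem strip_flip_left {s : Φ.Tile} (h : K.LeftVeering α s.1) :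
    Φ.strip (Φ.tileFlip s) = Φ.strip s - Φ.sgn s.1 := by
  rw [strip, strip, leftEnd_flip _ h, apex_left _ h, Complex.add_re, rise_re]
  change _ + (Φ.sgn (hα.flip s.1) - 1) / 2 = _
  rw [Φ.sgn_flip]; ring

theorem strip_flip_right {s : Φ.Tile} (h : ¬ K.LeftVeering α s.1) :
    Φ.strip (Φ.tileFlip s) = Φ.strip s + Φ.sgn s.1 := by
  have h1 := Φ.rightEnd_re (Φ.tileFlip s)
  rw [rightEnd_flip _ h, apex_right _ h, Complex.add_re, rise_re, rightEnd_re] at h1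
  change _ = _ + Φ.sgn (hα.flip s.1) at h1
  rw [strip, strip]
  change _ + (Φ.sgn (hα.flip s.1) - 1) / 2 = _
  rw [Φ.sgn_flip] at h1 ⊢
  linarith

theorem sgn_eq_of_sameCycle {s t : Φ.Tile} (h : Φ.tiles.up.SameCycle s t) :
    Φ.sgn s.1 = Φ.sgn t.1 := by
  have hn : ∀ (m : ℕ) (s : Φ.Tile), Φ.sgn ((Φ.tileUp ^ m) s).1 = Φ.sgn s.1 := by
    intro m s
    induction m with
    | zero => rfl
    | succ m ih => rw [pow_succ', Equiv.Perm.mul_apply, ← ih]; exact Φ.sgn_up _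
  obtain ⟨n, rfl⟩ := h
  obtain ⟨m, rfl | rfl⟩ := n.eq_nat_or_neg
  · rw [zpow_natCast]; exact (hn m s).symm
  · have := hn m ((Φ.tileUp ^ (-(m : ℤ))) s)
    change _ = Φ.sgn ((Φ.tileUp ^ (-(m : ℤ))) s).1
    rw [← this]
    congr 2
    rw [← zpow_natCast, ← Equiv.Perm.mul_apply, ← zpow_add]; simp

/-- The direction of the strip of a developed triangle. -/
def lineSgn : Φ.tiles.Line → ℝ :=
  Quotient.lift (fun s : Φ.Tile => Φ.sgn s.1) fun _ _ h => Φ.sgn_eq_of_sameCycle h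

theorem lineSgn_line (s : Φ.Tile) : Φ.lineSgn (Φ.tiles.line s) = Φ.sgn s.1 := rfl

theorem lineSgn_flipLine (b : Bool) (A : Φ.tiles.Line) :
    Φ.lineSgn (Φ.tiles.flipLine b A) = - Φ.lineSgn A := by
  obtain ⟨s, rfl, hs⟩ := Φ.tiles.exists_line_left A b
  rw [LadderSystem.flipLine_line _ hs, lineSgn_line, lineSgn_line]
  exact Φ.sgn_flip s.1

open Classical in
/-- The strip to the right of a strip. -/
def rightLine : Equiv.Perm Φ.tiles.Line where
  -- A strip of sign `-1` is developed upside down, so its own left side is on the right in the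
  -- plane.
  toFun A := Φ.tiles.flipLine (decide (Φ.lineSgn A = -1)) A
  invFun A := Φ.tiles.flipLine (decide (Φ.lineSgn A = 1)) A
  left_inv A := by
    simp only [lineSgn_flipLine]
    have : (- Φ.lineSgn A = 1) ↔ Φ.lineSgn A = -1 := by
      constructor <;> intro h <;> linarith
    simp only [this, LadderSystem.flipLine_flipLine]
  right_inv A := by
    simp only [lineSgn_flipLine]
    have : (- Φ.lineSgn A = -1) ↔ Φ.lineSgn A = 1 := by
      constructor <;> intro h <;> linarith
    simp only [this, LadderSystem.flipLine_flipLine]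

/-- Two developed triangles in compatible positions of one development. -/
def Linked (s t : Φ.Tile) : Prop :=
  ∃ k : ℤ, Φ.tiles.line t = (Φ.rightLine ^ k) (Φ.tiles.line s) ∧ Φ.strip t = Φ.strip s + k

variable {Φ} in
theorem Linked.symm {s t : Φ.Tile} (h : Φ.Linked s t) : Φ.Linked t s := by
  obtain ⟨k, h1, h2⟩ := h
  refine ⟨-k, ?_, by rw [h2]; push_cast; ring⟩
  rw [h1, ← Equiv.Perm.mul_apply, ← zpow_add]; simp

variable {Φ} in
theorem Linked.trans {s t u : Φ.Tile} (h : Φ.Linked s t) (h' : Φ.Linked t u) : Φ.Linked s u := by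
  obtain ⟨k, h1, h2⟩ := h
  obtain ⟨l, h3, h4⟩ := h'
  refine ⟨l + k, ?_, by rw [h4, h2]; push_cast; ring⟩
  rw [h3, h1, ← Equiv.Perm.mul_apply, ← zpow_add]

theorem linked_refl (s : Φ.Tile) : Φ.Linked s s := ⟨0, by simp, by simp⟩

theorem linked_up (s : Φ.Tile) : Φ.Linked s (Φ.tileUp s) :=
  ⟨0, by rw [zpow_zero]; exact Φ.tiles.line_up s, by rw [strip_up]; simp⟩

theorem linked_flip (s : Φ.Tile) : Φ.Linked s (Φ.tileFlip s) := by
  have hR : ∀ b : Bool, (K.LeftVeering α s.1 ↔ b = true) →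
      Φ.tiles.flipLine b (Φ.tiles.line s) = Φ.tiles.line (Φ.tileFlip s) := fun b hb =>
    Φ.tiles.flipLine_line hb
  have h1 := Φ.lineSgn_line s
  by_cases h : K.LeftVeering α s.1
  · have h2 := hR true (iff_of_true h rfl)
    rcases Φ.sgn_eq s.1 with hs | hs
    · refine ⟨-1, ?_, by rw [strip_flip_left _ h, hs]; push_cast; ring⟩
      rw [zpow_neg_one, ← h2]
      change _ = Φ.tiles.flipLine (decide (Φ.lineSgn _ = 1)) _
      rw [h1, hs]; simp
    · refine ⟨1, ?_, by rw [strip_flip_left _ h, hs]; push_cast; ring⟩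
      rw [zpow_one, ← h2]
      change _ = Φ.tiles.flipLine (decide (Φ.lineSgn _ = -1)) _
      rw [h1, hs]; simp
  · have h2 := hR false (iff_of_false h Bool.false_ne_true)
    rcases Φ.sgn_eq s.1 with hs | hs
    · refine ⟨1, ?_, by rw [strip_flip_right _ h, hs]; push_cast; ring⟩
      rw [zpow_one, ← h2]
      change _ = Φ.tiles.flipLine (decide (Φ.lineSgn _ = -1)) _
      rw [h1, hs, decide_eq_false (by norm_num)]
    · refine ⟨-1, ?_, by rw [strip_flip_right _ h, hs]; push_cast; ring⟩
      rw [zpow_neg_one, ← h2]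
      change _ = Φ.tiles.flipLine (decide (Φ.lineSgn _ = 1)) _
      rw [h1, hs, decide_eq_false (by norm_num)]

/-- All triangles met while developing a curve are linked. This relation takes the place of a
universal cover: it records only how many strips one has moved to the right. -/
theorem linked_crossTile {s : Φ.Tile} {d : K.Corner} (h : hα.top d = s.1) :
    Φ.Linked s (Φ.crossTile s d) := by
  have h' := hα.side_cases d
  rw [h] at h'
  rcases h' with h' | h' | h' <;> rw [h']
  · rw [← tileUp_symm_eq]
    have := Φ.linked_up (Φ.tileUp.symm s)
    rw [Equiv.apply_symm_apply] at this
    exact this.symm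
  · rw [← tileUp_eq]; exact Φ.linked_up s
  · rw [← tileFlip_eq]; exact Φ.linked_flip s

end FlatStructure
end IdealTriangulation
end

noncomputable section
namespace IdealTriangulation
variable {ι : Type*} [Fintype ι] {K : IdealTriangulation ι} {α : ι → Fin 3 → ℝ}

theorem IsVeering.eq_or_of_top_eq (hα : K.IsVeering α) {c d : K.Corner} (h : hα.top c = hα.top d) :
    c = d ∨ c = K.ccw d ∨ c = K.ccw.symm d := by
  rcases hα.corner_cases c with hc | hc | hc <;> rcases hα.corner_cases d with hd | hd | hd <;>
    rw [hc, hd, h] <;> simp [ccw_ccw, ccw_symm_symm]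

namespace FlatStructure

variable {hα : K.IsVeering α} (Φ : FlatStructure hα)

/-! ### Points of developed triangles -/

/-- A barycentric coordinate of a point with respect to a developed triangle, multiplied by twice
the area of this triangle. -/
def sideDist (s : Φ.Tile) (d : K.Corner) (z : ℂ) : ℝ :=
  Complex.det₂ (Φ.side d) (z - Φ.pos s.2 (K.ccw d))

theorem sideDist_ccw (s : Φ.Tile) (d : K.Corner) (z : ℂ) :
    Φ.sideDist s (K.ccw d) z = Complex.det₂ (Φ.side (K.ccw d)) (z - Φ.pos s.2 (K.ccw d)) +
      Complex.det₂ (Φ.side d) (Φ.side (K.ccw d)) := by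
  rw [sideDist, ccw_ccw, pos_ccw_symm]
  simp only [Complex.det₂, Complex.sub_re, Complex.sub_im, Complex.add_re, Complex.add_im]
  ring

theorem sideDist_ccw_symm (s : Φ.Tile) (d : K.Corner) (z : ℂ) :
    Φ.sideDist s (K.ccw.symm d) z =
      Complex.det₂ (Φ.side (K.ccw.symm d)) (z - Φ.pos s.2 (K.ccw d)) := by
  rw [sideDist, Equiv.apply_symm_apply, pos_ccw Φ s.2 d]
  simp only [Complex.det₂, Complex.sub_re, Complex.sub_im, Complex.add_re, Complex.add_im]
  ring

theorem sideDist_sum (s : Φ.Tile) (d : K.Corner) (z : ℂ) :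
    Φ.sideDist s d z + Φ.sideDist s (K.ccw d) z + Φ.sideDist s (K.ccw.symm d) z =
      Complex.det₂ (Φ.side d) (Φ.side (K.ccw d)) := by
  rw [sideDist_ccw, sideDist_ccw_symm, sideDist, side_ccw_symm]
  simp only [Complex.det₂, Complex.sub_re, Complex.sub_im, Complex.neg_re, Complex.neg_im]
  ring

theorem sideDist_crossTile (s : Φ.Tile) (d : K.Corner) (z : ℂ) :
    Φ.sideDist (Φ.crossTile s d) (K.cross d) z = - Φ.sideDist s d z := by
  rw [sideDist, sideDist, crossTile, pos_ccw_cross, Φ.side_cross, pos_ccw_symm]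
  simp only [Complex.det₂, Complex.sub_re, Complex.sub_im, Complex.neg_re, Complex.neg_im,
    Complex.add_re, Complex.add_im]
  ring

/-- The point of a side of a developed triangle with a given affine coordinate. -/
def onSide (s : Φ.Tile) (d : K.Corner) (τ : ℝ) : ℂ := Φ.pos s.2 (K.ccw d) + τ * Φ.side d

theorem onSide_crossTile (s : Φ.Tile) (d : K.Corner) (τ : ℝ) :
    Φ.onSide (Φ.crossTile s d) (K.cross d) (1 - τ) = Φ.onSide s d τ := by
  rw [onSide, onSide, crossTile, pos_ccw_cross, Φ.side_cross, pos_ccw_symm]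
  push_cast; ring

theorem sideDist_onSide (s : Φ.Tile) (d : K.Corner) (τ : ℝ) :
    Φ.sideDist s d (Φ.onSide s d τ) = 0 := by
  rw [sideDist, onSide, add_sub_cancel_left]
  simp only [Complex.det₂, Complex.re_ofReal_mul, Complex.im_ofReal_mul]
  ring

theorem sideDist_ccw_onSide (s : Φ.Tile) (d : K.Corner) (τ : ℝ) :
    Φ.sideDist s (K.ccw d) (Φ.onSide s d τ) =
      (1 - τ) * Complex.det₂ (Φ.side d) (Φ.side (K.ccw d)) := by
  rw [sideDist_ccw, onSide, add_sub_cancel_left]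
  simp only [Complex.det₂, Complex.re_ofReal_mul, Complex.im_ofReal_mul]
  ring

theorem sideDist_ccw_symm_onSide (s : Φ.Tile) (d : K.Corner) (τ : ℝ) :
    Φ.sideDist s (K.ccw.symm d) (Φ.onSide s d τ) =
      τ * Complex.det₂ (Φ.side d) (Φ.side (K.ccw d)) := by
  rw [sideDist_ccw_symm, onSide, add_sub_cancel_left, side_ccw_symm]
  simp only [Complex.det₂, Complex.re_ofReal_mul, Complex.im_ofReal_mul, Complex.sub_re,
    Complex.sub_im, Complex.neg_re, Complex.neg_im]
  ring

theorem exists_onSide {s : Φ.Tile} {d : K.Corner} {z : ℂ} (h : Φ.sideDist s d z = 0) :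
    ∃ τ, z = Φ.onSide s d τ := by
  have hd := Φ.det_side_pos d
  rw [sideDist] at h
  set w := z - Φ.pos s.2 (K.ccw d) with hw
  set e := Φ.side d
  have hn : 0 < e.re ^ 2 + e.im ^ 2 := by
    by_contra h0
    have h1 : e.re = 0 := by nlinarith [sq_nonneg e.re, sq_nonneg e.im]
    have h2 : e.im = 0 := by nlinarith [sq_nonneg e.re, sq_nonneg e.im]
    simp [Complex.det₂, h1, h2] at hd
  refine ⟨(e.re * w.re + e.im * w.im) / (e.re ^ 2 + e.im ^ 2), ?_⟩
  rw [onSide, ← sub_eq_iff_eq_add', ← hw]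
  simp only [Complex.det₂] at h
  apply Complex.ext
  · rw [Complex.re_ofReal_mul]
    field_simp
    linear_combination (- e.im) * h
  · rw [Complex.im_ofReal_mul]
    field_simp
    linear_combination e.re * h

/-- The point is in the developed triangle, and is not one of its vertices. -/
structure Inside (s : Φ.Tile) (z : ℂ) : Prop where
  nonneg : ∀ d, hα.top d = s.1 → 0 ≤ Φ.sideDist s d z
  pos : ∀ d, hα.top d = s.1 → 0 < Φ.sideDist s d z ∨ 0 < Φ.sideDist s (K.ccw d) z

variable {Φ} in
theorem Inside.of_three {s : Φ.Tile} {z : ℂ} {d : K.Corner} (hd : hα.top d = s.1)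
    (h : 0 ≤ Φ.sideDist s d z) (h1 : 0 < Φ.sideDist s (K.ccw d) z)
    (h2 : 0 < Φ.sideDist s (K.ccw.symm d) z) : Φ.Inside s z := by
  constructor
  · intro e he
    rcases hα.eq_or_of_top_eq (he.trans hd.symm) with rfl | rfl | rfl
    · exact h
    · exact h1.le
    · exact h2.le
  · intro e he
    rcases hα.eq_or_of_top_eq (he.trans hd.symm) with rfl | rfl | rfl
    · exact Or.inr h1
    · exact Or.inl h1
    · exact Or.inl h2

variable {Φ} in
theorem Inside.pos_of_eq_zero {s : Φ.Tile} {z : ℂ} {d : K.Corner} (hi : Φ.Inside s z)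
    (hd : hα.top d = s.1) (h : Φ.sideDist s d z = 0) :
    0 < Φ.sideDist s (K.ccw d) z ∧ 0 < Φ.sideDist s (K.ccw.symm d) z := by
  refine ⟨(hi.pos d hd).resolve_left h.le.not_gt, ?_⟩
  have := hi.pos (K.ccw.symm d) (by rw [hα.top_ccw_symm, hd])
  rw [Equiv.apply_symm_apply] at this
  exact this.resolve_right h.le.not_gt

theorem inside_onSide {s : Φ.Tile} {d : K.Corner} (hd : hα.top d = s.1) {τ : ℝ} (h0 : 0 < τ)
    (h1 : τ < 1) : Φ.Inside s (Φ.onSide s d τ) := by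
  have ha := Φ.det_side_pos d
  refine Inside.of_three hd (Φ.sideDist_onSide s d τ).ge ?_ ?_
  · rw [sideDist_ccw_onSide]; exact mul_pos (by linarith) ha
  · rw [sideDist_ccw_symm_onSide]; exact mul_pos h0 ha

variable {Φ} in
theorem Inside.crossTile {s : Φ.Tile} {z : ℂ} {d : K.Corner} (hi : Φ.Inside s z)
    (hd : hα.top d = s.1) (h : Φ.sideDist s d z = 0) : Φ.Inside (Φ.crossTile s d) z := by
  have ha := Φ.det_side_pos d
  obtain ⟨h1, h2⟩ := hi.pos_of_eq_zero hd h
  obtain ⟨τ, rfl⟩ := Φ.exists_onSide h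
  rw [sideDist_ccw_onSide] at h1
  rw [sideDist_ccw_symm_onSide] at h2
  have h3 : 0 < τ := pos_of_mul_pos_left h2 ha.le
  have h4 : 0 < 1 - τ := pos_of_mul_pos_left h1 ha.le
  rw [← onSide_crossTile]
  exact Φ.inside_onSide rfl h4 (by linarith)

/-! ### Two developed triangles that share a point -/

theorem sideDist_upper (s : Φ.Tile) (z : ℂ) :
    Φ.sideDist s (K.upper α s.1) z = - Φ.sideDist (Φ.tileUp s) (hα.up s.1) z := by
  rw [tileUp_eq, ← hα.cross_upper, sideDist_crossTile, neg_neg]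

theorem sideDist_pole_left {s : Φ.Tile} (h : K.LeftVeering α s.1) (z : ℂ) :
    Φ.sideDist s (K.pole α s.1) z = Φ.len s.1 * (Φ.sgn s.1 * (z.re - (Φ.leftEnd s).re)) := by
  have h1 := Φ.apex_left h
  have h2 : Φ.pos s.2 (K.ccw (K.pole α s.1)) = Φ.apex s := by
    rw [pole_of_left h, Equiv.apply_symm_apply]; rfl
  rw [sideDist, h2, h1, Φ.side_pole_left h, Complex.det₂]
  simp [rise]
  ring

theorem sideDist_pole_right {s : Φ.Tile} (h : ¬ K.LeftVeering α s.1) (z : ℂ) :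
    Φ.sideDist s (K.pole α s.1) z =
      Φ.len s.1 * (1 - Φ.sgn s.1 * (z.re - (Φ.leftEnd s).re)) := by
  have h1 := Φ.rightEnd_re s
  have h2 : Φ.pos s.2 (K.ccw (K.pole α s.1)) = Φ.rightEnd s := by
    rw [pole_of_not_left h, ccw_ccw]; rfl
  have h3 := Φ.sgn_mul_sgn s.1
  rw [sideDist, h2, Φ.side_pole_right h, Complex.det₂]
  simp [rise, h1]
  linear_combination (Φ.len s.1) * h3

theorem det_side_wide (p : K.Wide α) : Complex.det₂ (Φ.side p) (Φ.side (K.ccw p)) = Φ.len p := by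
  have hs := Φ.sgn_mul_sgn p
  by_cases h : K.LeftVeering α p
  · have h1 := Φ.side_pole_left h
    have h2 := Φ.side_sum p
    rw [pole_of_left h] at h1
    rw [h1, side_wide] at h2
    have h3 : Φ.side (K.ccw p) = Φ.rise p - Φ.rung p := by linear_combination h2
    rw [h3, side_wide]
    simp [Complex.det₂, rise, rung]
    linear_combination (Φ.len p) * hs
  · have h1 := Φ.side_pole_right h
    rw [pole_of_not_left h] at h1
    rw [h1, side_wide]
    simp [Complex.det₂, rise, rung]
    linear_combination (Φ.len p) * hs

theorem sideDist_sum' (s : Φ.Tile) (z : ℂ) : Φ.sideDist s s.1 z +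
    Φ.sideDist s (K.upper α s.1) z + Φ.sideDist s (K.pole α s.1) z = Φ.len s.1 := by
  rw [← det_side_wide, ← Φ.sideDist_sum s s.1 z]
  by_cases h : K.LeftVeering α s.1
  · rw [upper_of_left h, pole_of_left h]
  · rw [upper_of_not_left h, pole_of_not_left h]; ring

/-- The horizontal coordinate of a point in the strip of a developed triangle. -/
def across (s : Φ.Tile) (z : ℂ) : ℝ := Φ.sgn s.1 * (z.re - (Φ.leftEnd s).re)

theorem across_up (s : Φ.Tile) (z : ℂ) : Φ.across (Φ.tileUp s) z = Φ.across s z := by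
  rw [across, leftEnd_up_re]
  change Φ.sgn (hα.up s.1) * _ = _
  rw [Φ.sgn_up]; rfl

theorem across_up_pow (s : Φ.Tile) (z : ℂ) (r : ℕ) :
    Φ.across ((Φ.tileUp ^ r) s) z = Φ.across s z := by
  induction r with
  | zero => rfl
  | succ r ih => rw [pow_succ', Equiv.Perm.mul_apply, across_up, ih]

/-- Climbing the strip, the distance of a point of the strip above the lower rung decreases by an
amount that depends only on the segment length and the horizontal position. -/
theorem sideDist_sub_up (s : Φ.Tile) (z : ℂ) :
    Φ.sideDist s s.1 z - Φ.sideDist (Φ.tileUp s) (Φ.tileUp s).1 z =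
      Φ.len s.1 - Φ.sideDist s (K.pole α s.1) z := by
  have h1 := Φ.sideDist_sum' s z
  rw [sideDist_upper] at h1
  change _ - Φ.sideDist (Φ.tileUp s) (hα.up s.1) z = _
  linear_combination h1

variable {Φ} in
theorem Inside.across_mem {s : Φ.Tile} {z : ℂ} (hi : Φ.Inside s z) :
    0 ≤ Φ.across s z ∧ Φ.across s z ≤ 1 := by
  have hl := Φ.len_pos s.1
  have h0 := Φ.sideDist_sum' s z
  have h1 := hi.nonneg _ (hα.top_of_wide s.1)
  have h2 := hi.nonneg _ (hα.top_upper s.1)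
  have h3 := hi.nonneg _ (hα.top_pole s.1)
  rw [across]
  by_cases h : K.LeftVeering α s.1
  · rw [Φ.sideDist_pole_left h] at h0 h3
    constructor <;> nlinarith
  · rw [Φ.sideDist_pole_right h] at h0 h3
    constructor <;> nlinarith

variable {Φ} in
theorem Inside.pos_of_ne {s : Φ.Tile} {z : ℂ} (hi : Φ.Inside s z) {d e : K.Corner}
    (hd : hα.top d = s.1) (he : hα.top e = s.1) (hde : e ≠ d) (h : Φ.sideDist s d z = 0) :
    0 < Φ.sideDist s e z := by
  obtain ⟨h1, h2⟩ := hi.pos_of_eq_zero hd h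
  rcases hα.eq_or_of_top_eq (he.trans hd.symm) with rfl | rfl | rfl
  · exact absurd rfl hde
  · exact h1
  · exact h2

variable {Φ} in
theorem Inside.across_lt {s : Φ.Tile} {z : ℂ} (hi : Φ.Inside s z)
    (hu : Φ.sideDist s (K.upper α s.1) z = 0) : 0 < Φ.across s z ∧ Φ.across s z < 1 := by
  have hl := Φ.len_pos s.1
  have h0 := Φ.sideDist_sum' s z
  obtain ⟨n1, n2, n3⟩ := upper_ne (α := α) s.1
  have h1 := hi.pos_of_ne (hα.top_upper s.1) (hα.top_of_wide s.1) n1.symm hu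
  have h3 := hi.pos_of_ne (hα.top_upper s.1) (hα.top_pole s.1) n3 hu
  rw [across]
  by_cases h : K.LeftVeering α s.1
  · rw [Φ.sideDist_pole_left h] at h0 h3
    constructor <;> nlinarith
  · rw [Φ.sideDist_pole_right h] at h0 h3
    constructor <;> nlinarith

-- The scaled heights `l r` of `z` above the successive lower rungs decrease. Lying in both
-- triangles forces `l 1 = 0`, so `z` is inside the first upper rung. Away from the ladderpoles the
-- decrease is strict, which excludes `m ≥ 2`.
variable {Φ} in
theorem Inside.eq_up_of_pow {s : Φ.Tile} {z : ℂ} {m : ℕ} (hm : 1 ≤ m) (hi : Φ.Inside s z)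
    (hi' : Φ.Inside ((Φ.tileUp ^ m) s) z) :
    (Φ.tileUp ^ m) s = Φ.tileUp s ∧ Φ.sideDist s (K.upper α s.1) z = 0 := by
  classical
  obtain ⟨hx0, hx1⟩ := hi.across_mem
  set l : ℕ → ℝ := fun r => Φ.sideDist ((Φ.tileUp ^ r) s) ((Φ.tileUp ^ r) s).1 z with hl
  have hstep : ∀ r, l r - l (r + 1) =
      Φ.len ((Φ.tileUp ^ r) s).1 * (if K.LeftVeering α ((Φ.tileUp ^ r) s).1 then
        1 - Φ.across s z else Φ.across s z) := by
    intro r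
    have h1 := Φ.sideDist_sub_up ((Φ.tileUp ^ r) s) z
    rw [← Equiv.Perm.mul_apply, ← pow_succ'] at h1
    have h2 := Φ.across_up_pow s z r
    rw [across] at h2
    change _ - _ = _ at h1
    simp only [hl]
    rw [h1]
    split_ifs with h
    · rw [Φ.sideDist_pole_left h, h2]; ring
    · rw [Φ.sideDist_pole_right h, h2]; ring
  have hanti : Antitone l := antitone_nat_of_succ_le fun r => by
    have h1 := hstep r
    have h2 := Φ.len_pos ((Φ.tileUp ^ r) s).1
    have h3 : 0 ≤ (if K.LeftVeering α ((Φ.tileUp ^ r) s).1 then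
        1 - Φ.across s z else Φ.across s z) := by split_ifs <;> linarith
    nlinarith
  have hu := Φ.sideDist_upper s z
  have hl1 : Φ.sideDist s (K.upper α s.1) z = - l 1 := hu
  have hu0 := hi.nonneg _ (hα.top_upper s.1)
  have hm0 : 0 ≤ l m := hi'.nonneg _ (hα.top_of_wide _)
  have h1m := hanti hm
  have hz : Φ.sideDist s (K.upper α s.1) z = 0 := by linarith
  refine ⟨?_, hz⟩
  obtain rfl | hm2 : m = 1 ∨ 2 ≤ m := by omega
  · rw [pow_one]
  exfalso
  have h2m := hanti hm2
  have h12 := hstep 1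
  obtain ⟨hy0, hy1⟩ := hi.across_lt hz
  have h2 := Φ.len_pos ((Φ.tileUp ^ 1) s).1
  have h3 : 0 < (if K.LeftVeering α ((Φ.tileUp ^ 1) s).1 then
        1 - Φ.across s z else Φ.across s z) := by split_ifs <;> linarith
  have h4 := mul_pos h2 h3
  rw [← h12, one_add_one_eq_two] at h4
  linarith

/-- Two developed triangles that share a point on their boundaries are adjacent across a side that
contains the point, or equal. -/
def Adjacent (s t : Φ.Tile) (z : ℂ) : Prop :=
  s = t ∨ ∃ d, hα.top d = s.1 ∧ t = Φ.crossTile s d ∧ Φ.sideDist s d z = 0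

variable {Φ} in
theorem Adjacent.symm {s t : Φ.Tile} {z : ℂ} (h : Φ.Adjacent s t z) : Φ.Adjacent t s z := by
  rcases h with rfl | ⟨d, hd, rfl, h⟩
  · exact Or.inl rfl
  · exact Or.inr ⟨K.cross d, rfl, (Φ.crossTile_cross hd).symm, by rw [sideDist_crossTile, h, neg_zero]⟩

variable {Φ} in
theorem Inside.adjacent_of_line {s t : Φ.Tile} {z : ℂ} (hi : Φ.Inside s z) (hi' : Φ.Inside t z)
    (h : Φ.tiles.line s = Φ.tiles.line t) : Φ.Adjacent s t z := by
  have key : ∀ {s t : Φ.Tile} (m : ℕ), Φ.Inside s z → Φ.Inside t z → (Φ.tileUp ^ m) s = t →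
      Φ.Adjacent s t z := by
    rintro s t m hi hi' rfl
    obtain rfl | hm : m = 0 ∨ 1 ≤ m := by omega
    · exact Or.inl rfl
    · obtain ⟨h1, h2⟩ := hi.eq_up_of_pow hm hi'
      exact Or.inr ⟨_, hα.top_upper _, by rw [h1, tileUp_eq], h2⟩
  obtain ⟨n, hn⟩ := Φ.tiles.line_eq_iff.1 h
  obtain ⟨m, rfl | rfl⟩ := n.eq_nat_or_neg
  · exact key m hi hi' (by rw [← hn, zpow_natCast]; rfl)
  · refine (key m hi' hi ?_).symm
    rw [← hn, zpow_neg, zpow_natCast]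
    exact Equiv.apply_symm_apply _ _

variable {Φ} in
theorem Inside.strip_le {s : Φ.Tile} {z : ℂ} (hi : Φ.Inside s z) :
    Φ.strip s ≤ z.re ∧ z.re ≤ Φ.strip s + 1 := by
  obtain ⟨h1, h2⟩ := hi.across_mem
  rw [strip]
  rw [across] at h1 h2
  rcases Φ.sgn_eq s.1 with h | h <;> rw [h] at h1 h2 ⊢ <;> constructor <;> linarith

-- A common point of two adjacent strips is on the ladderpole between them. The triangle across this
-- ladderpole from `s` then contains the point and lies in the strip of `t`, where
-- `adjacent_of_line` applies. The only side of that triangle through the point is the one that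
-- leads back to `s`.
variable {Φ} in
theorem Inside.adjacent_of_right {s t : Φ.Tile} {z : ℂ} (hi : Φ.Inside s z) (hi' : Φ.Inside t z)
    (h1 : Φ.tiles.line t = Φ.rightLine (Φ.tiles.line s)) (h2 : Φ.strip t = Φ.strip s + 1) :
    Φ.Adjacent s t z := by
  have hz : z.re = Φ.strip s + 1 := le_antisymm hi.strip_le.2 (by rw [← h2]; exact hi'.strip_le.1)
  have hl := Φ.len_pos s.1
  have h0 := Φ.sideDist_sum' s z
  have p1 := hi.nonneg _ (hα.top_of_wide s.1)
  have p2 := hi.nonneg _ (hα.top_upper s.1)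
  obtain ⟨n1, n2, n3⟩ := upper_ne (α := α) s.1
  have hpol : Φ.sideDist s (K.pole α s.1) z = 0 ∧
      (K.LeftVeering α s.1 ↔ decide (Φ.sgn s.1 = -1) = true) := by
    have hne : Φ.sideDist s (K.pole α s.1) z ≠ Φ.len s.1 := by
      intro he
      have q1 : Φ.sideDist s s.1 z = 0 := by linarith
      have q2 := hi.pos_of_ne (hα.top_of_wide s.1) (hα.top_upper s.1) n1 q1
      linarith
    rw [strip] at hz
    rcases Φ.sgn_eq s.1 with hs | hs <;> rw [hs] at hz <;> by_cases h : K.LeftVeering α s.1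
    · exact absurd (by rw [Φ.sideDist_pole_left h, hs, hz]; ring) hne
    · refine ⟨by rw [Φ.sideDist_pole_right h, hs, hz]; ring, ?_⟩
      rw [hs, decide_eq_true_iff]; norm_num [h]
    · refine ⟨by rw [Φ.sideDist_pole_left h, hs, hz]; ring, ?_⟩
      rw [hs, decide_eq_true_iff]; norm_num [h]
    · exact absurd (by rw [Φ.sideDist_pole_right h, hs, hz]; ring) hne
  have h3 : Φ.tiles.line t = Φ.tiles.line (Φ.tileFlip s) := by
    rw [h1]
    exact Φ.tiles.flipLine_line hpol.2
  have hpt := hα.top_pole s.1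
  have hf := hi.crossTile hpt hpol.1
  rw [← tileFlip_eq] at hf
  have hzf := Φ.sideDist_crossTile s (K.pole α s.1) z
  rw [← tileFlip_eq, hpol.1, neg_zero] at hzf
  rcases hf.adjacent_of_line hi' h3.symm with h4 | ⟨d, hd, h4, h5⟩
  · exact Or.inr ⟨_, hpt, by rw [← h4, tileFlip_eq], hpol.1⟩
  · have hd' : d = K.cross (K.pole α s.1) := by
      by_contra hne
      exact h5.not_gt (hf.pos_of_ne (by rw [tileFlip_eq]; rfl) hd hne hzf)
    left
    rw [h4, hd', tileFlip_eq, Φ.crossTile_cross hpt]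

variable {Φ} in
/-- The developed triangles of one development tile the plane. -/
theorem Inside.adjacent {s t : Φ.Tile} {z : ℂ} (hi : Φ.Inside s z) (hi' : Φ.Inside t z)
    (h : Φ.Linked s t) : Φ.Adjacent s t z := by
  have hst := h.symm
  obtain ⟨k, h1, h2⟩ := h
  -- Strips have width one, so a common point leaves only `k = 0`, `1` or `-1`.
  have a1 := hi.strip_le
  have a2 := hi'.strip_le
  have k1 : (k : ℝ) ≤ 1 := by linarith
  have k2 : (-1 : ℝ) ≤ k := by linarith
  have k3 : k ≤ 1 := by exact_mod_cast k1
  have k4 : -1 ≤ k := by exact_mod_cast k2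
  obtain rfl | rfl | rfl : k = 0 ∨ k = 1 ∨ k = -1 := by omega
  · exact hi.adjacent_of_line hi' (by rw [h1]; rfl)
  · exact hi.adjacent_of_right hi' (by rw [h1, zpow_one]) (by rw [h2]; simp)
  · refine (hi'.adjacent_of_right hi ?_ (by rw [h2]; simp)).symm
    rw [h1, zpow_neg_one]
    exact (Equiv.apply_symm_apply _ _).symm

end FlatStructure
end IdealTriangulation
end

/-! ### Normal curves developed into the plane, and their turning. -/

noncomputable section

-- In the coordinates of the basis `a`, `b` at the corner `C`, comparison of a common point shows
-- that its two pairs of weights agree, and then that both weights vanish.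
open Complex in
theorem disjoint_segment_of_nested {C a b : ℂ} (hab : 0 < det₂ a b) {p q p' q' : ℝ} (hp : 0 < p)
    (hq : 0 < q) (hpp : p < p') (hqq : q < q') :
    Disjoint (segment ℝ (C + p * a) (C + q * b)) (segment ℝ (C + p' * a) (C + q' * b)) := by
  rw [Set.disjoint_left]
  rintro z ⟨s, t, hs, ht, hst, rfl⟩ ⟨s', t', hs', ht', hst', h⟩
  have h1 : ((s' * p' - s * p : ℝ) : ℂ) * a + ((t' * q' - t * q : ℝ) : ℂ) * b = 0 := by
    have e1 : (s : ℂ) + t = 1 := by exact_mod_cast hst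
    have e2 : (s' : ℂ) + t' = 1 := by exact_mod_cast hst'
    simp only [Complex.real_smul] at h
    push_cast
    linear_combination h + C * (e1 - e2)
  have h2 := congrArg Complex.re h1
  have h3 := congrArg Complex.im h1
  simp only [Complex.add_re, Complex.add_im, Complex.re_ofReal_mul, Complex.im_ofReal_mul,
    Complex.zero_re, Complex.zero_im] at h2 h3
  have h4 : (s' * p' - s * p) * det₂ a b = 0 := by
    simp only [det₂]; linear_combination b.im * h2 - b.re * h3
  have h5 : (t' * q' - t * q) * det₂ a b = 0 := by
    simp only [det₂]; linear_combination a.re * h3 - a.im * h2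
  have h6 := (mul_eq_zero.1 h4).resolve_right hab.ne'
  have h7 := (mul_eq_zero.1 h5).resolve_right hab.ne'
  have h8 : s' ≤ s := by
    by_contra! hlt
    nlinarith
  have h9 : t' ≤ t := by
    by_contra! hlt
    nlinarith
  have e1 : s = s' := by linarith
  have e2 : t = t' := by linarith
  subst e1 e2
  have h10 : s = 0 := by
    have : s * (p' - p) = 0 := by linarith
    exact (mul_eq_zero.1 this).resolve_right (by linarith)
  have h11 : t = 0 := by
    have : t * (q' - q) = 0 := by linarith
    exact (mul_eq_zero.1 this).resolve_right (by linarith)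
  rw [h10, h11] at hst
  norm_num at hst

-- The segments cut off the corners `C` and `C + a` of a triangle and meet the common side at the
-- parameters `p` and `1 - q'`. In this order they cannot cross.
open Complex in
theorem disjoint_segment_of_separated {C a b : ℂ} (hab : 0 < det₂ a b) {p q p' q' : ℝ} (hp : 0 < p)
    (hp1 : p < 1) (hq1 : q < 1) (hp1' : p' < 1) (h : p < 1 - q') :
    Disjoint (segment ℝ (C + p * a) (C + q * b))
      (segment ℝ (C + a + p' * (b - a)) (C + a + q' * (-a))) := by
  rw [Set.disjoint_left]
  rintro z ⟨s, t, hs, ht, hst, rfl⟩ ⟨s', t', hs', ht', hst', h⟩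
  have h1 : ((s' * (1 - p') + t' * (1 - q') - s * p : ℝ) : ℂ) * a +
      ((s' * p' - t * q : ℝ) : ℂ) * b = 0 := by
    have e1 : (s : ℂ) + t = 1 := by exact_mod_cast hst
    have e2 : (s' : ℂ) + t' = 1 := by exact_mod_cast hst'
    simp only [Complex.real_smul] at h
    push_cast
    linear_combination h + C * (e1 - e2)
  have h2 := congrArg Complex.re h1
  have h3 := congrArg Complex.im h1
  simp only [Complex.add_re, Complex.add_im, Complex.re_ofReal_mul, Complex.im_ofReal_mul,
    Complex.zero_re, Complex.zero_im] at h2 h3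
  have h4 : (s' * (1 - p') + t' * (1 - q') - s * p) * det₂ a b = 0 := by
    simp only [det₂]; linear_combination b.im * h2 - b.re * h3
  have h5 : (s' * p' - t * q) * det₂ a b = 0 := by
    simp only [det₂]; linear_combination a.re * h3 - a.im * h2
  have h6 := (mul_eq_zero.1 h4).resolve_right hab.ne'
  have h7 := (mul_eq_zero.1 h5).resolve_right hab.ne'
  have h8 : s' * p' ≤ t := by nlinarith
  have h9 : s' * (1 - p') + t' * (1 - q') ≤ (1 - s' * p') * p := by nlinarith
  have h10 : t' * p ≤ t' * (1 - q') := by nlinarith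
  have h11 : s' * ((1 - p') * (1 - p)) ≤ 0 := by
    have : t' = 1 - s' := by linarith
    subst this
    nlinarith
  have h12 : s' = 0 := by
    have := mul_pos (sub_pos.2 hp1') (sub_pos.2 hp1)
    nlinarith
  have h13 : t' = 1 := by linarith
  rw [h12, h13] at h9
  linarith

theorem sum_range_zmod {M : Type*} [AddCommMonoid M] (n : ℕ) [NeZero n] (g : ZMod n → M) (i : ℕ) :
    ∑ j ∈ Finset.range n, g ((i + j : ℕ) : ZMod n) = ∑ x, g x := by
  have h : ∀ g : ZMod n → M, ∑ j ∈ Finset.range n, g ((j : ℕ) : ZMod n) = ∑ x, g x := by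
    intro g
    refine Finset.sum_nbij' (fun j => (j : ZMod n)) ZMod.val (by simp) ?_ ?_ (by simp) (by simp)
    · intro a _; simpa using ZMod.val_lt a
    · intro a ha; exact ZMod.val_cast_of_lt (Finset.mem_range.1 ha)
  rw [← Equiv.sum_comp (Equiv.addLeft (i : ZMod n)) g, ← h]
  simp

theorem Complex.re_neg_I_mul_div_pos {v e : ℂ} (h : 0 < det₂ v e) : 0 < (-I * e / v).re := by
  have hv : 0 < Complex.normSq v := by
    rw [Complex.normSq_pos]
    rintro rfl
    simp [det₂] at h
  have : (-I * e / v).re = det₂ v e / Complex.normSq v := by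
    rw [Complex.div_re, det₂]
    simp
    ring
  rw [this]
  exact div_pos h hv

namespace IdealTriangulation
variable {ι : Type*} [Fintype ι] {K : IdealTriangulation ι} {α : ι → Fin 3 → ℝ}

theorem NormalCurve.entry_succ (γ : K.NormalCurve) (i : ZMod γ.len) :
    γ.entry (i + 1) = K.cross (γ.exit i) := (γ.cross_exit i).symm

theorem NormalCurve.top_entry (hα : K.IsVeering α) (γ : K.NormalCurve) (i : ZMod γ.len) :
    hα.top (γ.entry i) = hα.top (γ.corner i) := by
  rw [NormalCurve.entry]
  split_ifs
  · exact hα.top_ccw_symm _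
  · exact hα.top_ccw _

theorem NormalCurve.top_exit (hα : K.IsVeering α) (γ : K.NormalCurve) (i : ZMod γ.len) :
    hα.top (γ.exit i) = hα.top (γ.corner i) := by
  rw [NormalCurve.exit]
  split_ifs
  · exact hα.top_ccw _
  · exact hα.top_ccw_symm _

theorem NormalCurve.exit_ne_entry (γ : K.NormalCurve) (i : ZMod γ.len) : γ.exit i ≠ γ.entry i := by
  rw [NormalCurve.exit, NormalCurve.entry]
  split_ifs
  · exact (ccw_symm_ne_ccw _ _).symm
  · exact ccw_symm_ne_ccw _ _

namespace FlatStructure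

variable {hα : K.IsVeering α} (Φ : FlatStructure hα)

/-! ### Developing a normal curve -/

/-- The developed triangles met by a normal curve. -/
def tile (γ : K.NormalCurve) (i : ℕ) : Φ.Tile :=
  (hα.top (γ.corner i), ∑ j ∈ Finset.range i, Φ.jump (γ.exit j))

/-- The translation of the development of a normal curve. -/
def period (γ : K.NormalCurve) : ℂ := ∑ i, Φ.jump (γ.exit i)

/-- The endpoints of the developed arcs of a normal curve. -/
def point (γ : K.NormalCurve) (i : ℕ) : ℂ :=
  -- `Real.sigmoid` is an increasing map from `ℝ` to `(0, 1)`. It takes opposite numbers to `τ` and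
  -- `1 - τ`, as required by the two views of an edge.
  Φ.onSide (Φ.tile γ i) (γ.entry i) (Real.sigmoid (γ.pos i))

theorem tile_succ (γ : K.NormalCurve) (i : ℕ) :
    Φ.tile γ (i + 1) = Φ.crossTile (Φ.tile γ i) (γ.exit i) := by
  rw [tile, crossTile]
  refine Prod.ext ?_ ?_
  · change hα.top (γ.corner ((i + 1 : ℕ) : ZMod γ.len)) = hα.top (K.cross (γ.exit i))
    rw [← γ.entry_succ, γ.top_entry]
    push_cast; rfl
  · exact Finset.sum_range_succ _ _

theorem tile_pred (γ : K.NormalCurve) (i : ℕ) :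
    Φ.tile γ i = Φ.crossTile (Φ.tile γ (i + 1)) (γ.entry ((i + 1 : ℕ) : ZMod γ.len)) := by
  push_cast
  rw [tile_succ, γ.entry_succ, crossTile_cross]
  exact γ.top_exit hα _

theorem tile_add_len (γ : K.NormalCurve) (i : ℕ) :
    (Φ.tile γ (i + γ.len)).2 = (Φ.tile γ i).2 + Φ.period γ := by
  rw [tile, tile]
  change ∑ j ∈ Finset.range (i + γ.len), _ = _
  rw [Finset.sum_range_add, period, ← sum_range_zmod γ.len (fun x => Φ.jump (γ.exit x)) i]

theorem tile_add_mul_len (γ : K.NormalCurve) (i m : ℕ) :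
    (Φ.tile γ (i + m * γ.len)).2 = (Φ.tile γ i).2 + m * Φ.period γ := by
  induction m with
  | zero => simp
  | succ m ih =>
    have h : i + (m + 1) * γ.len = i + m * γ.len + γ.len := by ring
    rw [h, tile_add_len, ih]; push_cast; ring

theorem onSide_add (s : Φ.Tile) (V : ℂ) (d : K.Corner) (τ : ℝ) :
    Φ.onSide (s.1, s.2 + V) d τ = Φ.onSide s d τ + V := by
  simp only [onSide, pos]; ring

theorem point_add_len (γ : K.NormalCurve) (i : ℕ) :
    Φ.point γ (i + γ.len) = Φ.point γ i + Φ.period γ := by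
  have hc : ((i + γ.len : ℕ) : ZMod γ.len) = i := by simp
  have h : Φ.tile γ (i + γ.len) = ((Φ.tile γ i).1, (Φ.tile γ i).2 + Φ.period γ) :=
    Prod.ext (by rw [tile, tile, hc]) (Φ.tile_add_len γ i)
  rw [point, hc, h, onSide_add]; rfl

theorem point_succ (γ : K.NormalCurve) (i : ℕ) : Φ.point γ (i + 1) =
    Φ.onSide (Φ.tile γ i) (γ.exit i) (Real.sigmoid (- γ.pos (i + 1))) := by
  rw [point, tile_succ]
  push_cast
  rw [γ.entry_succ, Real.sigmoid_neg, ← onSide_crossTile Φ (Φ.tile γ i) (γ.exit i) (1 - _), sub_sub_cancel]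

theorem top_entry_tile (γ : K.NormalCurve) (i : ℕ) : hα.top (γ.entry i) = (Φ.tile γ i).1 :=
  γ.top_entry hα i

theorem top_exit_tile (γ : K.NormalCurve) (i : ℕ) : hα.top (γ.exit i) = (Φ.tile γ i).1 :=
  γ.top_exit hα i

theorem inside_point (γ : K.NormalCurve) (i : ℕ) : Φ.Inside (Φ.tile γ i) (Φ.point γ i) :=
  Φ.inside_onSide (Φ.top_entry_tile γ i) (Real.sigmoid_pos _) (Real.sigmoid_lt_one _)

theorem inside_point_succ (γ : K.NormalCurve) (i : ℕ) :
    Φ.Inside (Φ.tile γ i) (Φ.point γ (i + 1)) := by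
  rw [point_succ]
  exact Φ.inside_onSide (Φ.top_exit_tile γ i) (Real.sigmoid_pos _) (Real.sigmoid_lt_one _)

theorem linked_tile (γ : K.NormalCurve) (i : ℕ) : Φ.Linked (Φ.tile γ 0) (Φ.tile γ i) := by
  induction i with
  | zero => exact Φ.linked_refl _
  | succ i ih =>
    rw [tile_succ]
    exact ih.trans (Φ.linked_crossTile (Φ.top_exit_tile γ i))

theorem sideDist_add_smul (s : Φ.Tile) (d : K.Corner) (a b : ℂ) {x y : ℝ} (h : x + y = 1) :
    Φ.sideDist s d (x • a + y • b) = x * Φ.sideDist s d a + y * Φ.sideDist s d b := by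
  have hx : x = 1 - y := by linarith
  subst hx
  simp only [sideDist, Complex.det₂, Complex.sub_re, Complex.sub_im, Complex.add_re,
    Complex.add_im, Complex.real_smul, Complex.re_ofReal_mul, Complex.im_ofReal_mul]
  ring

/-- A developed arc. -/
def arc (γ : K.NormalCurve) (i : ℕ) : Set ℂ := segment ℝ (Φ.point γ i) (Φ.point γ (i + 1))

theorem sideDist_entry_point (γ : K.NormalCurve) (i : ℕ) :
    Φ.sideDist (Φ.tile γ i) (γ.entry i) (Φ.point γ i) = 0 := Φ.sideDist_onSide _ _ _

theorem sideDist_exit_point (γ : K.NormalCurve) (i : ℕ) :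
    Φ.sideDist (Φ.tile γ i) (γ.exit i) (Φ.point γ (i + 1)) = 0 := by
  rw [point_succ]; exact Φ.sideDist_onSide _ _ _

/-- A proper convex combination of the endpoints has all three side distances positive, so an arc
meets the sides of its triangle only in its endpoints. -/
theorem arc_cases {γ : K.NormalCurve} {i : ℕ} {z : ℂ} (hz : z ∈ Φ.arc γ i) :
    Φ.Inside (Φ.tile γ i) z ∧ ∀ d, hα.top d = (Φ.tile γ i).1 →
      Φ.sideDist (Φ.tile γ i) d z = 0 →
      (d = γ.entry i ∧ z = Φ.point γ i) ∨ (d = γ.exit i ∧ z = Φ.point γ (i + 1)) := by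
  obtain ⟨x, y, hx, hy, hxy, rfl⟩ := hz
  have i1 := Φ.inside_point γ i
  have i2 := Φ.inside_point_succ γ i
  have hex := γ.exit_ne_entry i
  have t1 := Φ.top_entry_tile γ i
  have t2 := Φ.top_exit_tile γ i
  have d1 := Φ.sideDist_entry_point γ i
  have d2 := Φ.sideDist_exit_point γ i
  rcases hx.eq_or_lt with rfl | hx
  · rw [zero_add] at hxy
    subst hxy
    rw [zero_smul, one_smul, zero_add]
    refine ⟨i2, fun d hd h => Or.inr ⟨?_, rfl⟩⟩
    by_contra hne
    exact (i2.pos_of_ne t2 hd hne d2).ne' h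
  rcases hy.eq_or_lt with rfl | hy
  · rw [add_zero] at hxy
    subst hxy
    rw [zero_smul, one_smul, add_zero]
    refine ⟨i1, fun d hd h => Or.inl ⟨?_, rfl⟩⟩
    by_contra hne
    exact (i1.pos_of_ne t1 hd hne d1).ne' h
  have hpos : ∀ d, hα.top d = (Φ.tile γ i).1 →
      0 < Φ.sideDist (Φ.tile γ i) d (x • Φ.point γ i + y • Φ.point γ (i + 1)) := by
    intro d hd
    rw [sideDist_add_smul _ _ _ _ _ hxy]
    by_cases he : d = γ.entry i
    · subst he
      rw [d1]
      have := mul_pos hy (i2.pos_of_ne t2 hd hex.symm d2)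
      linarith
    · have h1 := mul_pos hx (i1.pos_of_ne t1 hd he d1)
      have h2 := mul_nonneg hy.le (i2.nonneg d hd)
      linarith
  exact ⟨⟨fun d hd => (hpos d hd).le, fun d hd => Or.inl (hpos d hd)⟩,
    fun d hd h => absurd h (hpos d hd).ne'⟩

/-- Seen from the corner that it cuts off, an arc has the form of the two disjointness lemmas for
segments, whichever way it is oriented. -/
theorem arc_eq (γ : K.NormalCurve) (i : ℕ) : Φ.arc γ i =
    segment ℝ (Φ.pos (Φ.tile γ i).2 (γ.corner i) +
        (Real.sigmoid (outDist γ.left γ.pos i) : ℂ) * Φ.side (K.ccw.symm (γ.corner i)))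
      (Φ.pos (Φ.tile γ i).2 (γ.corner i) +
        (Real.sigmoid (inDist γ.left γ.pos i) : ℂ) * -Φ.side (K.ccw (γ.corner i))) := by
  rw [arc, point_succ, point]
  have h := Φ.pos_ccw_symm (Φ.tile γ i).2 (K.ccw (γ.corner i))
  rw [Equiv.symm_apply_apply, ccw_ccw] at h
  simp only [NormalCurve.entry, NormalCurve.exit, outDist, inDist]
  cases γ.left i
  · simp only [Bool.false_eq_true, if_false]
    rw [segment_symm]
    congr 1
    · rw [onSide, Equiv.apply_symm_apply]
    · rw [onSide, ccw_ccw, h, Real.sigmoid_neg]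
      push_cast; ring
  · simp only [if_true]
    congr 1
    · rw [onSide, Equiv.apply_symm_apply]
    · rw [onSide, ccw_ccw, h, Real.sigmoid_neg]
      push_cast; ring

/-- The indices differ modulo the length, since otherwise the tiles would differ by a nonzero
multiple of the period. So these are two different arcs of the curve in one triangle, and
embeddedness applies. -/
theorem disjoint_arc_of_tile_eq {γ : K.NormalCurve} (hV : Φ.period γ ≠ 0) {i j : ℕ} (hij : i ≠ j)
    (h : Φ.tile γ i = Φ.tile γ j) : Disjoint (Φ.arc γ i) (Φ.arc γ j) := by
  have hsep : ∀ {i j : ℕ}, Φ.tile γ i = Φ.tile γ j → γ.corner j = K.ccw (γ.corner i) →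
      Disjoint (Φ.arc γ i) (Φ.arc γ j) := by
    intro i j h hc
    have hs := γ.separated i j hc
    have hd := Φ.det_side_pos (K.ccw.symm (γ.corner i))
    rw [Equiv.apply_symm_apply] at hd
    have h1 := Φ.side_sum (γ.corner i)
    have hd' : 0 < Complex.det₂ (Φ.side (K.ccw.symm (γ.corner i))) (-Φ.side (K.ccw (γ.corner i))) := by
      have : - Φ.side (K.ccw (γ.corner i)) =
          Φ.side (γ.corner i) + Φ.side (K.ccw.symm (γ.corner i)) := by linear_combination -h1
      rw [this]
      simp only [Complex.det₂, Complex.add_re, Complex.add_im] at hd ⊢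
      linarith
    rw [arc_eq, arc_eq, ← h, hc, Equiv.symm_apply_apply, ccw_ccw, pos_ccw]
    have h2 : Φ.side (γ.corner i) =
      (-Φ.side (K.ccw (γ.corner i))) - Φ.side (K.ccw.symm (γ.corner i)) := by linear_combination h1
    rw [h2]
    refine disjoint_segment_of_separated hd' (Real.sigmoid_pos _) (Real.sigmoid_lt_one _)
      (Real.sigmoid_lt_one _) (Real.sigmoid_lt_one _) ?_
    rw [← Real.sigmoid_neg]
    exact Real.sigmoid_strictMono hs
  have hne : (i : ZMod γ.len) ≠ j := by
    have key : ∀ {i j : ℕ}, i < j → Φ.tile γ i = Φ.tile γ j → (i : ZMod γ.len) ≠ j := by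
      intro i j hij h he
      obtain ⟨m, hm⟩ := (Nat.modEq_iff_dvd' hij.le).1 ((ZMod.natCast_eq_natCast_iff _ _ _).1 he)
      have hj : j = i + m * γ.len := by rw [mul_comm]; omega
      have h1 := Φ.tile_add_mul_len γ i m
      rw [← hj, ← h] at h1
      have h2 : (m : ℂ) * Φ.period γ = 0 := by linear_combination -h1
      rcases mul_eq_zero.1 h2 with h3 | h3
      · have : m = 0 := by exact_mod_cast h3
        subst this
        simp at hj
        omega
      · exact hV h3
    rcases hij.lt_or_gt with hlt | hlt
    · exact key hlt h
    · exact (key hlt h.symm).symm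
  have hc : hα.top (γ.corner j) = hα.top (γ.corner i) := (congrArg Prod.fst h).symm
  rcases hα.eq_or_of_top_eq hc with hc | hc | hc
  · have hd := Φ.det_side_pos (K.ccw (γ.corner i))
    rw [ccw_ccw] at hd
    have hd' : 0 < Complex.det₂ (Φ.side (K.ccw.symm (γ.corner i)))
        (-Φ.side (K.ccw (γ.corner i))) := by
      simp only [Complex.det₂, Complex.neg_re, Complex.neg_im] at hd ⊢
      linarith
    rw [arc_eq, arc_eq, ← h, hc]
    rcases γ.nested i j hne hc.symm with ⟨h1, h2⟩ | ⟨h1, h2⟩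
    · exact disjoint_segment_of_nested hd' (Real.sigmoid_pos _) (Real.sigmoid_pos _)
        (Real.sigmoid_strictMono h1) (Real.sigmoid_strictMono h2)
    · exact (disjoint_segment_of_nested hd' (Real.sigmoid_pos _) (Real.sigmoid_pos _)
        (Real.sigmoid_strictMono h1) (Real.sigmoid_strictMono h2)).symm
  · exact hsep h hc
  · refine (hsep h.symm ?_).symm
    rw [hc, Equiv.apply_symm_apply]

/-- At a common point the two tiles coincide or are adjacent. In the second case the point is an
endpoint of the arc `j`, hence also on the arc before or after it, which lies in the tile of `i`. As
`i + 2 ≤ j`, that arc is still not the arc `i`. -/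
theorem disjoint_arc {γ : K.NormalCurve} (hV : Φ.period γ ≠ 0) {i j : ℕ} (hij : i + 2 ≤ j) :
    Disjoint (Φ.arc γ i) (Φ.arc γ j) := by
  rw [Set.disjoint_left]
  intro z hi hj
  obtain ⟨hi1, -⟩ := Φ.arc_cases hi
  obtain ⟨hj1, hj2⟩ := Φ.arc_cases hj
  obtain ⟨j, rfl⟩ : ∃ j', j = j' + 1 := ⟨j - 1, by omega⟩
  have hl := (Φ.linked_tile γ (j + 1)).symm.trans (Φ.linked_tile γ i)
  rcases hj1.adjacent hi1 hl with h | ⟨d, hd, h, h0⟩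
  · exact Set.disjoint_left.1 (Φ.disjoint_arc_of_tile_eq hV (by omega) h.symm) hi hj
  rcases hj2 d hd h0 with ⟨rfl, rfl⟩ | ⟨rfl, rfl⟩
  · rw [← tile_pred] at h
    exact Set.disjoint_left.1 (Φ.disjoint_arc_of_tile_eq hV (by omega) h) hi
      (right_mem_segment ℝ _ _)
  · rw [← tile_succ] at h
    exact Set.disjoint_left.1 (Φ.disjoint_arc_of_tile_eq hV (by omega) h) hi
      (left_mem_segment ℝ _ _)

/-! ### Turning of a developed curve -/

theorem det_exit (γ : K.NormalCurve) (i : ℕ) :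
    0 < Complex.det₂ (Φ.point γ (i + 1) - Φ.point γ i) (Φ.side (γ.exit i)) := by
  have h1 := (Φ.inside_point γ i).pos_of_ne (Φ.top_entry_tile γ i) (Φ.top_exit_tile γ i)
    (γ.exit_ne_entry i) (Φ.sideDist_entry_point γ i)
  have h2 := Φ.sideDist_exit_point γ i
  simp only [sideDist, Complex.det₂, Complex.sub_re, Complex.sub_im] at h1 h2 ⊢
  linarith

theorem det_entry (γ : K.NormalCurve) (i : ℕ) :
    0 < Complex.det₂ (Φ.point γ (i + 1) - Φ.point γ i) (- Φ.side (γ.entry i)) := by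
  have h1 := (Φ.inside_point_succ γ i).pos_of_ne (Φ.top_exit_tile γ i) (Φ.top_entry_tile γ i)
    (γ.exit_ne_entry i).symm (Φ.sideDist_exit_point γ i)
  have h2 := Φ.sideDist_entry_point γ i
  simp only [sideDist, Complex.det₂, Complex.sub_re, Complex.sub_im, Complex.neg_re,
    Complex.neg_im] at h1 h2 ⊢
  linarith

theorem neg_side_entry_succ (γ : K.NormalCurve) (i : ℕ) :
    - Φ.side (γ.entry ((i + 1 : ℕ) : ZMod γ.len)) = Φ.side (γ.exit i) := by
  push_cast
  rw [γ.entry_succ, Φ.side_cross, neg_neg]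

theorem sum_arg_point {γ : K.NormalCurve} (hV : Φ.period γ ≠ 0) :
    ∑ i ∈ Finset.range γ.len, ((Φ.point γ (i + 2) - Φ.point γ (i + 1)) /
      (Φ.point γ (i + 1) - Φ.point γ i)).arg = 0 := by
  refine sum_arg_eq_zero_of_embedded (Φ.point γ) γ.len (Nat.one_le_iff_ne_zero.2 γ.len_ne_zero.out)
    (Φ.period γ) (Φ.point_add_len γ) (fun i j hij => Φ.disjoint_arc hV hij) fun i => ?_
  have h1 := Φ.det_exit γ i
  have h2 := Φ.det_entry γ (i + 1)
  rw [neg_side_entry_succ] at h2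
  -- With this factor the real part of the product with `v` is the determinant of `v` and the
  -- crossed side. Both adjacent arcs cross that side in the same direction.
  refine ⟨⟨(Φ.side (γ.exit i)).im, (Φ.side (γ.exit i)).re⟩, ?_, ?_⟩
  · rw [Complex.mul_re]
    simp only [Complex.det₂] at h1
    linarith
  · rw [Complex.mul_re]
    simp only [Complex.det₂] at h2
    linarith

/-- The crossed sides turn as much as the arcs. Each arc makes an angle in `(0, π)` with the sides
at both of its ends, and `-Complex.I` centres this range so that arguments are additive. The
difference between the two total turnings telescopes over a period. -/
theorem sum_arg_side {γ : K.NormalCurve} (hV : Φ.period γ ≠ 0) :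
    ∑ i, (Φ.side (γ.exit i) / (- Φ.side (γ.entry i))).arg = 0 := by
  rw [← sum_range_zmod γ.len _ 0]
  simp only [zero_add]
  set v : ℕ → ℂ := fun i => Φ.point γ (i + 1) - Φ.point γ i with hv
  set e : ℕ → ℂ := fun i => - Φ.side (γ.entry i) with he
  have h1 : ∀ i, 0 < (-Complex.I * e i / v i).re := fun i =>
    Complex.re_neg_I_mul_div_pos (Φ.det_entry γ i)
  have h2 : ∀ i, 0 < (-Complex.I * e (i + 1) / v i).re := fun i => by
    refine Complex.re_neg_I_mul_div_pos ?_
    simp only [he, hv]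
    rw [neg_side_entry_succ]
    exact Φ.det_exit γ i
  have h3 : ∀ i, (e (i + 1) / e i).arg =
      (-Complex.I * e (i + 1) / v i).arg - (-Complex.I * e i / v i).arg := by
    intro i
    have := arg_div_of_re_pos (u := -Complex.I / v i) (z := e i) (w := e (i + 1))
      (by convert h1 i using 2; ring) (by convert h2 i using 2; ring)
    rw [this]
    congr 2 <;> ring
  have h4 : ∀ i, (v (i + 1) / v i).arg =
      (-Complex.I * e (i + 1) / v i).arg - (-Complex.I * e (i + 1) / v (i + 1)).arg := by
    intro i
    have := arg_div_of_re_pos (u := -Complex.I * e (i + 1)) (z := (v (i + 1))⁻¹) (w := (v i)⁻¹)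
      (h1 (i + 1)) (h2 i)
    rw [← div_eq_mul_inv, ← div_eq_mul_inv] at this
    rw [← this]
    congr 1
    rw [div_inv_eq_mul, mul_comm, div_eq_mul_inv]
  have h5 := Φ.sum_arg_point hV
  have h6 : ∀ i, Φ.side (γ.exit (i : ℕ)) / (- Φ.side (γ.entry (i : ℕ))) = e (i + 1) / e i := by
    intro i
    simp only [he]
    rw [neg_side_entry_succ]
  have h7 : ∀ i, ((Φ.point γ (i + 2) - Φ.point γ (i + 1)) /
      (Φ.point γ (i + 1) - Φ.point γ i)).arg = (v (i + 1) / v i).arg := fun i => rfl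
  simp only [h7, h4] at h5
  simp only [h6, h3]
  rw [Finset.sum_sub_distrib] at h5 ⊢
  have h8 : ∑ i ∈ Finset.range γ.len, (-Complex.I * e (i + 1) / v (i + 1)).arg =
      ∑ i ∈ Finset.range γ.len, (-Complex.I * e i / v i).arg := by
    have h9 := Finset.sum_range_succ' (fun i => (-Complex.I * e i / v i).arg) γ.len
    have h10 := Finset.sum_range_succ (fun i => (-Complex.I * e i / v i).arg) γ.len
    have h11 : (-Complex.I * e γ.len / v γ.len).arg = (-Complex.I * e 0 / v 0).arg := by
      have a1 := Φ.point_add_len γ 0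
      have a2 := Φ.point_add_len γ 1
      rw [zero_add] at a1
      rw [add_comm] at a2
      simp only [hv, he]
      rw [a1, a2]
      simp
    rw [h11] at h10
    linarith
  rw [← h8]
  exact h5

/-- The tilts in `arg_side_div` cancel, each exit side being glued to the next entry side. -/
theorem sum_roughAngle {γ : K.NormalCurve} (hV : Φ.period γ ≠ 0) :
    (∑ i, if γ.left i then hα.roughAngle (γ.corner i) else - hα.roughAngle (γ.corner i)) = 0 := by
  have h1 : ∀ i, (Φ.side (γ.exit i) / (- Φ.side (γ.entry i))).arg =
      (if γ.left i then hα.roughAngle (γ.corner i) else - hα.roughAngle (γ.corner i)) +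
        (Φ.tilt (γ.exit i) - Φ.tilt (γ.entry i)) := by
    intro i
    rw [NormalCurve.exit, NormalCurve.entry]
    split_ifs
    · rw [arg_side_div]; ring
    · rw [arg_side_div']; ring
  have h2 := Φ.sum_arg_side hV
  simp only [h1] at h2
  rw [Finset.sum_add_distrib, Finset.sum_sub_distrib] at h2
  have h3 : ∑ i, Φ.tilt (γ.entry i) = ∑ i, Φ.tilt (γ.exit i) := by
    rw [← Equiv.sum_comp (Equiv.addRight (1 : ZMod γ.len))]
    refine Finset.sum_congr rfl fun i _ => ?_
    rw [Equiv.coe_addRight, γ.entry_succ, tilt_cross]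
  rw [h3, sub_self, add_zero] at h2
  exact h2

end FlatStructure
end IdealTriangulation
end

noncomputable section

/-! ### Closed orbits -/

theorem iterate_val_succ {X : Type*} (f : X → X) (x : X) [NeZero (Function.minimalPeriod f x)]
    (i : ZMod (Function.minimalPeriod f x)) : f^[(i + 1).val] x = f (f^[i.val] x) := by
  have h : i + 1 = ((i.val + 1 : ℕ) : ZMod (Function.minimalPeriod f x)) := by simp
  rw [h, ZMod.val_natCast, Function.iterate_mod_minimalPeriod_eq, Function.iterate_succ_apply']

theorem iterate_val_injective {X : Type*} (f : X → X) (x : X)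
    [NeZero (Function.minimalPeriod f x)] :
    Function.Injective fun i : ZMod (Function.minimalPeriod f x) => f^[i.val] x := by
  intro i j h
  exact ZMod.val_injective _ (Function.iterate_injOn_Iio_minimalPeriod (ZMod.val_lt i)
    (ZMod.val_lt j) h)

theorem exists_iterate_val {X : Type*} (f : X → X) (x : X)
    [NeZero (Function.minimalPeriod f x)] (k : ℕ) :
    ∃ i : ZMod (Function.minimalPeriod f x), f^[i.val] x = f^[k] x :=
  ⟨k, by rw [ZMod.val_natCast, Function.iterate_mod_minimalPeriod_eq]⟩

namespace IdealTriangulation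
variable {ι : Type*} [Fintype ι] {K : IdealTriangulation ι} {α : ι → Fin 3 → ℝ}

/-! ### Curves that spiral through the ladders -/

/-- A ladder that is entered from its left side (if the second component is true) or from its right
side is left through its other side. -/
def IsVeering.nextLadder (hα : K.IsVeering α) : Equiv.Perm (hα.ladders.Line × Bool) where
  toFun x := (hα.ladders.flipLine (!x.2) x.1, !x.2)
  invFun x := (hα.ladders.flipLine x.2 x.1, !x.2)
  left_inv x := by simp [LadderSystem.flipLine_flipLine]
  right_inv x := by simp [LadderSystem.flipLine_flipLine]

/-- In every ladder, a path that enters it and goes up until it leaves it on the other side. -/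
structure LadderWalk (hα : K.IsVeering α) where
  first : hα.ladders.Line × Bool → K.Wide α
  line_first : ∀ x, hα.ladders.line (first x) = x.1
  left_first : ∀ x, K.LeftVeering α (first x) ↔ x.2 = true
  height : hα.ladders.Line × Bool → ℕ
  up_height : ∀ x, (hα.up ^ height x) (first x) = hα.flip (first (hα.nextLadder x))

theorem IsVeering.exists_ladderWalk (hα : K.IsVeering α) : Nonempty (LadderWalk hα) := by
  choose f hf1 hf2 using fun x : hα.ladders.Line × Bool => hα.ladders.exists_line_left x.1 x.2
  have h : ∀ x, ∃ m : ℕ, (hα.up ^ m) (f x) = hα.flip (f (hα.nextLadder x)) := by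
    intro x
    have h1 : hα.ladders.line (f x) = hα.ladders.line (hα.flip (f (hα.nextLadder x))) := by
      have h2 := hα.ladders.flipLine_line (hf2 (hα.nextLadder x))
      rw [hf1] at h2
      refine (hf1 x).trans (Eq.trans ?_ h2)
      exact (hα.ladders.flipLine_flipLine _ _).symm
    exact Equiv.Perm.SameCycle.exists_nat_pow_eq (hα.ladders.line_eq_iff.1 h1)
  choose m hm using h
  exact ⟨⟨f, hf1, hf2, m, hm⟩⟩

namespace LadderWalk

variable {hα : K.IsVeering α} (W : LadderWalk hα)

/-- The positions of a walk: a ladder, and the height reached in it. -/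
abbrev State (_W : LadderWalk hα) : Type _ := (hα.ladders.Line × Bool) × ℕ

theorem height_pos (x : hα.ladders.Line × Bool) : 0 < W.height x := by
  by_contra h
  have h1 := W.up_height x
  rw [Nat.eq_zero_of_not_pos h, pow_zero, Equiv.Perm.one_apply] at h1
  have h2 := hα.left_flip (W.first (hα.nextLadder x))
  rw [← h1, W.left_first, W.left_first] at h2
  change _ ↔ (!x.2) = true at h2
  cases x.2 <;> simp at h2

/-- The triangle of a state. -/
def tri (q : W.State) : K.Wide α := (hα.up ^ q.2) (W.first q.1)

/-- The state that follows. -/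
def step (q : W.State) : W.State :=
  if q.2 < W.height q.1 then (q.1, q.2 + 1) else (hα.nextLadder q.1, 0)

theorem line_tri (q : W.State) : hα.ladders.line (W.tri q) = q.1.1 :=
  (hα.ladders.line_up_pow q.2 _).trans (W.line_first q.1)

theorem tri_succ (x : hα.ladders.Line × Bool) (r : ℕ) : W.tri (x, r + 1) = hα.up (W.tri (x, r)) := by
  rw [tri, tri, pow_succ', Equiv.Perm.mul_apply]

theorem flip_tri_height (x : hα.ladders.Line × Bool) :
    hα.flip (W.tri (x, W.height x)) = W.first (hα.nextLadder x) := by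
  rw [tri, W.up_height, hα.flip_flip]

theorem left_tri_zero (x : hα.ladders.Line × Bool) :
    K.LeftVeering α (W.tri (x, 0)) ↔ x.2 = true := W.left_first x

theorem left_tri_height (x : hα.ladders.Line × Bool) :
    K.LeftVeering α (W.tri (x, W.height x)) ↔ x.2 = false := by
  rw [tri, W.up_height, hα.left_flip, W.left_first]
  change (!x.2) = true ↔ _
  simp

/-- The side through which a state is entered. -/
def entrySide (q : W.State) : K.Corner := if q.2 = 0 then K.pole α (W.tri q) else W.tri q

/-- The side through which a state is left. -/
def exitSide (q : W.State) : K.Corner :=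
  if q.2 < W.height q.1 then K.upper α (W.tri q) else K.pole α (W.tri q)

/-- The corner that is cut off by the arc of a state. -/
def cutCorner (q : W.State) : K.Corner :=
  if q.2 = 0 then W.tri q else
    if q.2 < W.height q.1 then K.pole α (W.tri q) else K.upper α (W.tri q)

open Classical in
/-- The side on which the arc of a state has the corner that it cuts off. -/
def turnsLeft (q : W.State) : Bool :=
  if 0 < q.2 ∧ q.2 < W.height q.1 then !decide (K.LeftVeering α (W.tri q))
    else decide (K.LeftVeering α (W.tri q))

/-- The coordinate at which a state is entered. -/
def entryPos (q : W.State) : ℝ := (if q.1.2 then 1 else -1) * q.2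

theorem cross_exitSide {q : W.State} (hq : q.2 ≤ W.height q.1) :
    K.cross (W.exitSide q) = W.entrySide (W.step q) := by
  obtain ⟨x, r⟩ := q
  change r ≤ W.height x at hq
  rw [exitSide, step]
  dsimp only
  by_cases h : r < W.height x
  · rw [if_pos h, if_pos h, hα.cross_upper, entrySide, if_neg (Nat.succ_ne_zero r), tri_succ]
  · obtain rfl : r = W.height x := by omega
    rw [if_neg h, if_neg h, hα.cross_pole_flip, flip_tri_height, entrySide, if_pos rfl]
    rfl

theorem top_cutCorner (q : W.State) : hα.top (W.cutCorner q) = W.tri q := by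
  rw [cutCorner]
  split_ifs
  · exact hα.top_of_wide _
  · exact hα.top_pole _
  · exact hα.top_upper _

theorem entrySide_eq (q : W.State) :
    (if W.turnsLeft q then K.ccw.symm (W.cutCorner q) else K.ccw (W.cutCorner q)) =
      W.entrySide q := by
  rw [turnsLeft, cutCorner, entrySide]
  by_cases hl : K.LeftVeering α (W.tri q) <;> rcases Nat.eq_zero_or_pos q.2 with h0 | h0
  · simp [h0, hl, pole_of_left hl]
  · by_cases h1 : q.2 < W.height q.1
    · simp [h0, h0.ne', h1, hl, pole_of_left hl]
    · simp [h0.ne', h1, hl, upper_of_left hl]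
  · simp [h0, hl, pole_of_not_left hl]
  · by_cases h1 : q.2 < W.height q.1
    · simp [h0, h0.ne', h1, hl, pole_of_not_left hl]
    · simp [h0.ne', h1, hl, upper_of_not_left hl]

theorem exitSide_eq (q : W.State) :
    (if W.turnsLeft q then K.ccw (W.cutCorner q) else K.ccw.symm (W.cutCorner q)) =
      W.exitSide q := by
  have hpos := W.height_pos q.1
  rw [turnsLeft, cutCorner, exitSide]
  by_cases hl : K.LeftVeering α (W.tri q) <;> rcases Nat.eq_zero_or_pos q.2 with h0 | h0
  · simp [h0, hl, upper_of_left hl, hpos]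
  · by_cases h1 : q.2 < W.height q.1
    · simp [h0, h0.ne', h1, hl, pole_of_left hl, upper_of_left hl, ccw_symm_symm]
    · simp [h0.ne', h1, hl, pole_of_left hl, upper_of_left hl, ccw_ccw]
  · simp [h0, hl, upper_of_not_left hl, hpos]
  · by_cases h1 : q.2 < W.height q.1
    · simp [h0, h0.ne', h1, hl, pole_of_not_left hl, upper_of_not_left hl, ccw_ccw]
    · simp [h0.ne', h1, hl, pole_of_not_left hl, upper_of_not_left hl, ccw_symm_symm]

/-- The distance from the corner at which the arc of a state meets the side out of its corner. -/
def outPos (q : W.State) : ℝ := if W.turnsLeft q then W.entryPos q else - W.entryPos (W.step q)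

/-- The distance from the corner at which the arc of a state meets the side into its corner. -/
def inPos (q : W.State) : ℝ := if W.turnsLeft q then W.entryPos (W.step q) else - W.entryPos q

theorem entryPos_step {x : hα.ladders.Line × Bool} {r : ℕ} (h : r < W.height x) :
    W.entryPos (W.step (x, r)) = (if x.2 then 1 else -1) * (r + 1) := by
  rw [step, if_pos h, entryPos]
  push_cast; rfl

theorem entryPos_step_height (x : hα.ladders.Line × Bool) :
    W.entryPos (W.step (x, W.height x)) = 0 := by
  rw [step, if_neg (lt_irrefl _), entryPos]
  simp

theorem turnsLeft_zero (x : hα.ladders.Line × Bool) : W.turnsLeft (x, 0) = x.2 := by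
  have h := W.left_tri_zero x
  rw [turnsLeft, if_neg (by simp)]
  cases hx : x.2 <;> rw [hx] at h <;> simpa using h

theorem turnsLeft_height (x : hα.ladders.Line × Bool) : W.turnsLeft (x, W.height x) = !x.2 := by
  have h := W.left_tri_height x
  rw [turnsLeft, if_neg (by simp)]
  cases hx : x.2 <;> rw [hx] at h <;> simpa using h

theorem outPos_zero (x : hα.ladders.Line × Bool) : W.outPos (x, 0) = if x.2 then 0 else 1 := by
  rw [outPos, turnsLeft_zero, W.entryPos_step (W.height_pos x), entryPos]
  cases x.2 <;> simp

theorem inPos_zero (x : hα.ladders.Line × Bool) : W.inPos (x, 0) = if x.2 then 1 else 0 := by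
  rw [inPos, turnsLeft_zero, W.entryPos_step (W.height_pos x), entryPos]
  cases x.2 <;> simp

theorem outPos_height (x : hα.ladders.Line × Bool) :
    W.outPos (x, W.height x) = if x.2 then 0 else - (W.height x : ℝ) := by
  rw [outPos, turnsLeft_height, entryPos_step_height, entryPos]
  cases x.2 <;> simp

theorem inPos_height (x : hα.ladders.Line × Bool) :
    W.inPos (x, W.height x) = if x.2 then - (W.height x : ℝ) else 0 := by
  rw [inPos, turnsLeft_height, entryPos_step_height, entryPos]
  cases x.2 <;> simp

open Classical in
theorem turnsLeft_mid {x : hα.ladders.Line × Bool} {r : ℕ} (h0 : 0 < r) (h1 : r < W.height x) :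
    W.turnsLeft (x, r) = !decide (K.LeftVeering α (W.tri (x, r))) := by
  rw [turnsLeft, if_pos (And.intro h0 h1)]

open Classical in
theorem outPos_mid {x : hα.ladders.Line × Bool} {r : ℕ} (h0 : 0 < r) (h1 : r < W.height x) :
    W.outPos (x, r) = (if x.2 then 1 else -1) *
      if K.LeftVeering α (W.tri (x, r)) then - ((r : ℝ) + 1) else r := by
  rw [outPos, W.turnsLeft_mid h0 h1, W.entryPos_step h1, entryPos]
  by_cases hl : K.LeftVeering α (W.tri (x, r)) <;> cases x.2 <;> simp [hl]

open Classical in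
theorem inPos_mid {x : hα.ladders.Line × Bool} {r : ℕ} (h0 : 0 < r) (h1 : r < W.height x) :
    W.inPos (x, r) = (if x.2 then 1 else -1) *
      if K.LeftVeering α (W.tri (x, r)) then - (r : ℝ) else r + 1 := by
  rw [inPos, W.turnsLeft_mid h0 h1, W.entryPos_step h1, entryPos]
  by_cases hl : K.LeftVeering α (W.tri (x, r)) <;> simp [hl]

theorem cutCorner_zero (x : hα.ladders.Line × Bool) : W.cutCorner (x, 0) = W.tri (x, 0) := if_pos rfl

theorem cutCorner_height (x : hα.ladders.Line × Bool) :
    W.cutCorner (x, W.height x) = K.upper α (W.tri (x, W.height x)) := by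
  rw [cutCorner, if_neg (W.height_pos x).ne', if_neg (lt_irrefl _)]

theorem cutCorner_mid {x : hα.ladders.Line × Bool} {r : ℕ} (h0 : 0 < r) (h1 : r < W.height x) :
    W.cutCorner (x, r) = K.pole α (W.tri (x, r)) := by
  rw [cutCorner, if_neg h0.ne', if_pos h1]

theorem phases {x : hα.ladders.Line × Bool} {r : ℕ} (hr : r ≤ W.height x) :
    r = 0 ∨ (0 < r ∧ r < W.height x) ∨ r = W.height x := by omega

/-- Only two intermediate arcs can cut off the same corner: the first and the last arc cut off
corners of another kind. The coordinate on the rungs drifts steadily with the height, away from the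
side where the ladder was entered, so the laps of the spiral are parallel. -/
theorem nested {x : hα.ladders.Line × Bool} {r r' : ℕ} (hr : r ≤ W.height x)
    (hr' : r' ≤ W.height x) (hlt : r < r') (h : W.cutCorner (x, r) = W.cutCorner (x, r')) :
    (W.outPos (x, r) < W.outPos (x, r') ∧ W.inPos (x, r) < W.inPos (x, r')) ∨
    (W.outPos (x, r') < W.outPos (x, r) ∧ W.inPos (x, r') < W.inPos (x, r)) := by
  have ht : W.tri (x, r) = W.tri (x, r') := by rw [← top_cutCorner, h, top_cutCorner]
  obtain ⟨n1, n2, n3⟩ := upper_ne (α := α) (W.tri (x, r'))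
  have hc : (r : ℝ) < r' := by exact_mod_cast hlt
  rcases W.phases hr with rfl | ⟨a0, a1⟩ | rfl <;> rcases W.phases hr' with rfl | ⟨b0, b1⟩ | rfl
  · exact absurd hlt (lt_irrefl _)
  · rw [W.cutCorner_mid b0 b1, cutCorner_zero, ht] at h
    exact absurd h.symm n2
  · rw [cutCorner_height, cutCorner_zero, ht] at h
    exact absurd h.symm n1
  · omega
  · rw [W.outPos_mid a0 a1, W.outPos_mid b0 b1, W.inPos_mid a0 a1, W.inPos_mid b0 b1, ht]
    cases x.2
    · simp only [Bool.false_eq_true, if_false]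
      split_ifs
      · left; constructor <;> linarith
      · right; constructor <;> linarith
    · simp only [if_true]
      split_ifs
      · right; constructor <;> linarith
      · left; constructor <;> linarith
  · rw [W.cutCorner_mid a0 a1, cutCorner_height, ht] at h
    exact absurd h n3
  · omega
  · omega
  · exact absurd hlt (lt_irrefl _)

theorem separated {x : hα.ladders.Line × Bool} {r r' : ℕ} (hr : r ≤ W.height x)
    (hr' : r' ≤ W.height x) (h : W.cutCorner (x, r') = K.ccw (W.cutCorner (x, r))) :
    W.outPos (x, r) < - W.inPos (x, r') := by
  have ht : W.tri (x, r) = W.tri (x, r') := by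
    rw [← top_cutCorner, ← top_cutCorner, h, hα.top_ccw]
  have l0 := W.left_tri_zero x
  have l1 := W.left_tri_height x
  have n1 := K.ccw_ne (W.tri (x, r'))
  have n2 := K.ccw_symm_ne (W.tri (x, r'))
  have n3 := K.ccw_symm_ne_ccw (W.tri (x, r'))
  rcases W.phases hr with rfl | ⟨a0, a1⟩ | rfl <;> rcases W.phases hr' with rfl | ⟨b0, b1⟩ | rfl
  · rw [cutCorner_zero] at h
    exact absurd h.symm n1
  · have hb : (0 : ℝ) < r' := by exact_mod_cast b0
    rw [cutCorner_zero, W.cutCorner_mid b0 b1, ht] at h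
    by_cases hl : K.LeftVeering α (W.tri (x, r'))
    · rw [pole_of_left hl] at h
      exact absurd h n3
    · rw [ht] at l0
      have hx : x.2 = false := by simpa using mt l0.2 hl
      rw [outPos_zero, W.inPos_mid b0 b1, if_neg hl, hx]
      simp only [Bool.false_eq_true, if_false]
      linarith
  -- The first and the last triangle of a passage are based on opposite sides of the ladder, so they
  -- are different.
  · rw [ht] at l0
    cases hx : x.2 <;> rw [hx] at l0 l1 <;> simp_all
  · have ha : (0 : ℝ) < r := by exact_mod_cast a0
    rw [cutCorner_zero, W.cutCorner_mid a0 a1, ht] at h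
    by_cases hl : K.LeftVeering α (W.tri (x, 0))
    · rw [W.outPos_mid a0 a1, inPos_zero, ht, if_pos hl, l0.1 hl]
      simp only [if_true]
      linarith
    · rw [pole_of_not_left hl, ccw_ccw] at h
      exact absurd h.symm n2
  · rw [W.cutCorner_mid a0 a1, W.cutCorner_mid b0 b1, ht] at h
    exact absurd h.symm (K.ccw_ne _)
  · have ha : (r : ℝ) < W.height x := by exact_mod_cast a1
    rw [cutCorner_height, W.cutCorner_mid a0 a1, ht] at h
    by_cases hl : K.LeftVeering α (W.tri (x, W.height x))
    · rw [pole_of_left hl, upper_of_left hl, Equiv.apply_symm_apply] at h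
      exact absurd h n1
    · have hx : x.2 = true := by simpa using mt l1.2 hl
      rw [W.outPos_mid a0 a1, inPos_height, ht, if_neg hl, hx]
      simp only [if_true]
      linarith
  · rw [← ht] at l0
    cases hx : x.2 <;> rw [hx] at l0 l1 <;> simp_all
  · have hb : (r' : ℝ) < W.height x := by exact_mod_cast b1
    rw [cutCorner_height, W.cutCorner_mid b0 b1, ht] at h
    rw [ht] at l1
    by_cases hl : K.LeftVeering α (W.tri (x, r'))
    · rw [outPos_height, W.inPos_mid b0 b1, if_pos hl, l1.1 hl]
      simp only [Bool.false_eq_true, if_false]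
      linarith
    · rw [pole_of_not_left hl, upper_of_not_left hl, Equiv.apply_symm_apply] at h
      exact absurd h n1
  · rw [cutCorner_height] at h
    exact absurd h.symm (K.ccw_ne _)

/-! The orbit of a state under `step` is a closed curve. -/

theorem step_iterate {x : hα.ladders.Line × Bool} {r : ℕ} (hr : r ≤ W.height x) :
    W.step^[r] (x, 0) = (x, r) := by
  induction r with
  | zero => rfl
  | succ r ih => rw [Function.iterate_succ_apply', ih (by omega), step, if_pos (by exact hr)]

theorem step_iterate_height (x : hα.ladders.Line × Bool) :
    W.step^[W.height x + 1] (x, 0) = (hα.nextLadder x, 0) := by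
  rw [Function.iterate_succ_apply', W.step_iterate le_rfl, step, if_neg (lt_irrefl _)]

theorem exists_step_iterate (x : hα.ladders.Line × Bool) (j : ℕ) :
    ∃ k, j ≤ k ∧ W.step^[k] (x, 0) = (hα.nextLadder^[j] x, 0) := by
  induction j with
  | zero => exact ⟨0, le_rfl, rfl⟩
  | succ j ih =>
    obtain ⟨k, hk, h⟩ := ih
    refine ⟨W.height (hα.nextLadder^[j] x) + 1 + k, by omega, ?_⟩
    rw [Function.iterate_add_apply, h, step_iterate_height, Function.iterate_succ_apply']

theorem step_iterate_mem (x : hα.ladders.Line × Bool) (k : ℕ) :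
    (W.step^[k] (x, 0)).2 ≤ W.height (W.step^[k] (x, 0)).1 ∧
      ∃ j, hα.nextLadder^[j] x = (W.step^[k] (x, 0)).1 := by
  induction k with
  | zero => exact ⟨Nat.zero_le _, 0, rfl⟩
  | succ k ih =>
    obtain ⟨-, j, hj⟩ := ih
    rw [Function.iterate_succ_apply', step]
    split_ifs with h
    · exact ⟨h, j, hj⟩
    · exact ⟨Nat.zero_le _, j + 1, by rw [Function.iterate_succ_apply', hj]⟩

theorem minimalPeriod_pos (x : hα.ladders.Line × Bool) :
    0 < Function.minimalPeriod W.step (x, 0) := by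
  obtain ⟨n, hn, h⟩ := Function.mem_periodicPts.1
    (Function.Injective.mem_periodicPts hα.nextLadder.injective x)
  obtain ⟨k, hk, hk'⟩ := W.exists_step_iterate x n
  refine Function.minimalPeriod_pos_of_mem_periodicPts
    (Function.mk_mem_periodicPts (n := k) (by omega) ?_)
  rw [Function.IsPeriodicPt, Function.IsFixedPt, hk', h]

instance (x : hα.ladders.Line × Bool) : NeZero (Function.minimalPeriod W.step (x, 0)) :=
  ⟨(W.minimalPeriod_pos x).ne'⟩

/-- The states on the closed orbit of the first state of a ladder. -/
def state (x : hα.ladders.Line × Bool) (i : ZMod (Function.minimalPeriod W.step (x, 0))) :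
    W.State := W.step^[i.val] (x, 0)

theorem state_succ (x : hα.ladders.Line × Bool)
    (i : ZMod (Function.minimalPeriod W.step (x, 0))) :
    W.state x (i + 1) = W.step (W.state x i) := iterate_val_succ _ _ i

theorem state_injective (x : hα.ladders.Line × Bool) : Function.Injective (W.state x) :=
  iterate_val_injective _ _

theorem state_le (x : hα.ladders.Line × Bool)
    (i : ZMod (Function.minimalPeriod W.step (x, 0))) :
    (W.state x i).2 ≤ W.height (W.state x i).1 := (W.step_iterate_mem x _).1

theorem state_mem (x : hα.ladders.Line × Bool)
    (i : ZMod (Function.minimalPeriod W.step (x, 0))) :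
    ∃ j, hα.nextLadder^[j] x = (W.state x i).1 := (W.step_iterate_mem x _).2

theorem exists_state (x : hα.ladders.Line × Bool) (j : ℕ) {r : ℕ}
    (hr : r ≤ W.height (hα.nextLadder^[j] x)) : ∃ i, W.state x i = (hα.nextLadder^[j] x, r) := by
  obtain ⟨k, -, hk⟩ := W.exists_step_iterate x j
  obtain ⟨i, hi⟩ := exists_iterate_val W.step (x, 0) (r + k)
  exact ⟨i, by rw [state, hi, Function.iterate_add_apply, hk, W.step_iterate hr]⟩

/-- Passing to the next ladder changes both its colour and the side of entry. Their product is
invariant along the orbit, so a ladder is always entered from the same side. -/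
theorem _root_.IdealTriangulation.IsVeering.nextLadder_iterate_ext (hα : K.IsVeering α)
    {x : hα.ladders.Line × Bool} {i j : ℕ}
    (h : (hα.nextLadder^[i] x).1 = (hα.nextLadder^[j] x).1) :
    hα.nextLadder^[i] x = hα.nextLadder^[j] x := by
  obtain ⟨ε, hε⟩ := hα.exists_coloring
  have key : ∀ i, ε (hα.nextLadder^[i] x).1 * (if (hα.nextLadder^[i] x).2 then 1 else -1) =
      ε x.1 * (if x.2 then 1 else -1) := by
    intro i
    induction i with
    | zero => rfl
    | succ i ih =>
      rw [← ih, Function.iterate_succ_apply']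
      set y := hα.nextLadder^[i] x
      change ε (hα.ladders.flipLine (!y.2) y.1) * (if !y.2 then 1 else -1) = _
      rw [hε.flipLine]
      cases y.2 <;> simp
  refine Prod.ext h ?_
  have h1 := (key i).trans (key j).symm
  rw [h] at h1
  rcases hε.eq_or (hα.nextLadder^[j] x).1 with h2 | h2 <;> rw [h2] at h1 <;>
    cases h3 : (hα.nextLadder^[i] x).2 <;> cases h4 : (hα.nextLadder^[j] x).2 <;>
    rw [h3, h4] at h1 <;> simp at h1 ⊢

/-- The closed curve that follows a walk. -/
def curve (x : hα.ladders.Line × Bool) : K.NormalCurve where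
  len := Function.minimalPeriod W.step (x, 0)
  len_ne_zero := inferInstance
  corner i := W.cutCorner (W.state x i)
  left i := W.turnsLeft (W.state x i)
  pos i := W.entryPos (W.state x i)
  glued i := by
    rw [exitSide_eq, entrySide_eq, state_succ, cross_exitSide _ (W.state_le x i)]
  nested i j hij h := by
    have h1 := W.state_le x i
    have h2 := W.state_le x j
    have ht := congrArg hα.top h
    rw [top_cutCorner, top_cutCorner] at ht
    -- Two states in one triangle belong to one ladder, hence to one passage through it, where
    -- `LadderWalk.nested` compares them.
    obtain ⟨a, ha⟩ := W.state_mem x i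
    obtain ⟨b, hb⟩ := W.state_mem x j
    have hl : (W.state x i).1 = (W.state x j).1 := by
      rw [← ha, ← hb]
      refine hα.nextLadder_iterate_ext ?_
      rw [ha, hb, ← line_tri, ← line_tri, ht]
    have hne := (W.state_injective x).ne hij
    have key : ∀ p q : W.State, p.2 ≤ W.height p.1 → q.2 ≤ W.height q.1 → p.1 = q.1 → p ≠ q →
        W.cutCorner p = W.cutCorner q →
        (W.outPos p < W.outPos q ∧ W.inPos p < W.inPos q) ∨
        (W.outPos q < W.outPos p ∧ W.inPos q < W.inPos p) := by
      rintro ⟨y, r⟩ ⟨y', r'⟩ hr hr' rfl hne h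
      rcases lt_trichotomy r r' with hlt | rfl | hlt
      · exact W.nested hr hr' hlt h
      · exact absurd rfl hne
      · exact (W.nested hr' hr hlt h.symm).symm
    have := key _ _ h1 h2 hl hne h
    simpa only [outDist, inDist, outPos, inPos, state_succ] using this
  separated i j h := by
    have h1 := W.state_le x i
    have h2 := W.state_le x j
    have ht := congrArg hα.top h
    rw [hα.top_ccw, top_cutCorner, top_cutCorner] at ht
    obtain ⟨a, ha⟩ := W.state_mem x i
    obtain ⟨b, hb⟩ := W.state_mem x j
    have hl : (W.state x i).1 = (W.state x j).1 := by
      rw [← ha, ← hb]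
      refine hα.nextLadder_iterate_ext ?_
      rw [ha, hb, ← line_tri, ← line_tri, ht]
    have key : ∀ p q : W.State, p.2 ≤ W.height p.1 → q.2 ≤ W.height q.1 → p.1 = q.1 →
        W.cutCorner q = K.ccw (W.cutCorner p) → W.outPos p < - W.inPos q := by
      rintro ⟨y, r⟩ ⟨y', r'⟩ hr hr' rfl h
      exact W.separated hr hr' h
    have := key _ _ h1 h2 hl h
    simpa only [outDist, inDist, outPos, inPos, state_succ] using this

theorem curve_entry (x : hα.ladders.Line × Bool) (i) :
    (W.curve x).entry i = W.entrySide (W.state x i) := W.entrySide_eq _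

theorem curve_exit (x : hα.ladders.Line × Bool) (i) :
    (W.curve x).exit i = W.exitSide (W.state x i) := W.exitSide_eq _

end LadderWalk

end IdealTriangulation
end

/-! ### Sums along orbits, and the core classes of the ladders. -/

noncomputable section

theorem sum_iterate_minimalPeriod {X M : Type*} [Fintype X] [AddCommMonoid M] (f : Equiv.Perm X)
    (x : X) (F : X → M) [DecidablePred (f.SameCycle x)] :
    ∑ r ∈ Finset.range (Function.minimalPeriod f x), F (f^[r] x) =
      ∑ y with f.SameCycle x y, F y := by
  refine Finset.sum_bij (fun r _ => f^[r] x) ?_ ?_ ?_ fun _ _ => rfl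
  · intro r _
    rw [Finset.mem_filter]
    exact ⟨Finset.mem_univ _, r, by rw [zpow_natCast, Equiv.Perm.coe_pow]⟩
  · intro r hr s hs h
    exact Function.iterate_injOn_Iio_minimalPeriod (Finset.mem_range.1 hr) (Finset.mem_range.1 hs) h
  · intro y hy
    obtain ⟨m, rfl⟩ := (Finset.mem_filter.1 hy).2.exists_nat_pow_eq
    have hpos : 0 < Function.minimalPeriod f x := by
      refine Function.minimalPeriod_pos_of_mem_periodicPts ?_
      exact Function.Injective.mem_periodicPts f.injective x
    exact ⟨m % Function.minimalPeriod f x, Finset.mem_range.2 (Nat.mod_lt _ hpos),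
      by rw [Function.iterate_mod_minimalPeriod_eq, Equiv.Perm.coe_pow]⟩

theorem sum_iterate_add_minimalPeriod {X M : Type*} [Fintype X] [AddCommMonoid M]
    (f : Equiv.Perm X) (x : X) (F : X → M) [DecidablePred (f.SameCycle x)] (m n : ℕ) :
    ∑ r ∈ Finset.range (m + n * Function.minimalPeriod f x), F (f^[r] x) =
      ∑ r ∈ Finset.range m, F (f^[r] x) + n • ∑ y with f.SameCycle x y, F y := by
  classical
  induction n with
  | zero => simp
  | succ n ih =>
    have h : m + (n + 1) * Function.minimalPeriod f x =
        m + n * Function.minimalPeriod f x + Function.minimalPeriod f x := by ring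
    rw [h, Finset.sum_range_add, ih, succ_nsmul, add_assoc]
    congr 2
    set k := m + n * Function.minimalPeriod f x
    have h1 := sum_iterate_minimalPeriod f (f^[k] x) F
    rw [Function.minimalPeriod_apply_iterate
      (Function.Injective.mem_periodicPts f.injective x)] at h1
    simp only [add_comm k, Function.iterate_add_apply]
    rw [h1]
    refine Finset.sum_congr (Finset.filter_congr fun y _ => ?_) fun _ _ => rfl
    rw [← Equiv.Perm.coe_pow]
    exact Equiv.Perm.sameCycle_pow_left

namespace IdealTriangulation
variable {ι : Type*} [Fintype ι] {K : IdealTriangulation ι} {α : ι → Fin 3 → ℝ}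

/-! ### Classes of curves in ladders -/

open Classical in
/-- The cycle running up once along a ladder. -/
def IsVeering.coreChain (hα : K.IsVeering α) (A : hα.ladders.Line) : K.Corner → ℤ :=
  hα.ofSides (fun p => if hα.ladders.line p = A then -1 else 0)
    (fun p => if hα.ladders.line p = A then 1 else 0) 0

open Classical in
theorem IsVeering.coreChain_wide (hα : K.IsVeering α) (A : hα.ladders.Line) (p : K.Wide α) :
    hα.coreChain A p = if hα.ladders.line p = A then -1 else 0 := hα.ofSides_wide _ _ _ p

open Classical in
theorem IsVeering.coreChain_upper (hα : K.IsVeering α) (A : hα.ladders.Line) (p : K.Wide α) :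
    hα.coreChain A (K.upper α p) = if hα.ladders.line p = A then 1 else 0 :=
  hα.ofSides_upper _ _ _ p

theorem IsVeering.coreChain_pole (hα : K.IsVeering α) (A : hα.ladders.Line) (p : K.Wide α) :
    hα.coreChain A (K.pole α p) = 0 := hα.ofSides_pole _ _ _ p

theorem IsVeering.mem_cycles (hα : K.IsVeering α) {z : K.Corner → ℤ}
    (h1 : ∀ p : K.Wide α, z (K.upper α p) = - z (hα.up p))
    (h2 : ∀ p : K.Wide α, z (K.pole α (hα.flip p)) = - z (K.pole α p))
    (h3 : ∀ p : K.Wide α, z p + z (K.upper α p) + z (K.pole α p) = 0) : z ∈ K.cycles :=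
  ⟨hα.cross_of_sides h1 h2, fun d => by rw [ccw_ccw, hα.sum_triangle, h3]⟩

theorem IsVeering.coreChain_mem (hα : K.IsVeering α) (A : hα.ladders.Line) :
    hα.coreChain A ∈ K.cycles := by
  refine hα.mem_cycles (fun p => ?_) (fun p => ?_) fun p => ?_
  · rw [hα.coreChain_upper, hα.coreChain_wide, hα.line_up]; split_ifs <;> rfl
  · rw [hα.coreChain_pole, hα.coreChain_pole, neg_zero]
  · rw [hα.coreChain_upper, hα.coreChain_wide, hα.coreChain_pole]; split_ifs <;> rfl

/-- The class of the core curve of a ladder. -/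
def IsVeering.coreClass (hα : K.IsVeering α) (A : hα.ladders.Line) : K.H1 :=
  QuotientAddGroup.mk ⟨hα.coreChain A, hα.coreChain_mem A⟩

open Classical in
/-- A function of the ladderpoles determines a function of the vertices. -/
theorem IsVeering.ofPoles_rot (hα : K.IsVeering α) {X : Type*} {g : Bool → hα.ladders.Line → X}
    (hg : ∀ b A, g b (hα.ladders.flipLine b A) = g b A) (c : K.Corner) :
    g (decide (K.LeftVeering α (K.rot c))) (hα.ladders.line (hα.top (K.rot c))) =
      g (decide (K.LeftVeering α c)) (hα.ladders.line (hα.top c)) := by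
  have h1 : K.LeftVeering α (K.rot c) ↔ K.LeftVeering α c :=
    leftVeering_congr (sameCycle_rot c).symm
  have h2 : hα.top (K.rot c) = hα.top (K.cross (K.ccw c)) := by rw [rot_apply, hα.top_ccw]
  rw [decide_eq_decide.2 h1, h2, ← hα.top_ccw c]
  rcases hα.side_cases (K.ccw c) with h | h | h
  · conv_lhs => rw [h]
    rw [hα.cross_wide, hα.top_upper]
    congr 1
    exact hα.ladders.line_up_symm _
  · conv_lhs => rw [h]
    rw [hα.cross_upper, hα.top_of_wide, hα.line_up]
  · conv_lhs => rw [h]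
    rw [hα.cross_pole_flip, hα.top_pole]
    set p := hα.top (K.ccw c) with hp
    have h3 : c = K.ccw.symm (K.pole α p) := by rw [← h, Equiv.symm_apply_apply]
    have h4 : K.LeftVeering α c ↔ K.LeftVeering α p := by
      rw [h3]
      by_cases hl : K.LeftVeering α p
      · rw [pole_of_left hl, ccw_symm_symm]
        exact iff_of_true (hα.left_ccw p.2) hl
      · rw [pole_of_not_left hl, Equiv.symm_apply_apply]
    have h5 := hα.ladders.flipLine_line (b := decide (K.LeftVeering α c)) (s := p)
      (h4.symm.trans decide_eq_true_iff.symm)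
    change g _ (hα.ladders.line (hα.ladders.flip p)) = _
    rw [← h5, hg]

-- Every vertex lies on one ladderpole, given by a ladder beside it and the direction in which the
-- vertex veers. The hypothesis `hg` says that the value is the same from both sides of the
-- ladderpole.
open Classical in
theorem IsVeering.mem_boundaries (hα : K.IsVeering α) {g : Bool → hα.ladders.Line → ℤ}
    (hg : ∀ b A, g b (hα.ladders.flipLine b A) = g b A) {z : K.Corner → ℤ}
    (h1 : ∀ p : K.Wide α, z p = g false (hα.ladders.line p) - g true (hα.ladders.line p))
    (h2 : ∀ p : K.Wide α, z (K.upper α p) =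
      g true (hα.ladders.line p) - g false (hα.ladders.line p))
    (h3 : ∀ p : K.Wide α, z (K.pole α p) = 0) : z ∈ K.boundaries := by
  refine ⟨fun c => g (decide (K.LeftVeering α c)) (hα.ladders.line (hα.top c)),
    hα.ofPoles_rot hg, fun d => ?_⟩
  simp only [hα.top_ccw, hα.top_ccw_symm]
  have l1 := hα.left_ccw (hα.top d).2
  have l2 := hα.not_left_ccw_symm (hα.top d).2
  have key : ∀ e : K.Corner, e = d → hα.top e = hα.top d := fun e he => by rw [he]
  rcases hα.side_cases d with h | h | h
  · have hz : z d = z (hα.top d) := by rw [← h]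
    have e1 : K.LeftVeering α (K.ccw d) := by rw [h]; exact l1
    have e2 : ¬ K.LeftVeering α (K.ccw.symm d) := by rw [h]; exact l2
    rw [hz, h1, decide_eq_true e1, decide_eq_false e2]
  · have hz : z d = z (K.upper α (hα.top d)) := by rw [← h]
    by_cases hl : K.LeftVeering α (hα.top d)
    · have hu := upper_of_left hl
      have e1 : ¬ K.LeftVeering α (K.ccw d) := by rw [h, hu, ccw_ccw]; exact l2
      have e2 : K.LeftVeering α (K.ccw.symm d) := by rw [h, hu, Equiv.symm_apply_apply]; exact hl
      rw [hz, h2, decide_eq_false e1, decide_eq_true e2]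
    · have hu := upper_of_not_left hl
      have e1 : ¬ K.LeftVeering α (K.ccw d) := by rw [h, hu, Equiv.apply_symm_apply]; exact hl
      have e2 : K.LeftVeering α (K.ccw.symm d) := by rw [h, hu, ccw_symm_symm]; exact l1
      rw [hz, h2, decide_eq_false e1, decide_eq_true e2]
  · have hz : z d = z (K.pole α (hα.top d)) := by rw [← h]
    by_cases hl : K.LeftVeering α (hα.top d)
    · have hu := pole_of_left hl
      have e1 : K.LeftVeering α (K.ccw d) := by rw [h, hu, Equiv.apply_symm_apply]; exact hl
      have e2 : K.LeftVeering α (K.ccw.symm d) := by rw [h, hu, ccw_symm_symm]; exact l1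
      rw [hz, h3, decide_eq_true e1, decide_eq_true e2, sub_self]
    · have hu := pole_of_not_left hl
      have e1 : ¬ K.LeftVeering α (K.ccw d) := by rw [h, hu, ccw_ccw]; exact l2
      have e2 : ¬ K.LeftVeering α (K.ccw.symm d) := by rw [h, hu, Equiv.symm_apply_apply]; exact hl
      rw [hz, h3, decide_eq_false e1, decide_eq_false e2, sub_self]

/-- Adjacent ladders run in opposite directions. Their core curves together bound the union of the
dual cells of the vertices on the ladderpole between them, so the witness `g` is, up to sign, the
indicator of this ladderpole. -/
theorem IsVeering.coreClass_flipLine (hα : K.IsVeering α) (b : Bool) (A : hα.ladders.Line) :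
    hα.coreClass (hα.ladders.flipLine b A) = - hα.coreClass A := by
  classical
  set B := hα.ladders.flipLine b A with hB
  have hne : B ≠ A := hα.flipLine_ne b A
  rw [eq_neg_iff_add_eq_zero]
  refine (QuotientAddGroup.eq_zero_iff _).2 ?_
  change hα.coreChain B + hα.coreChain A ∈ K.boundaries
  refine hα.mem_boundaries (g := fun b' C => if b' = b ∧ (C = A ∨ C = B) then
    (if b then 1 else -1) else 0) ?_ ?_ ?_ ?_
  · intro b' C
    by_cases hb : b' = b
    · subst hb
      have h1 : (hα.ladders.flipLine b' C = A ∨ hα.ladders.flipLine b' C = B) ↔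
          (C = A ∨ C = B) := by
        constructor
        · rintro (h | h)
          · right; rw [hB, ← h, LadderSystem.flipLine_flipLine]
          · left
            rw [← hα.ladders.flipLine_flipLine b' C, h, hB, LadderSystem.flipLine_flipLine]
        · rintro (rfl | h)
          · right; rfl
          · left; rw [h, hB, LadderSystem.flipLine_flipLine]
      simp only [h1]
    · simp only [hb, false_and]
  · intro p
    rw [Pi.add_apply, hα.coreChain_wide, hα.coreChain_wide]
    by_cases h1 : hα.ladders.line p = A <;> by_cases h2 : hα.ladders.line p = B
    · exact absurd (h2.symm.trans h1) hne
    all_goals cases b <;> simp [h1, h2, hne.symm, hne]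
  · intro p
    rw [Pi.add_apply, hα.coreChain_upper, hα.coreChain_upper]
    by_cases h1 : hα.ladders.line p = A <;> by_cases h2 : hα.ladders.line p = B
    · exact absurd (h2.symm.trans h1) hne
    all_goals cases b <;> simp [h1, h2, hne.symm, hne]
  · intro p
    rw [Pi.add_apply, hα.coreChain_pole, hα.coreChain_pole, add_zero]

/-- A cycle that stays in a ladder is a multiple of its core curve. -/
theorem IsVeering.exists_eq_smul_coreChain (hα : K.IsVeering α) {z : K.Corner → ℤ}
    (hz : z ∈ K.cycles) (A : hα.ladders.Line) (h1 : ∀ p : K.Wide α, z (K.pole α p) = 0)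
    (h2 : ∀ p : K.Wide α, hα.ladders.line p ≠ A → z p = 0) :
    ∃ m : ℤ, z = m • hα.coreChain A := by
  classical
  have h3 : ∀ p : K.Wide α, z p + z (K.upper α p) = 0 := by
    intro p
    have := hα.sum_triangle z p
    have h4 := hz.2 p
    rw [ccw_ccw] at h4
    rw [h4, hα.top_of_wide, h1, add_zero] at this
    exact this.symm
  have h4 : ∀ p : K.Wide α, z (hα.up p) = z p := by
    intro p
    have := hz.1 (K.upper α p)
    rw [hα.cross_upper] at this
    linarith [h3 p]
  obtain ⟨q, hq⟩ := hα.ladders.exists_line A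
  have h5 : ∀ p : K.Wide α, hα.ladders.line p = A → z p = z q := by
    intro p hp
    have h6 : hα.up.SameCycle q p := hα.ladders.line_eq_iff.1 (hq.trans hp.symm)
    obtain ⟨m, rfl⟩ := h6.exists_nat_pow_eq
    clear h6 hp
    induction m with
    | zero => rfl
    | succ m ih => rw [pow_succ', Equiv.Perm.mul_apply, h4, ih]
  have h6 : ∀ p : K.Wide α, z p = (- z q) * hα.coreChain A p := by
    intro p
    rw [hα.coreChain_wide]
    split_ifs with h
    · rw [h5 p h]; ring
    · rw [h2 p h]; ring
  refine ⟨- z q, funext fun d => ?_⟩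
  rw [Pi.smul_apply, smul_eq_mul]
  rcases hα.side_cases d with h | h | h <;> rw [h]
  · exact h6 _
  · have h7 := h3 (hα.top d)
    rw [h6, hα.coreChain_wide] at h7
    rw [hα.coreChain_upper]
    split_ifs at h7 ⊢ <;> linarith
  · rw [h1, hα.coreChain_pole, mul_zero]

end IdealTriangulation
end

/-! ### Homology classes of ladder curves and of walks. -/

noncomputable section
namespace IdealTriangulation
variable {ι : Type*} [Fintype ι] {K : IdealTriangulation ι} {α : ι → Fin 3 → ℝ}

namespace NormalCurve

theorem cuspOf_corner_succ (γ : K.NormalCurve) (i : ZMod γ.len) :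
    K.cuspOf (γ.corner (i + 1)) = K.cuspOf (γ.corner i) := by
  have h1 : K.cuspOf (γ.entry (i + 1)) = K.cuspOf (γ.corner (i + 1)) := by
    rw [entry]; split_ifs
    exacts [cuspOf_ccw_symm _, cuspOf_ccw _]
  have h2 : K.cuspOf (γ.exit i) = K.cuspOf (γ.corner i) := by
    rw [exit]; split_ifs
    exacts [cuspOf_ccw _, cuspOf_ccw_symm _]
  rw [← h1, γ.entry_succ, cuspOf_cross, h2]

theorem eq_of_succ (γ : K.NormalCurve) {X : Type*} {f : ZMod γ.len → X}
    (h : ∀ i, f (i + 1) = f i) (i : ZMod γ.len) : f i = f 0 := by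
  obtain ⟨n, rfl⟩ := ZMod.natCast_zmod_surjective i
  induction n with
  | zero => rw [Nat.cast_zero]
  | succ n ih => rw [Nat.cast_succ, h, ih]

/-- The chain of a curve is supported on the sides of the triangles it meets. -/
theorem chain_eq_zero (γ : K.NormalCurve) {d : K.Corner} (h1 : ∀ i, γ.exit i ≠ d)
    (h2 : ∀ i, γ.entry i ≠ d) : γ.chain d = 0 := by
  classical
  rw [chain]
  exact Finset.sum_eq_zero fun i _ => by rw [if_neg (h1 i), if_neg (h2 i), sub_zero]

theorem homologyClass_mem (γ : K.NormalCurve) :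
    γ.homologyClass ∈ K.cuspH1 (K.cuspOf (γ.corner 0)) := by
  have hc : ∀ i, K.cuspOf (γ.corner i) = K.cuspOf (γ.corner 0) :=
    γ.eq_of_succ γ.cuspOf_corner_succ
  refine ⟨⟨γ.chain, γ.chain_mem⟩, fun d hd => γ.chain_eq_zero (fun i h => hd ?_)
    fun i h => hd ?_, rfl⟩
  · rw [← hc i, ← h, exit]
    split_ifs
    exacts [cuspOf_ccw _, cuspOf_ccw_symm _]
  · rw [← hc i, ← h, entry]
    split_ifs
    exacts [cuspOf_ccw_symm _, cuspOf_ccw _]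

end NormalCurve

/-- The class of a ladder curve is a multiple of the class of the core curve of a ladder. -/
theorem IsLadderCurve.exists_eq_smul_coreClass (hα : K.IsVeering α) {T : K.Cusp}
    {γ : K.NormalCurve} (hγ : K.IsLadderCurve α T γ) :
    ∃ (A : hα.ladders.Line) (m : ℤ), hα.cuspOfLine A = T ∧
      γ.homologyClass = m • hα.coreClass A := by
  have hpole : ∀ i p, γ.entry i ≠ K.pole α (p : K.Wide α) := fun i p h =>
    hα.not_isRung_pole p (h ▸ (hγ i).2)
  have hpole' : ∀ i p, γ.exit i ≠ K.pole α (p : K.Wide α) := fun i p h => by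
    refine hpole (i + 1) (hα.flip p) ?_
    rw [γ.entry_succ, h, hα.cross_pole_flip]
  have hline : ∀ i, hα.ladders.line (hα.top (γ.corner i)) =
      hα.ladders.line (hα.top (γ.corner 0)) := by
    refine γ.eq_of_succ fun i => ?_
    rw [← γ.top_entry hα, ← γ.top_exit hα, γ.entry_succ]
    rcases hα.side_cases (γ.exit i) with h | h | h
    · conv_lhs => rw [h]
      rw [hα.cross_wide, hα.top_upper]
      exact hα.ladders.line_up_symm _
    · conv_lhs => rw [h]
      rw [hα.cross_upper, hα.top_of_wide, hα.line_up]
    · exact absurd h (hpole' i _)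
  have hex : ∀ i (p : K.Wide α), γ.exit i = p →
      hα.ladders.line p = hα.ladders.line (hα.top (γ.corner 0)) := fun i p h => by
    rw [← hline i, ← γ.top_exit hα, h, hα.top_of_wide]
  have hen : ∀ i (p : K.Wide α), γ.entry i = p →
      hα.ladders.line p = hα.ladders.line (hα.top (γ.corner 0)) := fun i p h => by
    rw [← hline i, ← γ.top_entry hα, h, hα.top_of_wide]
  obtain ⟨m, hm⟩ := hα.exists_eq_smul_coreChain γ.chain_mem
    (hα.ladders.line (hα.top (γ.corner 0)))
    (fun p => γ.chain_eq_zero (fun i => hpole' i p) fun i => hpole i p)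
    (fun p hp => γ.chain_eq_zero (fun i h => hp (hex i p h)) fun i h => hp (hen i p h))
  refine ⟨_, m, ?_, congrArg QuotientAddGroup.mk (Subtype.ext hm)⟩
  rw [hα.cuspOfLine_line, hα.cuspOf_top, (hγ 0).1]

theorem IsVeering.crossingHom_coreClass (hα : K.IsVeering α) (A B : hα.ladders.Line) :
    hα.crossingHom A (hα.coreClass B) = 0 := by
  change hα.crossing A (hα.coreChain B) = 0
  rw [crossing, neg_eq_zero]
  exact Finset.sum_eq_zero fun p _ => hα.coreChain_pole B p

namespace LadderWalk

variable {hα : K.IsVeering α} (W : LadderWalk hα)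

/-- The ladders met by a walk. -/
def orbit (x : hα.ladders.Line × Bool) : Finset (hα.ladders.Line × Bool) :=
  (Set.toFinite {y | ∃ j, hα.nextLadder^[j] x = y}).toFinset

theorem mem_orbit {x y : hα.ladders.Line × Bool} :
    y ∈ orbit x ↔ ∃ j, hα.nextLadder^[j] x = y := by simp [orbit]

theorem sum_state (x : hα.ladders.Line × Bool) {M : Type*} [AddCommMonoid M] (F : W.State → M) :
    ∑ i, F (W.state x i) =
      ∑ y ∈ orbit x, ∑ r ∈ Finset.range (W.height y + 1), F (y, r) := by
  classical
  rw [Finset.sum_sigma']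
  refine Finset.sum_bij (fun i _ => ⟨(W.state x i).1, (W.state x i).2⟩) ?_ ?_ ?_ ?_
  · intro i _
    rw [Finset.mem_sigma]
    exact ⟨mem_orbit.2 (W.state_mem x i), Finset.mem_range.2 (Nat.lt_succ_of_le (W.state_le x i))⟩
  · intro i _ j _ h
    refine W.state_injective x ?_
    rw [Sigma.mk.injEq] at h
    exact Prod.ext h.1 (eq_of_heq h.2)
  · rintro ⟨y, r⟩ h
    obtain ⟨h1, h2⟩ := Finset.mem_sigma.1 h
    obtain ⟨j, rfl⟩ := mem_orbit.1 h1
    obtain ⟨i, hi⟩ := W.exists_state x j (Nat.lt_succ_iff.1 (Finset.mem_range.1 h2))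
    exact ⟨i, Finset.mem_univ _, by rw [hi]⟩
  · intro i _; rfl

open Classical in
/-- The chain of the part of a walk in one ladder. -/
def run (y : hα.ladders.Line × Bool) (d : K.Corner) : ℤ :=
  ((if K.pole α (W.tri (y, W.height y)) = d then 1 else 0) -
    if K.pole α (W.first y) = d then 1 else 0) +
  ∑ r ∈ Finset.range (W.height y), ((if K.upper α (W.tri (y, r)) = d then 1 else 0) -
    if (W.tri (y, r + 1) : K.Corner) = d then 1 else 0)

theorem chain_curve (x : hα.ladders.Line × Bool) (d : K.Corner) :
    (W.curve x).chain d = ∑ y ∈ orbit x, W.run y d := by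
  classical
  rw [NormalCurve.chain]
  simp only [curve_exit, curve_entry]
  refine (W.sum_state x fun q => ((if W.exitSide q = d then (1 : ℤ) else 0) -
    if W.entrySide q = d then 1 else 0)).trans (Finset.sum_congr rfl fun y _ => ?_)
  rw [Finset.sum_sub_distrib, Finset.sum_range_succ, Finset.sum_range_succ', run,
    Finset.sum_sub_distrib]
  have h1 : W.exitSide (y, W.height y) = K.pole α (W.tri (y, W.height y)) := if_neg (lt_irrefl _)
  have h2 : W.entrySide (y, 0) = K.pole α (W.first y) := if_pos rfl
  have h3 : ∀ r ∈ Finset.range (W.height y), (if W.exitSide (y, r) = d then (1 : ℤ) else 0) =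
      if K.upper α (W.tri (y, r)) = d then 1 else 0 := fun r hr => by
    have h5 : W.exitSide (y, r) = K.upper α (W.tri (y, r)) := if_pos (Finset.mem_range.1 hr)
    rw [h5]
  have h4 : ∀ r, W.entrySide (y, r + 1) = W.tri (y, r + 1) := fun r => if_neg (Nat.succ_ne_zero r)
  rw [h1, h2, Finset.sum_congr rfl h3]
  simp only [h4]
  ring

open Classical in
theorem run_pole (y : hα.ladders.Line × Bool) (p : K.Wide α) : W.run y (K.pole α p) =
    (if W.tri (y, W.height y) = p then 1 else 0) - if W.first y = p then 1 else 0 := by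
  have hinj : ∀ q : K.Wide α, K.pole α q = K.pole α p ↔ q = p := fun q =>
    ⟨fun h => by rw [← hα.top_pole q, h, hα.top_pole], fun h => by rw [h]⟩
  rw [run]
  simp only [hinj]
  rw [Finset.sum_eq_zero, add_zero]
  intro r _
  rw [if_neg, if_neg, sub_zero]
  · intro h
    have h1 := congrArg hα.top h
    rw [hα.top_of_wide, hα.top_pole] at h1
    rw [h1] at h
    exact (upper_ne p).2.1 h.symm
  · intro h
    have h1 := congrArg hα.top h
    rw [hα.top_upper, hα.top_pole] at h1
    rw [h1] at h
    exact (upper_ne p).2.2 h.symm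

theorem self_mem_orbit (x : hα.ladders.Line × Bool) : x ∈ orbit x := mem_orbit.2 ⟨0, rfl⟩

theorem eq_of_mem_orbit {x y : hα.ladders.Line × Bool} (hy : y ∈ orbit x) (h : y.1 = x.1) :
    y = x := by
  obtain ⟨j, rfl⟩ := mem_orbit.1 hy
  exact hα.nextLadder_iterate_ext (j := 0) h

/-- The walk passes through `A` once in its period, entering by the left side; its passages through
other ladders do not touch the left segments of `A`. -/
theorem crossingHom_curve (A : hα.ladders.Line) :
    hα.crossingHom A (W.curve (A, true)).homologyClass = 1 := by
  classical
  rw [hα.crossingHom_curve, IsVeering.crossing]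
  have h1 : ∀ p : K.Wide α, (W.curve (A, true)).chain (K.pole α p) = ∑ y ∈ orbit (A, true),
      ((if W.tri (y, W.height y) = p then 1 else 0) - if W.first y = p then 1 else 0) := by
    intro p
    rw [chain_curve]
    exact Finset.sum_congr rfl fun y _ => W.run_pole y p
  simp only [h1]
  rw [Finset.sum_comm, Finset.sum_eq_single_of_mem _ (self_mem_orbit (A, true))]
  · rw [Finset.sum_sub_distrib, Finset.sum_ite_eq, Finset.sum_ite_eq, if_neg, if_pos]
    · rfl
    · rw [Finset.mem_filter]
      exact ⟨Finset.mem_univ _, W.line_first _, (W.left_first _).2 rfl⟩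
    · rw [Finset.mem_filter]
      rintro ⟨-, -, h⟩
      exact Bool.noConfusion ((W.left_tri_height _).1 h)
  · intro y hy hne
    refine Finset.sum_eq_zero fun p hp => ?_
    have hp' := (Finset.mem_filter.1 hp).2.1
    have hy1 : y.1 ≠ A := fun h => hne (eq_of_mem_orbit hy h)
    rw [if_neg, if_neg, sub_zero]
    · rintro rfl
      exact hy1 ((W.line_first y).symm.trans hp')
    · rintro rfl
      exact hy1 ((W.line_tri _).symm.trans hp')

/-- A walk with additional turns in the ladders. -/
def addTurns (t : hα.ladders.Line × Bool → ℕ) : LadderWalk hα where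
  first := W.first
  line_first := W.line_first
  left_first := W.left_first
  height x := W.height x + t x * Function.minimalPeriod hα.up (W.first x)
  up_height x := by
    rw [pow_add, mul_comm, pow_mul, Equiv.Perm.mul_apply, ← W.up_height]
    congr 1
    have h1 : ∀ n : ℕ, ((hα.up ^ Function.minimalPeriod hα.up (W.first x)) ^ n) (W.first x) =
        W.first x := by
      intro n
      rw [← pow_mul, Equiv.Perm.coe_pow]
      exact (Function.isPeriodicPt_minimalPeriod _ _).mul_const n
    exact h1 _

open Classical in
theorem sum_line_coreChain (A : hα.ladders.Line) (d : K.Corner) :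
    ∑ q : K.Wide α with hα.ladders.line q = A, ((if K.upper α q = d then (1 : ℤ) else 0) -
      if (hα.up q : K.Corner) = d then 1 else 0) = hα.coreChain A d := by
  have hw : ∀ q p : K.Wide α, (q : K.Corner) = p ↔ q = p := fun q p => Subtype.coe_inj
  rcases hα.side_cases d with h | h | h <;> rw [h] <;> generalize hα.top d = p
  · rw [hα.coreChain_wide, Finset.sum_congr rfl (g := fun q => if q = hα.up.symm p then (-1 : ℤ) else 0),
      Finset.sum_ite_eq']
    · refine if_congr ?_ rfl rfl
      rw [Finset.mem_filter]
      have : hα.ladders.line (hα.up.symm p) = hα.ladders.line p := hα.ladders.line_up_symm p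
      rw [this]
      simp
    · intro q _
      simp only [hw]
      rw [if_neg, zero_sub]
      · by_cases hq : q = hα.up.symm p
        · rw [if_pos hq, if_pos (by rw [hq, Equiv.apply_symm_apply])]
        · rw [if_neg hq, if_neg, neg_zero]
          intro h; exact hq (by rw [← h, Equiv.symm_apply_apply])
      · intro h
        have h1 := congrArg hα.top h
        rw [hα.top_of_wide, hα.top_upper] at h1
        rw [h1] at h
        exact (upper_ne p).1 h
  · rw [hα.coreChain_upper, Finset.sum_congr rfl (g := fun q => if q = p then (1 : ℤ) else 0),
      Finset.sum_ite_eq']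
    · refine if_congr ?_ rfl rfl
      simp
    · intro q _
      have h1 : K.upper α q = K.upper α p ↔ q = p :=
        ⟨fun h => by rw [← hα.top_upper q, h, hα.top_upper], fun h => by rw [h]⟩
      have h2 : (hα.up q : K.Corner) ≠ K.upper α p := by
        intro h
        have h1 := congrArg hα.top h
        rw [hα.top_of_wide, hα.top_upper] at h1
        rw [h1] at h
        exact (upper_ne p).1 h.symm
      rw [if_neg h2, sub_zero]
      exact if_congr h1 rfl rfl
  · rw [hα.coreChain_pole]
    refine Finset.sum_eq_zero fun q _ => ?_
    rw [if_neg, if_neg, sub_zero]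
    · intro h
      have h1 := congrArg hα.top h
      rw [hα.top_of_wide, hα.top_pole] at h1
      rw [h1] at h
      exact (upper_ne p).2.1 h.symm
    · intro h
      have h1 := congrArg hα.top h
      rw [hα.top_upper, hα.top_pole] at h1
      rw [h1] at h
      exact (upper_ne p).2.2 h.symm

theorem run_addTurns (t : hα.ladders.Line × Bool → ℕ) (y : hα.ladders.Line × Bool)
    (d : K.Corner) : (W.addTurns t).run y d = W.run y d + t y * hα.coreChain y.1 d := by
  classical
  have h0 : (W.addTurns t).tri (y, (W.addTurns t).height y) = W.tri (y, W.height y) :=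
    ((W.addTurns t).up_height y).trans (W.up_height y).symm
  have h1 : (W.addTurns t).first y = W.first y := rfl
  have h2 : (W.addTurns t).height y =
    W.height y + t y * Function.minimalPeriod hα.up (W.first y) := rfl
  have h3 : ∀ r, (W.addTurns t).tri (y, r) = W.tri (y, r) := fun r => rfl
  have h4 := sum_iterate_add_minimalPeriod hα.up (W.first y) (fun q =>
    ((if K.upper α q = d then (1 : ℤ) else 0) - if (hα.up q : K.Corner) = d then 1 else 0))
    (W.height y) (t y)
  have h5 : ∀ r, hα.up^[r] (W.first y) = W.tri (y, r) := fun r => by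
    rw [tri, Equiv.Perm.coe_pow]
  simp only [h5] at h4
  rw [run, run, h0, h1, h2]
  simp only [h3, tri_succ]
  rw [h4, ← sum_line_coreChain, nsmul_eq_mul, add_assoc]
  congr 3
  refine Finset.sum_congr (Finset.filter_congr fun q _ => ?_) fun _ _ => rfl
  rw [← W.line_first y, eq_comm]
  exact hα.ladders.line_eq_iff.symm

theorem homologyClass_addTurns (x : hα.ladders.Line × Bool) (t : hα.ladders.Line × Bool → ℕ) :
    ((W.addTurns t).curve x).homologyClass =
      (W.curve x).homologyClass + ∑ y ∈ orbit x, (t y : ℤ) • hα.coreClass y.1 := by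
  have h1 : ((W.addTurns t).curve x).chain =
      (W.curve x).chain + ∑ y ∈ orbit x, (t y : ℤ) • hα.coreChain y.1 := by
    funext d
    rw [Pi.add_apply, chain_curve, chain_curve, Finset.sum_apply, ← Finset.sum_add_distrib]
    exact Finset.sum_congr rfl fun y _ => by rw [run_addTurns]; simp
  have h2 : (⟨((W.addTurns t).curve x).chain, NormalCurve.chain_mem _⟩ : K.cycles) =
      ⟨(W.curve x).chain, NormalCurve.chain_mem _⟩ +
        ∑ y ∈ orbit x, (t y : ℤ) • ⟨hα.coreChain y.1, hα.coreChain_mem y.1⟩ := by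
    refine Subtype.ext ?_
    simp [h1]
  have h3 := congrArg (QuotientAddGroup.mk' (K.boundaries.addSubgroupOf K.cycles)) h2
  rw [map_add, map_sum] at h3
  simp only [map_zsmul] at h3
  exact h3

/-- The number of turns around a ladder can be prescribed. -/
theorem exists_curve_add_smul (A : hα.ladders.Line) (n : ℤ) : ∃ γ : K.NormalCurve,
    γ.homologyClass = (W.curve (A, true)).homologyClass + n • hα.coreClass A := by
  classical
  obtain ⟨m, rfl | rfl⟩ := n.eq_nat_or_neg
  · refine ⟨(W.addTurns (Pi.single (A, true) m)).curve (A, true), ?_⟩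
    rw [homologyClass_addTurns, Finset.sum_eq_single_of_mem _ (self_mem_orbit _),
      Pi.single_eq_same]
    intro y _ hy
    rw [Pi.single_eq_of_ne hy, Nat.cast_zero, zero_smul]
  -- Walks can only go up. Negative multiples are obtained by turning in the next ladder, whose core
  -- class is the opposite one.
  · refine ⟨(W.addTurns (Pi.single (hα.nextLadder (A, true)) m)).curve (A, true), ?_⟩
    rw [homologyClass_addTurns, Finset.sum_eq_single_of_mem (hα.nextLadder (A, true))
      (mem_orbit.2 ⟨1, rfl⟩), Pi.single_eq_same]
    · change _ + _ • hα.coreClass (hα.ladders.flipLine false A) = _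
      rw [hα.coreClass_flipLine, zsmul_neg, neg_zsmul]
    intro y _ hy
    rw [Pi.single_eq_of_ne hy, Nat.cast_zero, zero_smul]

end LadderWalk

/-- A complement of the slope of the ladders crosses a ladder of its cusp once, and is represented
by a normal curve. -/
theorem IsLadderComplement.exists_curve (hα : K.IsVeering α) {T : K.Cusp} {δ : K.H1}
    (hδ : K.IsLadderComplement α T δ) :
    ∃ (A : hα.ladders.Line) (γ : K.NormalCurve) (n : ℤ), hα.cuspOfLine A = T ∧
      (n = 1 ∨ n = -1) ∧ hα.crossingHom A δ = n ∧ γ.homologyClass ≠ 0 ∧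
      n • γ.homologyClass = δ := by
  obtain ⟨γ₀, hγ₀, -, hsup⟩ := hδ
  obtain ⟨A, m, hA, hm⟩ := hγ₀.exists_eq_smul_coreClass hα
  obtain ⟨W⟩ := hα.exists_ladderWalk
  have hκ := (W.curve (A, true)).homologyClass_mem
  have hT : K.cuspOf ((W.curve (A, true)).corner 0) = T := by
    have h1 : (W.curve (A, true)).corner 0 = W.cutCorner (W.state (A, true) 0) := rfl
    rw [h1, ← hα.cuspOf_top, W.top_cutCorner, ← hα.cuspOfLine_line, W.line_tri]
    have h2 : W.state (A, true) 0 = ((A, true), 0) := by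
      rw [LadderWalk.state, ZMod.val_zero]; rfl
    rw [h2, hA]
  rw [hT, ← hsup, AddSubgroup.mem_sup] at hκ
  obtain ⟨u, hu, v, hv, huv⟩ := hκ
  obtain ⟨a, rfl⟩ := AddSubgroup.mem_zmultiples_iff.1 hu
  obtain ⟨b, rfl⟩ := AddSubgroup.mem_zmultiples_iff.1 hv
  have h1 := W.crossingHom_curve A
  rw [← huv, map_add, hm, map_zsmul, map_zsmul, map_zsmul, hα.crossingHom_coreClass, smul_zero,
    smul_zero, zero_add, smul_eq_mul] at h1
  -- The walk has class `(a * m) • coreClass A + b • δ`, and removing the turns leaves `b • δ`.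
  -- Since the walk crosses `A` once and the core class does not, `b` times the crossing number of
  -- `δ` is `1`, so `b` is a sign.
  obtain ⟨γ, hγ⟩ := W.exists_curve_add_smul A (- (a * m))
  have h2 : γ.homologyClass = b • δ := by
    rw [hγ, ← huv, hm, smul_smul, neg_smul]
    abel
  have h3 : γ.homologyClass ≠ 0 := by
    intro h
    have h4 := congrArg (hα.crossingHom A) h2
    rw [h, map_zero, map_zsmul, smul_eq_mul, h1] at h4
    exact zero_ne_one h4
  rcases Int.eq_one_or_neg_one_of_mul_eq_one' h1 with ⟨rfl, h4⟩ | ⟨rfl, h4⟩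
  · exact ⟨A, γ, 1, hA, Or.inl rfl, h4, h3, by rw [h2, smul_smul]; simp⟩
  · exact ⟨A, γ, -1, hA, Or.inr rfl, h4, h3, by rw [h2, smul_smul]; simp⟩

end IdealTriangulation
end

noncomputable section
namespace IdealTriangulation
variable {ι : Type*} [Fintype ι] {K : IdealTriangulation ι} {α : ι → Fin 3 → ℝ}

/-! ### Deformations of a veering structure along its ladders -/

theorem angle_add (θ θ' : ι → Fin 3 → ℝ) (c : K.Corner) :
    K.angle (θ + θ') c = K.angle θ c + K.angle θ' c := rfl

theorem angle_relabel_klein (θ : ι → Fin 3 → ℝ) (c : K.Corner) {h : alternatingGroup (Fin 4)}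
    (hh : h = klein₁ ∨ h = klein₂ ∨ h = klein₃) : K.angle θ (K.relabel h c) = K.angle θ c :=
  congrArg (θ c.1) ((edgePair_klein c.2 h).2 (Or.inr hh))

theorem exists_edgePair (j : Fin 3) :
    ∃ g : alternatingGroup (Fin 4), edgePair (g.1 0) (g.1 1) = j := by
  revert j
  decide +kernel

/-- Weights of the ladders between `0` and `π / 4` define a nonnegative angle structure. -/
theorem IsVeering.isNonnegAngleStructure (hα : K.IsVeering α) {σ : hα.ladders.Line → ℝ}
    (h0 : ∀ A, 0 ≤ σ A) (h1 : ∀ A, σ A ≤ Real.pi / 4) :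
    K.IsNonnegAngleStructure (α + K.tetDeform (hα.ladderCycle σ)) := by
  classical
  have hw := hα.isRealCycle_ladderCycle σ
  refine ⟨⟨fun t => ?_, fun c => ?_⟩, fun t j => ?_⟩
  · simp only [Pi.add_apply]
    rw [Finset.sum_add_distrib, hα.1.1.1, hw.sum_tetDeform, add_zero]
  · simp only [angle_add]
    rw [Finset.sum_add_distrib]
    have h2 := hα.1.1.2 c
    have h3 := hw.sum_angle_sameCycle c
    rw [← add_zero (2 * Real.pi)]
    exact congrArg₂ (· + ·) h2 h3
  · obtain ⟨g, rfl⟩ := exists_edgePair j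
    change 0 ≤ K.angle (α + K.tetDeform (hα.ladderCycle σ)) (t, g)
    generalize (t, g) = c
    rw [angle_add, angle_tetDeform]
    have k1 := angle_relabel_klein (K := K) α c (Or.inl rfl : klein₁ = klein₁ ∨ _ ∨ _)
    have k2 := angle_relabel_klein (K := K) α c (Or.inr (Or.inl rfl) : klein₂ = klein₁ ∨ _ ∨ _)
    have k3 := angle_relabel_klein (K := K) α c (Or.inr (Or.inr rfl) : klein₃ = klein₁ ∨ _ ∨ _)
    -- The four corners over one pair of edges are all wide or all thin in `α`. Wide ones lose at
    -- most `π / 4` each from an angle `π`; thin ones lose nothing.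
    have lower : ∀ c, - (Real.pi / 4) ≤ hα.ladderCycle σ c := by
      intro c
      have hpi := Real.pi_pos
      rcases hα.side_cases c with h | h | h <;> rw [h]
      · rw [hα.ladderCycle_wide]; exact neg_le_neg (h1 _)
      · rw [hα.ladderCycle_upper]; linarith [h0 (hα.ladders.line (hα.top c))]
      · rw [hα.ladderCycle_pole]; linarith
    have nonneg : ∀ c, K.angle α c = 0 → 0 ≤ hα.ladderCycle σ c := by
      intro c hc
      rcases hα.side_cases c with h | h | h
      · exfalso
        have h2 : K.angle α c = Real.pi := by rw [h]; exact (hα.top c).2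
        rw [hc] at h2
        exact Real.pi_pos.ne h2
      · rw [h, hα.ladderCycle_upper]; exact h0 _
      · rw [h, hα.ladderCycle_pole]
    rcases hα.angle_eq c with hc | hc
    · rw [hc] at k1 k2 k3 ⊢
      linarith [nonneg _ hc, nonneg _ k1, nonneg _ k2, nonneg _ k3]
    · have hc' : K.angle α c = Real.pi := hc
      rw [hc']
      linarith [lower c, lower (K.relabel klein₁ c), lower (K.relabel klein₂ c),
        lower (K.relabel klein₃ c)]

/-- The angles of `α` are flat angles corrected by a cycle. The correction is invisible to the
holonomy, because the crossing numbers with all ladders have sum zero. -/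
theorem IsVeering.angle_eq_roughAngle (hα : K.IsVeering α) (c : K.Corner) :
    K.angle α c = hα.roughAngle c - Real.pi / 2 * hα.ladderCycle 1 c := by
  have hz : ∀ p : K.Wide α, K.angle α (K.upper α p) = 0 ∧ K.angle α (K.pole α p) = 0 := by
    intro p
    have h1 := hα.angle_ccw p.2
    have h2 := hα.angle_ccw_symm p.2
    by_cases h : K.LeftVeering α p
    · rw [upper_of_left h, pole_of_left h]; exact ⟨h1, h2⟩
    · rw [upper_of_not_left h, pole_of_not_left h]; exact ⟨h2, h1⟩
  rcases hα.side_cases c with h | h | h <;> rw [h] <;> generalize hα.top c = p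
  · have h1 : K.angle α p = Real.pi := p.2
    rw [h1, roughAngle, hα.ofSides_wide, hα.ladderCycle_wide, Pi.one_apply]; ring
  · rw [(hz p).1, roughAngle, hα.ofSides_upper, hα.ladderCycle_upper, Pi.one_apply]; ring
  · rw [(hz p).2, roughAngle, hα.ofSides_pole, hα.ladderCycle_pole, Pi.zero_apply]; ring

/-- The crossing numbers with all ladders have sum zero. -/
theorem IsVeering.sum_crossingHom (hα : K.IsVeering α) [Fintype hα.ladders.Line] (x : K.H1) :
    ∑ A, hα.crossingHom A x = 0 := by
  have h : ∑ A, hα.crossingHom (hα.ladders.flipLine true A) x = ∑ A, hα.crossingHom A x :=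
    Equiv.sum_comp (Function.Involutive.toPerm _ (hα.ladders.flipLine_flipLine true))
      fun A => hα.crossingHom A x
  simp only [hα.crossingHom_flipLine, Finset.sum_neg_distrib] at h
  omega

/-- The real parts of the sides form a ladder cycle with weights `-ε`. The horizontal translation is
therefore a pairing, and counts the strips of width one that are crossed to the right. -/
theorem FlatStructure.re_period {hα : K.IsVeering α} [Fintype hα.ladders.Line]
    {ε : hα.ladders.Line → ℤ} {Φ : FlatStructure hα}
    (hΦ : ∀ p, Φ.sgn p = ε (hα.ladders.line p)) (γ : K.NormalCurve) :
    (Φ.period γ).re = ∑ A, (ε A * hα.crossingHom A γ.homologyClass : ℤ) := by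
  have hw : ∀ d, (Φ.side d).re = hα.ladderCycle (fun A => - (ε A : ℝ)) d := by
    intro d
    rcases hα.side_cases d with h | h | h <;> rw [h] <;> generalize hα.top d = p
    · rw [Φ.side_wide, Φ.rung_re, hα.ladderCycle_wide, hΦ, neg_neg]
    · rw [Φ.side_upper, Complex.neg_re, Φ.rung_re, hα.ladderCycle_upper, Φ.sgn_up, hΦ]
    · rw [hα.ladderCycle_pole]
      by_cases hl : K.LeftVeering α p
      · rw [Φ.side_pole_left hl, Complex.neg_re, Φ.rise_re, neg_zero]
      · rw [Φ.side_pole_right hl, Φ.rise_re]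
  have h1 : (Φ.period γ).re =
      ∑ i, ((Φ.toMid (γ.exit i)).re - (Φ.toMid (γ.entry i)).re) := by
    rw [period, Complex.re_sum, Finset.sum_sub_distrib]
    simp only [jump, Complex.sub_re, Finset.sum_sub_distrib]
    congr 1
    rw [← Equiv.sum_comp (Equiv.addRight (1 : ZMod γ.len)) fun i => (Φ.toMid (γ.entry i)).re]
    exact Finset.sum_congr rfl fun i _ => by rw [Equiv.coe_addRight, γ.entry_succ]
  have h2 := γ.sum_chain_mul fun d => (Φ.toMid d).re
  have h3 := hα.pairing_ladderCycle_eq (fun A => - (ε A : ℝ)) (isRealCycle_of_mem γ.chain_mem)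
  rw [h1, ← h2]
  have h4 : ∀ d, (Φ.toMid d).re = (hα.ladderCycle (fun A => - (ε A : ℝ)) (K.ccw.symm d) -
      hα.ladderCycle (fun A => - (ε A : ℝ)) (K.ccw d)) / 3 / 2 := by
    intro d
    rw [← hw, ← hw, toMid, ← Complex.ofReal_ofNat, Complex.div_ofReal_re, Complex.sub_re]
    ring
  rw [pairing, Finset.sum_div] at h3
  have h5 : ∑ d, (γ.chain d : ℝ) * (Φ.toMid d).re = (∑ d, (γ.chain d : ℝ) *
      (hα.ladderCycle (fun A => - (ε A : ℝ)) (K.ccw.symm d) -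
      hα.ladderCycle (fun A => - (ε A : ℝ)) (K.ccw d)) / 3) / 2 := by
    rw [Finset.sum_div]
    exact Finset.sum_congr rfl fun d _ => by rw [h4]; ring
  rw [h5, h3]
  simp only [hα.crossingHom_curve]
  push_cast
  simp only [hα.crossing_cast, neg_mul, Finset.sum_neg_distrib]
  ring

/-- The turning angle of a curve that crosses the ladders. -/
theorem IsVeering.turningAngle_eq (hα : K.IsVeering α) [Fintype hα.ladders.Line]
    (σ : hα.ladders.Line → ℝ) {Φ : FlatStructure hα} {γ : K.NormalCurve} (hV : Φ.period γ ≠ 0) :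
    γ.turningAngle (α + K.tetDeform (hα.ladderCycle σ)) =
      - 2 * ∑ A, σ A * hα.crossingHom A γ.homologyClass := by
  have hw := hα.isRealCycle_ladderCycle σ
  have h1 := hα.isRealCycle_ladderCycle 1
  have hz := isRealCycle_of_mem γ.chain_mem
  have hr := Φ.sum_roughAngle hV
  -- `B` is the difference between the deformed angles and the rough angles. It has sum zero in each
  -- triangle, so its turning is a pairing.
  set B : K.Corner → ℝ :=
    (-(Real.pi / 2)) • hα.ladderCycle 1 + K.angle (K.tetDeform (hα.ladderCycle σ)) with hB
  have hBs : ∀ d, B d + B (K.ccw d) + B (K.ccw.symm d) = 0 := by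
    intro d
    have e1 := h1.sum d
    have e2 := hw.angle_sum d
    simp only [hB, Pi.add_apply, Pi.smul_apply, smul_eq_mul]
    linear_combination (-(Real.pi / 2)) * e1 + e2
  have h2 : ∀ c, K.angle (α + K.tetDeform (hα.ladderCycle σ)) c = hα.roughAngle c + B c := by
    intro c
    rw [angle_add, hα.angle_eq_roughAngle]
    simp only [hB, Pi.add_apply, Pi.smul_apply, smul_eq_mul]
    ring
  have h3 : γ.turningAngle (α + K.tetDeform (hα.ladderCycle σ)) =
      (∑ i, if γ.left i then hα.roughAngle (γ.corner i) else - hα.roughAngle (γ.corner i)) +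
      ∑ i, if γ.left i then B (γ.corner i) else - B (γ.corner i) := by
    rw [NormalCurve.turningAngle, ← Finset.sum_add_distrib]
    refine Finset.sum_congr rfl fun i _ => ?_
    simp only [h2]
    split_ifs <;> ring
  have h4 := congrArg (fun n : ℤ => (n : ℝ)) (hα.sum_crossingHom γ.homologyClass)
  push_cast at h4
  rw [h3, hr, zero_add, γ.turning_eq_pairing hBs, hB, pairing_add_left, pairing_smul_left,
    hw.pairing_angle hz, hα.pairing_ladderCycle_eq _ hz, hα.pairing_ladderCycle_eq _ hz]
  simp only [hα.crossingHom_curve, hα.crossing_cast] at h4 ⊢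
  simp only [Pi.one_apply, one_mul]
  rw [h4]
  ring

/-- The holonomy of a complement of the slope of the ladders. -/
theorem IsLadderComplement.hasHolonomy (hα : K.IsVeering α) [Fintype hα.ladders.Line]
    {T : K.Cusp} {δ : K.H1} (hδ : K.IsLadderComplement α T δ) (σ : hα.ladders.Line → ℝ) :
    K.HasHolonomy (α + K.tetDeform (hα.ladderCycle σ)) δ
      (- 2 * ∑ A, σ A * hα.crossingHom A δ) := by
  classical
  obtain ⟨A₀, γ₀, n₀, hA₀, hn₀, hc, hγ₀, hγ₀δ⟩ := hδ.exists_curve hα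
  refine ⟨⟨γ₀, n₀, hγ₀, hγ₀δ⟩, fun γ n _ hn => ?_⟩
  obtain ⟨ε, hε⟩ := hα.exists_coloring
  obtain ⟨Φ, hΦ⟩ := hε.exists_flatStructure
  have hδT : δ ∈ K.cuspH1 T := by
    obtain ⟨_, -, -, h⟩ := hδ
    rw [← h]
    exact AddSubgroup.mem_sup_right (AddSubgroup.mem_zmultiples δ)
  have h1 : ∀ A, n * hα.crossingHom A γ.homologyClass = hα.crossingHom A δ := fun A => by
    rw [← hn, map_zsmul, smul_eq_mul]
  have hne : n * hα.crossingHom A₀ γ.homologyClass ≠ 0 := by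
    rw [h1, hc]; rcases hn₀ with rfl | rfl <;> decide
  have hn0 : n ≠ 0 := left_ne_zero_of_mul hne
  have hV : Φ.period γ ≠ 0 := by
    intro h0
    have h2 := FlatStructure.re_period hΦ γ
    rw [h0, Complex.zero_re, eq_comm, Int.cast_eq_zero] at h2
    -- The nonzero summands of the horizontal translation are equal, one for each ladder of `T`, so
    -- the sum cannot vanish.
    have h3 : ∀ A, ε A * hα.crossingHom A γ.homologyClass =
        if hα.cuspOfLine A = T then ε A₀ * hα.crossingHom A₀ γ.homologyClass else 0 := by
      intro A
      split_ifs with hA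
      · exact hε.mul_crossingHom (hA.trans hA₀.symm) _
      · have := h1 A
        rw [hα.crossingHom_of_mem_cuspH1 hδT hA] at this
        rw [(mul_eq_zero.1 this).resolve_left hn0, mul_zero]
    rw [Finset.sum_congr rfl fun A _ => h3 A] at h2
    rw [← Finset.sum_filter, Finset.sum_const, nsmul_eq_mul] at h2
    rcases mul_eq_zero.1 h2 with h4 | h4
    · rw [Nat.cast_eq_zero, Finset.card_eq_zero] at h4
      exact Finset.notMem_empty A₀ (h4 ▸ Finset.mem_filter.2 ⟨Finset.mem_univ _, hA₀⟩)
    · rcases mul_eq_zero.1 h4 with h5 | h5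
      · rcases hε.eq_or A₀ with h6 | h6 <;> rw [h6] at h5 <;> norm_num at h5
      · exact right_ne_zero_of_mul hne h5
  rw [hα.turningAngle_eq σ hV]
  rw [mul_left_comm, Finset.mul_sum]
  congr 1
  exact Finset.sum_congr rfl fun A _ => by rw [← h1]; push_cast; ring

theorem IsVeering.exists_nonneg_hasHolonomy (hα : K.IsVeering α)
    {k : K.Cusp → ℕ} (hk : ∀ T, K.ladderCount α T = 2 * k T)
    {δ : K.Cusp → K.H1} (hδ : ∀ T, K.IsLadderComplement α T (δ T))
    {x : K.Cusp → ℝ} (hx : ∀ T, |x T| ≤ k T * Real.pi / 2) :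
    ∃ θ : ι → Fin 3 → ℝ, K.IsNonnegAngleStructure θ ∧
      ∀ T, K.HasHolonomy θ (δ T) (x T) := by
  classical
  have := Fintype.ofFinite hα.ladders.Line
  obtain ⟨ε, hε⟩ := hα.exists_coloring
  have hε2 : ∀ A, ε A * ε A = 1 := fun A => by
    rcases hε.eq_or A with h | h <;> rw [h] <;> rfl
  -- The sign `v` records which colour of ladders `δ T` crosses from left to right.
  have hv : ∀ T, ∃ v : ℤ, v * v = 1 ∧
      ∀ A, hα.crossingHom A (δ T) = if hα.cuspOfLine A = T then ε A * v else 0 := by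
    intro T
    obtain ⟨A₀, -, n₀, hA₀, hn₀, hc, -⟩ := (hδ T).exists_curve hα
    refine ⟨ε A₀ * n₀, ?_, fun A => ?_⟩
    · have h1 := hε2 A₀
      have h2 : n₀ * n₀ = 1 := by rcases hn₀ with rfl | rfl <;> rfl
      linear_combination n₀ * n₀ * h1 + h2
    · split_ifs with hA
      · have h1 := hε.mul_crossingHom (hA.trans hA₀.symm) (δ T)
        have h2 := hε2 A
        rw [hc] at h1
        linear_combination (- hα.crossingHom A (δ T)) * h2 + ε A * h1
      · refine hα.crossingHom_of_mem_cuspH1 ?_ hA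
        obtain ⟨_, -, -, h⟩ := hδ T
        rw [← h]
        exact AddSubgroup.mem_sup_right (AddSubgroup.mem_zmultiples _)
  choose v hv1 hv2 using hv
  have hcard : ∀ T, ((Finset.univ.filter fun A => hα.cuspOfLine A = T).card : ℝ) = 2 * k T := by
    intro T
    have h1 := hk T
    rw [hα.ladderCount_eq, Set.ncard_eq_toFinset_card', Set.toFinset_ofPred] at h1
    exact_mod_cast h1
  have hkpos : ∀ A, 0 < (k (hα.cuspOfLine A) : ℝ) := by
    intro A
    have h1 := hcard (hα.cuspOfLine A)
    have h2 : 0 < (Finset.univ.filter fun B => hα.cuspOfLine B = hα.cuspOfLine A).card :=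
      Finset.card_pos.2 ⟨A, Finset.mem_filter.2 ⟨Finset.mem_univ _, rfl⟩⟩
    have h3 : (0 : ℝ) < (Finset.univ.filter fun B => hα.cuspOfLine B = hα.cuspOfLine A).card := by
      exact_mod_cast h2
    linarith
  -- One colour gets the weight `|x| / (2 * k)` and the other gets zero, according to the sign of
  -- `x` and the direction of crossing. The terms in `|x|` cancel between adjacent ladders, and
  -- those in `x` add up to the prescribed holonomy.
  set σ : hα.ladders.Line → ℝ := fun A =>
    (|x (hα.cuspOfLine A)| - ε A * v (hα.cuspOfLine A) * x (hα.cuspOfLine A)) /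
      (4 * k (hα.cuspOfLine A)) with hσ
  have hsign : ∀ A, ((ε A : ℝ) * v (hα.cuspOfLine A) = 1 ∨
      (ε A : ℝ) * v (hα.cuspOfLine A) = -1) := by
    intro A
    have h1 := hv1 (hα.cuspOfLine A)
    have h2 := hε2 A
    have h3 : (ε A * v (hα.cuspOfLine A)) * (ε A * v (hα.cuspOfLine A)) = 1 := by
      linear_combination ε A * ε A * h1 + h2
    rcases Int.eq_one_or_neg_one_of_mul_eq_one h3 with h | h
    · left; exact_mod_cast h
    · right; exact_mod_cast h
  refine ⟨α + K.tetDeform (hα.ladderCycle σ), hα.isNonnegAngleStructure ?_ ?_, fun T => ?_⟩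
  · intro A
    refine div_nonneg ?_ (by linarith [hkpos A])
    rcases hsign A with h | h <;> rw [h]
    · linarith [le_abs_self (x (hα.cuspOfLine A))]
    · linarith [neg_abs_le (x (hα.cuspOfLine A))]
  · intro A
    have h1 := hx (hα.cuspOfLine A)
    rw [hσ, div_le_iff₀ (by linarith [hkpos A])]
    rcases hsign A with h | h <;> rw [h]
    · linarith [neg_abs_le (x (hα.cuspOfLine A))]
    · linarith [le_abs_self (x (hα.cuspOfLine A))]
  · have h1 := (hδ T).hasHolonomy hα σ
    convert h1 using 1
    have h2 : ∀ A, σ A * (hα.crossingHom A (δ T) : ℝ) =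
        (|x T| * (hα.crossingHom A (δ T) : ℝ) - if hα.cuspOfLine A = T then x T else 0) /
          (4 * k T) := by
      intro A
      rw [hv2, hσ]
      split_ifs with hA
      · subst hA
        have h3 : ((ε A : ℝ) * v (hα.cuspOfLine A)) * ((ε A : ℝ) * v (hα.cuspOfLine A)) = 1 := by
          rcases hsign A with h | h <;> rw [h] <;> norm_num
        push_cast
        rw [div_mul_eq_mul_div]
        congr 1
        linear_combination (- x (hα.cuspOfLine A)) * h3
      · simp
    have h4 := congrArg (fun n : ℤ => (n : ℝ)) (hα.sum_crossingHom (δ T))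
    push_cast at h4
    simp only [h2]
    rw [← Finset.sum_div, Finset.sum_sub_distrib, ← Finset.mul_sum, h4, ← Finset.sum_filter,
      Finset.sum_const, nsmul_eq_mul, hcard]
    obtain ⟨A₀, -, -, rfl, -⟩ := (hδ T).exists_curve hα
    have := hkpos A₀
    field_simp
    ring

end IdealTriangulation
end

theorem proposition5p5 {ι : Type*} [Fintype ι] (K : IdealTriangulation ι)
    (α : ι → Fin 3 → ℝ) (hα : K.IsVeering α)
    (k : K.Cusp → ℕ) (hk : ∀ T, K.ladderCount α T = 2 * k T)
    (δ : K.Cusp → K.H1) (hδ : ∀ T, K.IsLadderComplement α T (δ T)) :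
    (∀ ε : K.Cusp → ℝ, (∀ T, ε T = 1 ∨ ε T = -1) →
      ∃ θ : ι → Fin 3 → ℝ, K.IsNonnegAngleStructure θ ∧
        ∀ T, K.HasHolonomy θ (δ T) (ε T * k T * Real.pi / 2)) ∧
    (∀ x : K.Cusp → ℝ, (∀ T, |x T| ≤ k T * Real.pi / 2) →
      ∃ θ : ι → Fin 3 → ℝ, K.IsNonnegAngleStructure θ ∧
        ∀ T, K.HasHolonomy θ (δ T) (x T)) := by
  refine ⟨fun ε hε => hα.exists_nonneg_hasHolonomy hk hδ fun T => ?_,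
    fun x hx => hα.exists_nonneg_hasHolonomy hk hδ hx⟩
  have h : (0 : ℝ) ≤ k T * Real.pi / 2 := by positivity
  rcases hε T with h1 | h1 <;> rw [h1]
  · rw [one_mul, abs_of_nonneg h]
  · rw [show (-1 : ℝ) * k T * Real.pi / 2 = -(k T * Real.pi / 2) by ring, abs_neg,
      abs_of_nonneg h]
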